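/- Let $(X_i)_{i\ge1}$ be independent random variables with values in $\mathbb Z_+=\{0,1,2,\dots\}$, let $S_{a,n}:=\sum_{i=a+1}^n X_i$, and write $\mathcal L(Y)$ for the law of $Y$ and $d_{TV}(\mu,\nu):=\sup_{A\subseteq\mathbb Z_+}|\mu(A)-\nu(A)|$. For $i,d\ge1$ set $$q(i,d):=\min\{P[X_i=0]\,P[X_{i+d}=i+d],\ P[X_i=i]\,P[X_{i+d}=0]\}.$$ Let $k\ge1$ be an integer and $\psi>0$ a real number, and suppose that, for every $j\ge1$, the block $\{jk+1,\dots,(j+1)k\}$ satisfies both of the following: (i) for every $d\in D:=\{2^{g+1}: g\ge0\}$, the block contains an index $i$ with $q(i,d)\ge\psi/(i+d)$; (ii) the block contains an odd index $i$ with $\min\{P[X_i=0],P[X_i=i]\}\ge\psi/i$. Then there exist constants $C,\gamma>0$, depending only on $k$ and $\psi$, such that $$d_{TV}\bigl(\mathcal L(S_{a,n}),\mathcal L(S_{a,n}+1)\bigr)\ \le\ C\left\{\frac{a+1}{n}\right\}^{\gamma}\qquad\text{for all integers } 0\le a<n.$$ -/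

import Mathlib

open MeasureTheory ProbabilityTheory

namespace UnitShift

noncomputable section

/-- Total variation distance of two laws on `ℕ`: the supremum over all `A ⊆ ℕ` of
`|μ A - ν A|`. For probability measures the supremum is over a set bounded by `1`. -/
def dTV (μ ν : Measure ℕ) : ℝ := ⨆ A : Set ℕ, |μ.real A - ν.real A|

variable {Ω : Type*} [MeasurableSpace Ω]

/-- The partial sum `S_{a,n} = X_{a+1} + ... + X_n`. -/
def partialSum (X : ℕ → Ω → ℕ) (a n : ℕ) (ω : Ω) : ℕ := ∑ i ∈ Finset.Ioc a n, X i ω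

/-- `q(i,d) = min (P[X_i = 0] P[X_{i+d} = i+d], P[X_i = i] P[X_{i+d} = 0])`. -/
def pairOverlap (P : Measure Ω) (X : ℕ → Ω → ℕ) (i d : ℕ) : ℝ :=
  min (P.real {ω | X i ω = 0} * P.real {ω | X (i + d) ω = i + d})
    (P.real {ω | X i ω = i} * P.real {ω | X (i + d) ω = 0})

/-- `E(d,ψ)`, the set of indices `i ≥ 1` with `q(i,d) ≥ ψ / (i + d)`. -/
def pairIndices (P : Measure Ω) (X : ℕ → Ω → ℕ) (d : ℕ) (ψ : ℝ) : Set ℕ :=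
  {i | 1 ≤ i ∧ ψ / ((i : ℝ) + (d : ℝ)) ≤ pairOverlap P X i d}

/-- The pair condition: for every step size `d ∈ D`, each block `{jk+1, ..., (j+1)k}` with
`j ≥ 1` meets `E(d,ψ)`. -/
def PairCondition (P : Measure Ω) (X : ℕ → Ω → ℕ) (D : Set ℕ) (k : ℕ) (ψ : ℝ) : Prop :=
  ∀ d ∈ D, ∀ j : ℕ, 1 ≤ j →
    (pairIndices P X d ψ ∩ Set.Icc (j * k + 1) ((j + 1) * k)).Nonempty

/-- `min (P[X_i = 0], P[X_i = i])`. -/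
def singleOverlap (P : Measure Ω) (X : ℕ → Ω → ℕ) (i : ℕ) : ℝ :=
  min (P.real {ω | X i ω = 0}) (P.real {ω | X i ω = i})

/-- The set of odd indices `i` with `min (P[X_i = 0], P[X_i = i]) ≥ ψ / i`. -/
def oddIndices (P : Measure Ω) (X : ℕ → Ω → ℕ) (ψ : ℝ) : Set ℕ :=
  {i | Odd i ∧ ψ / (i : ℝ) ≤ singleOverlap P X i}

/-- The single-index condition: each block `{jk+1, ..., (j+1)k}` with `j ≥ 1` contains an
odd `i` with `min (P[X_i = 0], P[X_i = i]) ≥ ψ / i`. -/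
def OddCondition (P : Measure Ω) (X : ℕ → Ω → ℕ) (k : ℕ) (ψ : ℝ) : Prop :=
  ∀ j : ℕ, 1 ≤ j → (oddIndices P X ψ ∩ Set.Icc (j * k + 1) ((j + 1) * k)).Nonempty

end

end UnitShift

/-! A finitely supported signed measure on `ℤ` is encoded as a Laurent polynomial: convolution
becomes multiplication and a shift by `n` becomes `T n`. After truncation of the variables, the
distance is bounded by the `ℓ¹` norm of `(1 - T 1) * ∏ p i`, where `p i` is the law of the `i`-th
variable.

Odd indices reduce the unit shift to even shifts, since `(1 - T)(1 + T^i) = (1 - T^(i+1)) - T(1 -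
T^(i-1))` (`l1_unit_shift_le_of_even`). The odd indices up to about `√((a+1)n)` supply such a factor
except with power-small probability, and the indices beyond smooth out the even shift
(`l1_even_shift_le`).

Even shifts are treated by a recursion over windows `(M, 3M]` (`window_step`). A fair choice between
`0` and `i` is extracted from `p i`; by Parseval and Cauchy–Schwarz the squared `ℓ¹` norm is at most
the length of the support times an integral over the circle. Fair choices at `i` and `i + d`
together damp the frequencies `θ` for which `dθ` is far from the integers. With dyadic `d` this
reaches every `θ` not within order `1/M` of `0`, `1/2` or `1`, where an even shift is itself small.
The damping is only a small power of `a/M`, too weak against a support of length of order `M`.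

The missing factor `1/M` comes from a hidden selection. Take about `M/(16k)` indices of the window
with mass at least `1/L` at one of `0, i` and at least `ψ/(3M)` at the other. With probability
bounded below, exactly one of them takes the chosen atom of the lighter value, and its position is
then uniform on a set `B` of distinct indices; this spreads the law out in `ℓ²`
(`l1_mul_prod_le_hidden`, `integral_hidSq_le`). On the complementary event the norm from before the
window is kept, so the norm contracts by a constant up to a power of `a/M`.

A large `L` costs a factor `L²`. If `L` is minimal, most pairs have masses at most `1/(L-1)` at `0`
and `i`; the overlap condition then forces the partner's masses up to order `ψ(L-1)/M`, and the
extra damping `exp(-c(L-1))` pays for `L²` (`exists_hidden_indices`). -/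

namespace UnitShift

noncomputable section

open scoped LaurentPolynomial
open LaurentPolynomial (T C)

/-! ### Laurent polynomials as finitely supported signed measures on `ℤ` -/

/-- The `ℓ¹` norm of the coefficients. -/
def l1 (p : ℝ[T;T⁻¹]) : ℝ := ∑ x ∈ p.coeff.support, |p.coeff x|

lemma l1_eq_sum {p : ℝ[T;T⁻¹]} {s : Finset ℤ} (h : p.coeff.support ⊆ s) :
    l1 p = ∑ x ∈ s, |p.coeff x| :=
  Finset.sum_subset h fun x _ hx => by simpa using hx

lemma l1_nonneg (p : ℝ[T;T⁻¹]) : 0 ≤ l1 p := Finset.sum_nonneg fun _ _ => abs_nonneg _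

lemma l1_zero : l1 0 = 0 := by simp [l1]

lemma l1_add_le (p q : ℝ[T;T⁻¹]) : l1 (p + q) ≤ l1 p + l1 q := by
  classical
  have hs : (p + q).coeff.support ⊆ p.coeff.support ∪ q.coeff.support := by
    rw [AddMonoidAlgebra.coeff_add]; exact Finsupp.support_add
  rw [l1_eq_sum hs, l1_eq_sum (p := p) (Finset.subset_union_left (s₂ := q.coeff.support)),
    l1_eq_sum (p := q) (Finset.subset_union_right (s₁ := p.coeff.support)),
    ← Finset.sum_add_distrib]
  exact Finset.sum_le_sum fun x _ => by simpa using abs_add_le _ _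

lemma l1_sum_le {ι : Type*} (s : Finset ι) (f : ι → ℝ[T;T⁻¹]) :
    l1 (∑ i ∈ s, f i) ≤ ∑ i ∈ s, l1 (f i) :=
  Finset.le_sum_of_subadditive l1 l1_zero.le l1_add_le s f

lemma coeff_C_mul (c : ℝ) (p : ℝ[T;T⁻¹]) (x : ℤ) : (C c * p).coeff x = c * p.coeff x := by
  rw [← LaurentPolynomial.smul_eq_C_mul]; simp

lemma coeff_T_mul (n : ℤ) (p : ℝ[T;T⁻¹]) (x : ℤ) : (T n * p).coeff x = p.coeff (x - n) := by
  rw [LaurentPolynomial.T, AddMonoidAlgebra.coeff_single_mul_apply, one_mul, neg_add_eq_sub]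

lemma l1_C_mul (c : ℝ) (p : ℝ[T;T⁻¹]) : l1 (C c * p) = |c| * l1 p := by
  have hs : (C c * p).coeff.support ⊆ p.coeff.support := by
    intro x hx
    simp only [Finsupp.mem_support_iff, coeff_C_mul] at hx ⊢
    exact right_ne_zero_of_mul hx
  rw [l1_eq_sum hs, l1, Finset.mul_sum]
  exact Finset.sum_congr rfl fun x _ => by rw [coeff_C_mul, abs_mul]

lemma l1_T_mul_le (n : ℤ) (p : ℝ[T;T⁻¹]) : l1 (T n * p) ≤ l1 p := by
  classical
  have hs : (T n * p).coeff.support ⊆ p.coeff.support.map (Equiv.addRight n).toEmbedding := by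
    intro x hx
    simp only [Finsupp.mem_support_iff, coeff_T_mul] at hx
    simp only [Finset.mem_map_equiv, Finsupp.mem_support_iff]
    simpa [sub_eq_add_neg] using hx
  rw [l1_eq_sum hs, l1, Finset.sum_map]
  exact Finset.sum_le_sum fun x _ => by rw [coeff_T_mul]; simp

lemma l1_T_mul (n : ℤ) (p : ℝ[T;T⁻¹]) : l1 (T n * p) = l1 p := by
  refine le_antisymm (l1_T_mul_le n p) ?_
  calc l1 p = l1 (T (-n) * (T n * p)) := by rw [← mul_assoc, ← LaurentPolynomial.T_add]; simp
    _ ≤ _ := l1_T_mul_le _ _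

lemma eq_sum_C_mul_T (p : ℝ[T;T⁻¹]) : p = ∑ x ∈ p.coeff.support, C (p.coeff x) * T x := by
  conv_lhs => rw [← AddMonoidAlgebra.sum_coeff_single p]
  exact Finset.sum_congr rfl fun x _ => LaurentPolynomial.single_eq_C_mul_T _ _

lemma l1_mul_le (p q : ℝ[T;T⁻¹]) : l1 (p * q) ≤ l1 p * l1 q := by
  conv_lhs => rw [eq_sum_C_mul_T p, Finset.sum_mul]
  refine (l1_sum_le _ _).trans ?_
  rw [l1, Finset.sum_mul]
  exact Finset.sum_le_sum fun x _ => by rw [mul_assoc, l1_C_mul, l1_T_mul]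

/-- All coefficients are nonnegative. -/
def IsNonneg (p : ℝ[T;T⁻¹]) : Prop := ∀ x, 0 ≤ p.coeff x

lemma IsNonneg.add {p q : ℝ[T;T⁻¹]} (hp : IsNonneg p) (hq : IsNonneg q) : IsNonneg (p + q) :=
  fun x => by simpa using add_nonneg (hp x) (hq x)

lemma IsNonneg.sum {ι : Type*} {s : Finset ι} {f : ι → ℝ[T;T⁻¹]} (h : ∀ i ∈ s, IsNonneg (f i)) :
    IsNonneg (∑ i ∈ s, f i) := by
  classical
  induction s using Finset.induction_on with
  | empty => intro x; simp
  | insert a s ha ih =>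
    rw [Finset.sum_insert ha]
    exact (h a (by simp)).add (ih fun i hi => h i (by simp [hi]))

lemma IsNonneg.C_mul {p : ℝ[T;T⁻¹]} (hp : IsNonneg p) {c : ℝ} (hc : 0 ≤ c) :
    IsNonneg (C c * p) := fun x => by rw [coeff_C_mul]; exact mul_nonneg hc (hp x)

lemma IsNonneg.T_mul {p : ℝ[T;T⁻¹]} (hp : IsNonneg p) (n : ℤ) : IsNonneg (T n * p) :=
  fun x => by rw [coeff_T_mul]; exact hp _

lemma isNonneg_T (n : ℤ) : IsNonneg (T n) := fun x => by
  rw [LaurentPolynomial.T_apply]; split_ifs <;> norm_num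

lemma isNonneg_one : IsNonneg 1 := by simpa using isNonneg_T 0

lemma IsNonneg.mul {p q : ℝ[T;T⁻¹]} (hp : IsNonneg p) (hq : IsNonneg q) : IsNonneg (p * q) := by
  rw [eq_sum_C_mul_T p, Finset.sum_mul]
  exact IsNonneg.sum fun x _ => by rw [mul_assoc]; exact (hq.T_mul x).C_mul (hp x)

lemma IsNonneg.prod {ι : Type*} {s : Finset ι} {f : ι → ℝ[T;T⁻¹]} (h : ∀ i ∈ s, IsNonneg (f i)) :
    IsNonneg (∏ i ∈ s, f i) := by
  classical
  induction s using Finset.induction_on with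
  | empty => simpa using isNonneg_one
  | insert a s ha ih =>
    rw [Finset.prod_insert ha]
    exact (h a (by simp)).mul (ih fun i hi => h i (by simp [hi]))

/-- The sum of all coefficients. -/
def mass : ℝ[T;T⁻¹] →+* ℝ := LaurentPolynomial.eval₂ (RingHom.id ℝ) 1

@[simp] lemma mass_T (n : ℤ) : mass (T n) = 1 := by simp [mass]

@[simp] lemma mass_C (c : ℝ) : mass (C c) = c := by simp [mass]

lemma mass_eq_sum (p : ℝ[T;T⁻¹]) : mass p = ∑ x ∈ p.coeff.support, p.coeff x := by
  conv_lhs => rw [eq_sum_C_mul_T p]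
  simp

lemma IsNonneg.l1_eq {p : ℝ[T;T⁻¹]} (hp : IsNonneg p) : l1 p = mass p := by
  rw [mass_eq_sum, l1]
  exact Finset.sum_congr rfl fun x _ => abs_of_nonneg (hp x)

lemma l1_T (n : ℤ) : l1 (T n) = 1 := by rw [(isNonneg_T n).l1_eq, mass_T]

/-- The sum of the squares of the coefficients. -/
def l2sq (p : ℝ[T;T⁻¹]) : ℝ := ∑ x ∈ p.coeff.support, p.coeff x ^ 2

lemma l1_sq_le {p : ℝ[T;T⁻¹]} {s : Finset ℤ} (h : p.coeff.support ⊆ s) :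
    l1 p ^ 2 ≤ s.card * l2sq p := by
  have h2 : l2sq p = ∑ x ∈ s, |p.coeff x| ^ 2 := by
    simp_rw [sq_abs]
    exact Finset.sum_subset h fun x _ hx => by simpa using hx
  rw [l1_eq_sum h, h2]
  exact sq_sum_le_card_mul_sum_sq

/-! ### Fourier analysis on the circle. -/

/-- The characteristic function at `2πθ`. -/
def char (θ : ℝ) : ℝ[T;T⁻¹] →+* ℂ :=
  LaurentPolynomial.eval₂ (algebraMap ℝ ℂ) (Circle.toUnits (Circle.exp (2 * Real.pi * θ)))

lemma char_T (θ : ℝ) (n : ℤ) :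
    char θ (T n) = Complex.exp ((2 * Real.pi * θ * n : ℝ) * Complex.I) := by
  rw [char, LaurentPolynomial.eval₂_T]
  have : (((Circle.toUnits (Circle.exp (2 * Real.pi * θ))) ^ n : ℂˣ) : ℂ)
      = ((Circle.exp (2 * Real.pi * θ) : Circle) : ℂ) ^ n := by simp
  rw [this, Circle.coe_exp, ← Complex.exp_int_mul]
  push_cast; ring_nf

@[simp] lemma char_C (θ c : ℝ) : char θ (C c) = c := by simp [char]

lemma normSq_char (θ : ℝ) (p : ℝ[T;T⁻¹]) :
    Complex.normSq (char θ p) = ∑ x ∈ p.coeff.support, ∑ y ∈ p.coeff.support,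
      p.coeff x * p.coeff y * Real.cos (2 * Real.pi * θ * (x - y)) := by
  have h : char θ p = ∑ x ∈ p.coeff.support,
      (p.coeff x : ℂ) * Complex.exp ((2 * Real.pi * θ * x : ℝ) * Complex.I) := by
    conv_lhs => rw [eq_sum_C_mul_T p]
    simp [char_T]
  have hre : (char θ p).re = ∑ x ∈ p.coeff.support, p.coeff x * Real.cos (2 * Real.pi * θ * x) := by
    rw [h, Complex.re_sum]
    exact Finset.sum_congr rfl fun x _ => by rw [Complex.re_ofReal_mul, Complex.exp_ofReal_mul_I_re]
  have him : (char θ p).im = ∑ x ∈ p.coeff.support, p.coeff x * Real.sin (2 * Real.pi * θ * x) := by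
    rw [h, Complex.im_sum]
    exact Finset.sum_congr rfl fun x _ => by rw [Complex.im_ofReal_mul, Complex.exp_ofReal_mul_I_im]
  rw [Complex.normSq_apply, hre, him, Finset.sum_mul_sum, Finset.sum_mul_sum,
    ← Finset.sum_add_distrib]
  refine Finset.sum_congr rfl fun x _ => ?_
  rw [← Finset.sum_add_distrib]
  refine Finset.sum_congr rfl fun y _ => ?_
  rw [mul_sub, Real.cos_sub]; ring

lemma continuous_normSq_char (p : ℝ[T;T⁻¹]) : Continuous fun θ => Complex.normSq (char θ p) := by
  simp_rw [normSq_char]; fun_prop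

lemma integral_cos_int (n : ℤ) :
    ∫ θ in (0 : ℝ)..1, Real.cos (2 * Real.pi * θ * n) = if n = 0 then 1 else 0 := by
  split_ifs with h
  · simp [h]
  · have hn : (2 * Real.pi * n : ℝ) ≠ 0 := by
      have : (n : ℝ) ≠ 0 := by exact_mod_cast h
      positivity
    have : ∀ θ : ℝ, 2 * Real.pi * θ * n = (2 * Real.pi * n) * θ := fun θ => by ring
    simp_rw [this]
    rw [intervalIntegral.integral_comp_mul_left (fun x => Real.cos x) hn, integral_cos]
    have : Real.sin (2 * Real.pi * n) = 0 := by
      rw [show 2 * Real.pi * (n : ℝ) = ((2 * n : ℤ) : ℝ) * Real.pi by push_cast; ring]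
      exact Real.sin_int_mul_pi _
    simp [this]

/-- Parseval's identity. -/
lemma integral_normSq_char (p : ℝ[T;T⁻¹]) :
    ∫ θ in (0 : ℝ)..1, Complex.normSq (char θ p) = l2sq p := by
  simp_rw [normSq_char]
  rw [intervalIntegral.integral_finsetSum fun x _ => by
    apply Continuous.intervalIntegrable; fun_prop]
  rw [l2sq]
  refine Finset.sum_congr rfl fun x hx => ?_
  rw [intervalIntegral.integral_finsetSum fun y _ => by
    apply Continuous.intervalIntegrable; fun_prop]
  rw [Finset.sum_eq_single x]
  · simp [pow_two]
  · intro y _ hy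
    rw [intervalIntegral.integral_const_mul]
    have := integral_cos_int (x - y)
    push_cast at this
    rw [this, if_neg (by omega)]; simp
  · intro h; exact absurd hx h

lemma normSq_char_one_sub_T (θ : ℝ) (n : ℤ) :
    Complex.normSq (char θ (1 - T n)) = 2 - 2 * Real.cos (2 * Real.pi * θ * n) := by
  rw [map_sub, map_one, char_T, Complex.normSq_apply]
  simp only [Complex.sub_re, Complex.sub_im, Complex.one_re, Complex.one_im,
    Complex.exp_ofReal_mul_I_re, Complex.exp_ofReal_mul_I_im]
  nlinarith [Real.sin_sq_add_cos_sq (2 * Real.pi * θ * n)]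

lemma normSq_char_one_add_T (θ : ℝ) (n : ℤ) :
    Complex.normSq (char θ (1 + T n)) = 2 + 2 * Real.cos (2 * Real.pi * θ * n) := by
  rw [map_add, map_one, char_T, Complex.normSq_apply]
  simp only [Complex.add_re, Complex.add_im, Complex.one_re, Complex.one_im,
    Complex.exp_ofReal_mul_I_re, Complex.exp_ofReal_mul_I_im]
  nlinarith [Real.sin_sq_add_cos_sq (2 * Real.pi * θ * n)]

/-! ### Mixture expansions of products -/

lemma l1_mul_prod_le_prod {ι : Type*} (s : Finset ι) (x : ℝ[T;T⁻¹]) (f : ι → ℝ[T;T⁻¹])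
    (c : ι → ℝ) (hf : ∀ i ∈ s, l1 (f i) ≤ c i) :
    l1 (x * ∏ i ∈ s, f i) ≤ l1 x * ∏ i ∈ s, c i := by
  classical
  induction s using Finset.induction_on with
  | empty => simp
  | insert a s ha ih =>
    rw [Finset.prod_insert ha, Finset.prod_insert ha, mul_left_comm (l1 x), mul_left_comm x]
    exact (l1_mul_le _ _).trans (mul_le_mul (hf a (by simp)) (ih fun i hi => hf i (by simp [hi]))
      (l1_nonneg _) ((l1_nonneg _).trans (hf a (by simp))))

/-- The product of the fair two-point laws on `{0, e i}`, `i ∈ S`. -/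
def fairProd {ι : Type*} (e : ι → ℤ) (S : Finset ι) : ℝ[T;T⁻¹] :=
  ∏ i ∈ S, C (1 / 2) * (1 + T (e i))

/-- The probability that exactly the indices in `S` are selected when `i ∈ F` is selected with
probability `2 ρ i`. -/
def selWeight {ι : Type*} [DecidableEq ι] (ρ : ι → ℝ) (F S : Finset ι) : ℝ :=
  (∏ i ∈ S, 2 * ρ i) * ∏ i ∈ F \ S, (1 - 2 * ρ i)

/-- Expand over the set `S` of indices whose fair part is taken; the other factors cost only their
`ℓ¹` norm. The factor `x` stays inside the norm, so its cancellation against the fair choices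
survives. -/
lemma l1_mul_prod_le_sum_selWeight {ι : Type*} [DecidableEq ι] (F : Finset ι)
    (p ν : ι → ℝ[T;T⁻¹]) (ρ : ι → ℝ) (e : ι → ℤ) (x : ℝ[T;T⁻¹])
    (hp : ∀ i ∈ F, p i = C (ρ i) * (1 + T (e i)) + ν i) (hρ : ∀ i ∈ F, 0 ≤ ρ i)
    (hν : ∀ i ∈ F, l1 (ν i) ≤ 1 - 2 * ρ i) :
    l1 (x * ∏ i ∈ F, p i) ≤ ∑ S ∈ F.powerset, selWeight ρ F S * l1 (x * fairProd e S) := by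
  rw [Finset.prod_congr rfl hp, Finset.prod_add, Finset.mul_sum]
  refine (l1_sum_le _ _).trans (Finset.sum_le_sum fun S hS => ?_)
  have hSF := Finset.mem_powerset.1 hS
  have h1 : ∏ i ∈ S, C (ρ i) * (1 + T (e i)) = C (∏ i ∈ S, 2 * ρ i) * fairProd e S := by
    rw [fairProd, map_prod, ← Finset.prod_mul_distrib]
    refine Finset.prod_congr rfl fun i _ => ?_
    rw [← mul_assoc, ← map_mul]; congr 2; ring
  rw [h1, ← mul_assoc, mul_left_comm]
  refine (l1_mul_prod_le_prod _ _ _ (fun i => 1 - 2 * ρ i)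
    fun i hi => hν i (Finset.mem_sdiff.1 hi).1).trans (le_of_eq ?_)
  rw [l1_C_mul, abs_of_nonneg (Finset.prod_nonneg fun i hi => by
    have := hρ i (hSF hi); positivity), selWeight]
  ring

lemma selWeight_nonneg {ι : Type*} [DecidableEq ι] {F S : Finset ι} {ρ : ι → ℝ} (hS : S ⊆ F)
    (hρ : ∀ i ∈ F, 0 ≤ ρ i) (hρ' : ∀ i ∈ F, 2 * ρ i ≤ 1) : 0 ≤ selWeight ρ F S :=
  mul_nonneg (Finset.prod_nonneg fun i hi => by have := hρ i (hS hi); positivity)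
    (Finset.prod_nonneg fun i hi => by have := hρ' i (Finset.mem_sdiff.1 hi).1; linarith)

lemma sum_selWeight {ι : Type*} [DecidableEq ι] (ρ : ι → ℝ) (F : Finset ι) :
    ∑ S ∈ F.powerset, selWeight ρ F S = 1 := by
  simp_rw [selWeight]
  rw [← Finset.prod_add]; simp

/-- Linearity of expectation for the random selected set; it will bound the mean length of the
support. -/
lemma sum_selWeight_mul_sum {ι : Type*} [DecidableEq ι] (ρ f : ι → ℝ) (F : Finset ι) :
    ∑ S ∈ F.powerset, selWeight ρ F S * ∑ i ∈ S, f i = ∑ i ∈ F, 2 * ρ i * f i := by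
  induction F using Finset.induction_on with
  | empty => simp
  | insert a F ha ih =>
    rw [Finset.sum_powerset_insert ha, Finset.sum_insert ha, ← ih]
    have h1 : ∀ S ∈ F.powerset, selWeight ρ (insert a F) S * ∑ i ∈ S, f i
        = (1 - 2 * ρ a) * (selWeight ρ F S * ∑ i ∈ S, f i) := fun S hS => by
      have haS : a ∉ S := fun h => ha (Finset.mem_powerset.1 hS h)
      rw [selWeight, Finset.insert_sdiff_of_notMem _ haS, Finset.prod_insert (by simp [ha]),
        selWeight]
      ring
    have h2 : ∀ S ∈ F.powerset, selWeight ρ (insert a F) (insert a S) * ∑ i ∈ insert a S, f i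
        = 2 * ρ a * (selWeight ρ F S * ∑ i ∈ S, f i) + 2 * ρ a * f a * selWeight ρ F S :=
      fun S hS => by
      have haS : a ∉ S := fun h => ha (Finset.mem_powerset.1 hS h)
      rw [selWeight, Finset.insert_sdiff_insert, Finset.sdiff_insert_of_notMem ha,
        Finset.prod_insert haS, Finset.sum_insert haS, selWeight]
      ring
    rw [Finset.sum_congr rfl h1, Finset.sum_congr rfl h2, Finset.sum_add_distrib,
      ← Finset.mul_sum, ← Finset.mul_sum, ← Finset.mul_sum, sum_selWeight]
    ring

/-- Independence of the selections factorizes the average, each index contributing `(1 - 2ρ) + 2ρ (1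
+ cos) / 2`. -/
lemma sum_selWeight_mul_normSq {ι : Type*} [DecidableEq ι] (ρ : ι → ℝ) (e : ι → ℤ) (F : Finset ι)
    (θ : ℝ) :
    ∑ S ∈ F.powerset, selWeight ρ F S * Complex.normSq (char θ (fairProd e S))
      = ∏ i ∈ F, (1 - ρ i * (1 - Real.cos (2 * Real.pi * θ * e i))) := by
  have h : ∀ S : Finset ι, Complex.normSq (char θ (fairProd e S))
      = ∏ i ∈ S, (1 + Real.cos (2 * Real.pi * θ * e i)) / 2 := fun S => by
    rw [fairProd, map_prod, map_prod]
    refine Finset.prod_congr rfl fun i _ => ?_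
    rw [map_mul, map_mul, normSq_char_one_add_T, char_C, Complex.normSq_ofReal]; ring
  simp_rw [h, selWeight, mul_right_comm _ (∏ i ∈ _ \ _, _), ← Finset.prod_mul_distrib]
  rw [← Finset.prod_add]
  exact Finset.prod_congr rfl fun i _ => by ring

/-! ### The hidden single selection. -/

/-- The part of `∏ i ∈ G, (a i + b i)` that takes exactly one factor `b i`. -/
def singlePart {R ι : Type*} [CommSemiring R] [DecidableEq ι] (a b : ι → R) (G : Finset ι) : R :=
  ∑ h ∈ G, b h * ∏ i ∈ G.erase h, a i

lemma singlePart_insert {R ι : Type*} [CommSemiring R] [DecidableEq ι] (a b : ι → R)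
    {G : Finset ι} {g : ι} (hg : g ∉ G) :
    singlePart a b (insert g G) = b g * ∏ i ∈ G, a i + a g * singlePart a b G := by
  rw [singlePart, Finset.sum_insert hg, Finset.erase_insert hg, singlePart, Finset.mul_sum]
  congr 1
  refine Finset.sum_congr rfl fun h hh => ?_
  have : g ≠ h := fun e => hg (e ▸ hh)
  rw [Finset.erase_insert_of_ne this, Finset.prod_insert (by simp [hg])]
  ring

/-- What remains is the sum of the terms with at least two factors `b`. -/
lemma isNonneg_prod_sub_singlePart {ι : Type*} [DecidableEq ι] (a b : ι → ℝ[T;T⁻¹])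
    (G : Finset ι) (ha : ∀ i ∈ G, IsNonneg (a i)) (hb : ∀ i ∈ G, IsNonneg (b i)) :
    IsNonneg (∏ i ∈ G, (a i + b i) - ∏ i ∈ G, a i - singlePart a b G) := by
  induction G using Finset.induction_on with
  | empty => intro x; simp [singlePart]
  | insert g G hg ih =>
    rw [singlePart_insert a b hg, Finset.prod_insert hg, Finset.prod_insert hg]
    have hag := ha g (by simp)
    have hbg := hb g (by simp)
    have ih' := ih (fun i hi => ha i (by simp [hi])) (fun i hi => hb i (by simp [hi]))
    have hS : IsNonneg (singlePart a b G) := IsNonneg.sum fun h hh =>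
      (hb h (by simp [hh])).mul (IsNonneg.prod fun i hi =>
        ha i (by simp [Finset.mem_of_mem_erase hi]))
    convert ((hag.add hbg).mul ih').add (hbg.mul hS) using 1
    ring

/-- `B` collects the indices whose factor is `c` or `b`. Which element of `B` carries `b` is not
recorded; this hidden position is the source of the smoothing. -/
lemma singlePart_add {R ι : Type*} [CommSemiring R] [DecidableEq ι] (c k b : ι → R)
    (G : Finset ι) :
    singlePart (fun i => c i + k i) b G
      = ∑ B ∈ G.powerset, singlePart c b B * ∏ i ∈ G \ B, k i := by
  induction G using Finset.induction_on with
  | empty => simp [singlePart]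
  | insert g G hg ih =>
    rw [singlePart_insert _ _ hg, Finset.sum_powerset_insert hg, ih, Finset.prod_add]
    have h1 : ∀ S ∈ G.powerset, singlePart c b S * ∏ i ∈ insert g G \ S, k i
        = k g * (singlePart c b S * ∏ i ∈ G \ S, k i) := fun S hS => by
      have hgS : g ∉ S := fun h => hg (Finset.mem_powerset.1 hS h)
      rw [Finset.insert_sdiff_of_notMem _ hgS, Finset.prod_insert (by simp [hg])]
      ring
    have h2 : ∀ S ∈ G.powerset, singlePart c b (insert g S) * ∏ i ∈ insert g G \ insert g S, k i
        = b g * ((∏ i ∈ S, c i) * ∏ i ∈ G \ S, k i)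
          + c g * (singlePart c b S * ∏ i ∈ G \ S, k i) := fun S hS => by
      have hgS : g ∉ S := fun h => hg (Finset.mem_powerset.1 hS h)
      rw [Finset.insert_sdiff_insert, Finset.sdiff_insert_of_notMem hg, singlePart_insert _ _ hgS]
      ring
    rw [Finset.sum_congr rfl h1, Finset.sum_congr rfl h2, Finset.sum_add_distrib,
      ← Finset.mul_sum, ← Finset.mul_sum, ← Finset.mul_sum]
    ring

/-- The sum of the point masses at `e h`, `h ∈ B`. -/
def pointSum {ι : Type*} (e : ι → ℤ) (B : Finset ι) : ℝ[T;T⁻¹] := ∑ h ∈ B, T (e h)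

/-- Every position in `B` has the same weight `α ^ (|B| - 1) * β`, so the hidden position is uniform
on `B`. Writing the weight with `β / α` avoids the exponent `|B| - 1`; for empty `B` both sides
vanish. -/
lemma singlePart_C_mul_T {ι : Type*} [DecidableEq ι] {α : ℝ} (hα : α ≠ 0) (β : ℝ) (u s : ι → ℤ)
    (B : Finset ι) :
    singlePart (fun i => C α * T (u i)) (fun i => C β * T (s i)) B
      = C (α ^ B.card * (β / α)) * (T (∑ i ∈ B, u i) * pointSum (fun i => s i - u i) B) := by
  rw [singlePart, pointSum, Finset.mul_sum, Finset.mul_sum]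
  refine Finset.sum_congr rfl fun h hh => ?_
  rw [Finset.prod_mul_distrib, Finset.prod_const, Finset.card_erase_of_mem hh]
  have hT : ∏ i ∈ B.erase h, (T (u i) : ℝ[T;T⁻¹]) = T (∑ i ∈ B.erase h, u i) := by
    induction (B.erase h) using Finset.induction_on with
    | empty => simp
    | insert a S ha ih => rw [Finset.prod_insert ha, Finset.sum_insert ha, ih,
        LaurentPolynomial.T_add]
  rw [hT, ← LaurentPolynomial.T_add, ← Finset.add_sum_erase _ _ hh, ← map_pow]
  have h1 : α ^ B.card * (β / α) = β * α ^ (B.card - 1) := by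
    have : B.card = B.card - 1 + 1 := by have := Finset.card_pos.2 ⟨h, hh⟩; omega
    conv_lhs => rw [this, pow_succ]
    field_simp
  have h2 : u h + ∑ i ∈ B.erase h, u i + (s h - u h) = s h + ∑ i ∈ B.erase h, u i := by ring
  rw [h1, h2, LaurentPolynomial.T_add, map_mul]
  ring

/-- The weight attached to the hidden single selection within `B`. -/
def hidWeight {ι : Type*} [DecidableEq ι] (α β : ℝ) (G B : Finset ι) : ℝ :=
  (1 - α - β) ^ (G \ B).card * α ^ B.card * (β / α)

lemma hidWeight_nonneg {ι : Type*} [DecidableEq ι] {α β : ℝ} (hα : 0 < α) (hβ : 0 ≤ β)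
    (hαβ : α + β ≤ 1) (G B : Finset ι) : 0 ≤ hidWeight α β G B := by
  have : 0 ≤ 1 - α - β := by linarith
  unfold hidWeight; positivity

lemma sum_hidWeight {ι : Type*} [DecidableEq ι] (α β : ℝ) (G : Finset ι) :
    ∑ B ∈ G.powerset, hidWeight α β G B = (1 - β) ^ G.card * (β / α) := by
  have := Finset.prod_add (fun _ : ι => α) (fun _ => 1 - α - β) G
  simp only [Finset.prod_const] at this
  rw [show α + (1 - α - β) = 1 - β by ring] at this
  rw [this, Finset.sum_mul]
  exact Finset.sum_congr rfl fun B _ => by rw [hidWeight]; ring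

/-- This is the probability of exactly one selection, read off from `singlePart_add` with constant
factors. -/
lemma sum_hidWeight_mul_card {ι : Type*} [DecidableEq ι] {α : ℝ} (hα : α ≠ 0) (β : ℝ)
    (G : Finset ι) :
    ∑ B ∈ G.powerset, hidWeight α β G B * B.card = G.card * β * (1 - β) ^ (G.card - 1) := by
  have h := singlePart_add (fun _ : ι => α) (fun _ => 1 - α - β) (fun _ => β) G
  have h1 : ∀ (a : ℝ) (B : Finset ι), singlePart (fun _ : ι => a) (fun _ => β) B
      = B.card * β * a ^ (B.card - 1) := fun a B => by
    rw [singlePart, Finset.sum_congr rfl fun i hi => by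
      rw [Finset.prod_const, Finset.card_erase_of_mem hi], Finset.sum_const, nsmul_eq_mul]
    ring
  simp only [h1, Finset.prod_const] at h
  rw [show α + (1 - α - β) = 1 - β by ring] at h
  rw [h]
  refine Finset.sum_congr rfl fun B _ => ?_
  rcases B.card.eq_zero_or_pos with h0 | h0
  · simp [h0]
  · have : α ^ B.card = α ^ (B.card - 1) * α := by rw [← pow_succ]; congr 1; omega
    rw [hidWeight, this]; field_simp

/-- The product minus its single-selection part has nonnegative coefficients, so its `ℓ¹` norm is
its mass, one minus the probability of exactly one selection. Nonnegativity of that mass is the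
first conjunct. -/
lemma l1_mul_prod_le_hidden {ι : Type*} [DecidableEq ι] (G : Finset ι) (p κ : ι → ℝ[T;T⁻¹])
    {α β : ℝ} (hα : 0 < α) (hβ : 0 ≤ β) (u s : ι → ℤ) (x : ℝ[T;T⁻¹])
    (hp : ∀ i ∈ G, p i = C α * T (u i) + C β * T (s i) + κ i) (hκ : ∀ i ∈ G, IsNonneg (κ i))
    (hκ1 : ∀ i ∈ G, mass (κ i) = 1 - α - β) :
    G.card * β * (1 - β) ^ (G.card - 1) ≤ 1 ∧
    l1 (x * ∏ i ∈ G, p i) ≤ (1 - G.card * β * (1 - β) ^ (G.card - 1)) * l1 x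
      + ∑ B ∈ G.powerset, hidWeight α β G B * l1 (x * pointSum (fun i => s i - u i) B) := by
  set a : ι → ℝ[T;T⁻¹] := fun i => C α * T (u i) + κ i with ha
  set b : ι → ℝ[T;T⁻¹] := fun i => C β * T (s i) with hb
  have hpa : ∏ i ∈ G, p i = ∏ i ∈ G, (a i + b i) :=
    Finset.prod_congr rfl fun i hi => by rw [hp i hi, ha, hb]; ring
  have han : ∀ i ∈ G, IsNonneg (a i) := fun i hi => ((isNonneg_T _).C_mul hα.le).add (hκ i hi)
  have hbn : ∀ i ∈ G, IsNonneg (b i) := fun i _ => (isNonneg_T _).C_mul hβ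
  have hrest : IsNonneg (∏ i ∈ G, p i - singlePart a b G) := by
    have := (isNonneg_prod_sub_singlePart a b G han hbn).add (IsNonneg.prod han)
    rw [hpa]; convert this using 1; ring
  have hma : ∀ i ∈ G, mass (a i) = 1 - β := fun i hi => by
    rw [ha]; simp only [map_add, map_mul, mass_C, mass_T, hκ1 i hi]; ring
  have hmS : mass (singlePart a b G) = G.card * β * (1 - β) ^ (G.card - 1) := by
    rw [singlePart, map_sum]
    rw [Finset.sum_congr rfl fun h hh => by
      rw [map_mul, map_prod, Finset.prod_congr rfl fun i hi => hma i (Finset.mem_of_mem_erase hi),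
        Finset.prod_const, Finset.card_erase_of_mem hh]]
    simp [hb]; ring
  have hmp : mass (∏ i ∈ G, p i) = 1 := by
    rw [map_prod]
    refine Finset.prod_eq_one fun i hi => ?_
    rw [hp i hi]; simp only [map_add, map_mul, mass_C, mass_T, hκ1 i hi]; ring
  have hl1 : l1 (∏ i ∈ G, p i - singlePart a b G)
      = 1 - G.card * β * (1 - β) ^ (G.card - 1) := by
    rw [hrest.l1_eq, map_sub, hmS, hmp]
  refine ⟨by have := l1_nonneg (∏ i ∈ G, p i - singlePart a b G); linarith, ?_⟩
  have hdec : x * ∏ i ∈ G, p i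
      = x * (∏ i ∈ G, p i - singlePart a b G) + x * singlePart a b G := by ring
  rw [hdec]
  refine (l1_add_le _ _).trans (add_le_add ?_ ?_)
  · rw [← hl1, mul_comm (l1 _)]; exact l1_mul_le _ _
  · rw [ha, singlePart_add, Finset.mul_sum]
    refine (l1_sum_le _ _).trans (Finset.sum_le_sum fun B hB => ?_)
    rw [hb, singlePart_C_mul_T hα.ne', ← mul_assoc]
    refine (l1_mul_prod_le_prod _ _ _ (fun _ => 1 - α - β) fun i hi => by
      have := (Finset.mem_sdiff.1 hi).1
      rw [(hκ i this).l1_eq, hκ1 i this]).trans (le_of_eq ?_)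
    rw [mul_left_comm x, mul_left_comm x, l1_C_mul, l1_T_mul, abs_of_nonneg (by positivity),
      Finset.prod_const, hidWeight]
    ring

/-! ### From `ℓ²` bounds on the circle to `ℓ¹` bounds -/

/-- The support of `p` is contained in `[a, b]`. -/
def SuppIn (p : ℝ[T;T⁻¹]) (a b : ℤ) : Prop := p.coeff.support ⊆ Finset.Icc a b

lemma SuppIn.mul {p q : ℝ[T;T⁻¹]} {a b c d : ℤ} (hp : SuppIn p a b) (hq : SuppIn q c d) :
    SuppIn (p * q) (a + c) (b + d) := by
  classical
  intro x hx
  have := AddMonoidAlgebra.support_coeff_mul_subset p q hx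
  obtain ⟨y, hy, z, hz, rfl⟩ := Finset.mem_add.1 this
  have h1 := Finset.mem_Icc.1 (hp hy)
  have h2 := Finset.mem_Icc.1 (hq hz)
  exact Finset.mem_Icc.2 ⟨by omega, by omega⟩

lemma SuppIn.add {p q : ℝ[T;T⁻¹]} {a b : ℤ} (hp : SuppIn p a b) (hq : SuppIn q a b) :
    SuppIn (p + q) a b := by
  classical
  intro x hx
  rw [AddMonoidAlgebra.coeff_add] at hx
  rcases Finset.mem_union.1 (Finsupp.support_add hx) with h | h
  exacts [hp h, hq h]

lemma suppIn_T {n a b : ℤ} (ha : a ≤ n) (hb : n ≤ b) : SuppIn (T n) a b := by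
  intro x hx
  simp only [Finsupp.mem_support_iff, LaurentPolynomial.T_apply, ne_eq, ite_eq_right_iff,
    Classical.not_imp] at hx
  exact Finset.mem_Icc.2 ⟨by omega, by omega⟩

lemma SuppIn.C_mul {p : ℝ[T;T⁻¹]} {a b : ℤ} (hp : SuppIn p a b) (c : ℝ) : SuppIn (C c * p) a b := by
  intro x hx
  simp only [Finsupp.mem_support_iff, coeff_C_mul] at hx
  exact hp (by simpa using right_ne_zero_of_mul hx)

lemma suppIn_one : SuppIn 1 0 0 := by simpa using suppIn_T (n := 0) le_rfl le_rfl

lemma suppIn_one_sub_T {n : ℤ} (hn : 0 ≤ n) : SuppIn (1 - T n) 0 n := by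
  have h1 : SuppIn 1 0 n := by simpa using suppIn_T (n := 0) le_rfl hn
  have h2 := h1.add ((suppIn_T hn le_rfl).C_mul (-1))
  simpa [sub_eq_add_neg] using h2

lemma suppIn_fairProd {ι : Type*} (e : ι → ℤ) (S : Finset ι) (he : ∀ i ∈ S, 0 ≤ e i) :
    SuppIn (fairProd e S) 0 (∑ i ∈ S, e i) := by
  classical
  induction S using Finset.induction_on with
  | empty => simpa [fairProd] using suppIn_one
  | insert a S ha ih =>
    rw [fairProd, Finset.prod_insert ha, Finset.sum_insert ha]
    have hea := he a (by simp)
    have h1 : SuppIn 1 0 (e a) := by simpa using suppIn_T (n := 0) le_rfl hea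
    have h2 : SuppIn (C (1 / 2) * (1 + T (e a))) 0 (e a) :=
      (h1.add (suppIn_T hea le_rfl)).C_mul (1 / 2)
    have h3 := h2.mul (ih fun i hi => he i (by simp [hi]))
    rwa [add_zero] at h3

lemma suppIn_pointSum {ι : Type*} (v : ι → ℤ) (B : Finset ι) (A : ℤ) (hv : ∀ i ∈ B, |v i| ≤ A) :
    SuppIn (pointSum v B) (-A) A := by
  classical
  induction B using Finset.induction_on with
  | empty => intro x hx; simp [pointSum] at hx
  | insert a S ha ih =>
    rw [pointSum, Finset.sum_insert ha]
    have hea := abs_le.1 (hv a (by simp))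
    exact (suppIn_T hea.1 hea.2).add (ih fun i hi => hv i (by simp [hi]))

lemma SuppIn.l1_sq_le {p : ℝ[T;T⁻¹]} {a b : ℤ} (hp : SuppIn p a b) (hab : a ≤ b + 1) :
    l1 p ^ 2 ≤ ((b - a + 1 : ℤ) : ℝ) * l2sq p := by
  have := UnitShift.l1_sq_le hp
  rw [Int.card_Icc] at this
  have h : (((b + 1 - a).toNat : ℕ) : ℝ) = ((b - a + 1 : ℤ) : ℝ) := by
    have : (((b + 1 - a).toNat : ℕ) : ℤ) = b - a + 1 := by omega
    exact_mod_cast congrArg (Int.cast (R := ℝ)) this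
  rwa [h] at this

lemma coeff_pointSum {ι : Type*} (v : ι → ℤ) (B : Finset ι) (x : ℤ) :
    (pointSum v B).coeff x = ∑ h ∈ B, if v h = x then 1 else 0 := by
  classical
  induction B using Finset.induction_on with
  | empty => simp [pointSum]
  | insert a S ha ih =>
    rw [pointSum] at ih
    rw [pointSum, Finset.sum_insert ha, Finset.sum_insert ha, AddMonoidAlgebra.coeff_add,
      Finsupp.add_apply, ih, LaurentPolynomial.T_apply]

lemma l2sq_pointSum_le {ι : Type*} {v : ι → ℤ} {B : Finset ι} (hv : Set.InjOn v B) :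
    l2sq (pointSum v B) ≤ B.card := by
  classical
  have hs : (pointSum v B).coeff.support ⊆ B.image v := by
    intro x hx
    rw [Finsupp.mem_support_iff, coeff_pointSum] at hx
    obtain ⟨h, hB, hh⟩ := Finset.exists_ne_zero_of_sum_ne_zero hx
    exact Finset.mem_image.2 ⟨h, hB, by by_contra hc; simp [hc] at hh⟩
  have h1 : l2sq (pointSum v B) ≤ ∑ x ∈ B.image v, (pointSum v B).coeff x ^ 2 :=
    Finset.sum_le_sum_of_subset_of_nonneg hs fun _ _ _ => sq_nonneg _
  refine h1.trans ?_
  rw [Finset.sum_image hv]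
  refine (Finset.sum_le_card_nsmul _ _ 1 fun h hh => ?_).trans (by simp)
  rw [coeff_pointSum, Finset.sum_eq_single h]
  · simp
  · intro b hb hbh
    rw [if_neg fun e => hbh (hv hb hh e)]
  · intro hn; exact absurd hh hn

lemma normSq_char_pointSum_le {ι : Type*} (θ : ℝ) (v : ι → ℤ) (B : Finset ι) :
    Complex.normSq (char θ (pointSum v B)) ≤ (B.card : ℝ) ^ 2 := by
  rw [Complex.normSq_eq_norm_sq]
  refine pow_le_pow_left₀ (norm_nonneg _) ?_ 2
  rw [pointSum, map_sum]
  refine (norm_sum_le _ _).trans (le_of_eq ?_)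
  simp [char_T, Complex.norm_exp_ofReal_mul_I, -Complex.ofReal_mul]

/-! ### Averaged squared moduli and the passage to `ℓ¹`. -/

/-- The squared modulus at `2πθ` of the fair selections from `F` and the shift by `Δ`, averaged
over the selections. -/
def meanSq (ρ : ℕ → ℝ) (F : Finset ℕ) (Δ : ℕ) (θ : ℝ) : ℝ :=
  (2 - 2 * Real.cos (2 * Real.pi * θ * Δ)) *
    ∏ i ∈ F, (1 - ρ i * (1 - Real.cos (2 * Real.pi * θ * i)))

lemma continuous_meanSq (ρ : ℕ → ℝ) (F : Finset ℕ) (Δ : ℕ) : Continuous (meanSq ρ F Δ) := by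
  unfold meanSq; fun_prop

/-- The squared modulus at `2πθ` of the hidden selection, averaged over its possible ranges. -/
def hidSq (α β : ℝ) (G : Finset ℕ) (v : ℕ → ℤ) (θ : ℝ) : ℝ :=
  ∑ B ∈ G.powerset, hidWeight α β G B / B.card * Complex.normSq (char θ (pointSum v B))

lemma continuous_hidSq (α β : ℝ) (G : Finset ℕ) (v : ℕ → ℤ) : Continuous (hidSq α β G v) := by
  unfold hidSq
  exact continuous_finsetSum _ fun B _ => (continuous_normSq_char _).const_mul _

lemma hidSq_nonneg {α β : ℝ} (hα : 0 < α) (hβ : 0 ≤ β) (hαβ : α + β ≤ 1) (G : Finset ℕ)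
    (v : ℕ → ℤ) (θ : ℝ) : 0 ≤ hidSq α β G v θ :=
  Finset.sum_nonneg fun _ _ => mul_nonneg
    (div_nonneg (hidWeight_nonneg hα hβ hαβ _ _) (Nat.cast_nonneg _)) (Complex.normSq_nonneg _)

lemma hidSq_le_one {α β : ℝ} (hα : 0 < α) (hβ : 0 ≤ β) (hαβ : α + β ≤ 1) (G : Finset ℕ)
    (v : ℕ → ℤ) (θ : ℝ) (h1 : ∑ B ∈ G.powerset, hidWeight α β G B * B.card ≤ 1) :
    hidSq α β G v θ ≤ 1 := by
  refine le_trans (Finset.sum_le_sum fun B _ => ?_) h1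
  rcases B.card.eq_zero_or_pos with h0 | h0
  · simp [h0]
  · have h0' : (0 : ℝ) < B.card := by exact_mod_cast h0
    calc hidWeight α β G B / B.card * Complex.normSq (char θ (pointSum v B))
        ≤ hidWeight α β G B / B.card * (B.card : ℝ) ^ 2 :=
          mul_le_mul_of_nonneg_left (normSq_char_pointSum_le _ _ _)
            (div_nonneg (hidWeight_nonneg hα hβ hαβ _ _) h0'.le)
      _ = _ := by field_simp

/-- Distinct positions give `pointSum v B` squared `ℓ²` norm at most `|B|`, which the division by
`|B|` cancels. In the application `β / α` is at most `L / M`: this is the gain of order `1 / M`. -/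
lemma integral_hidSq_le {α β : ℝ} (hα : 0 < α) (hβ : 0 ≤ β) (hαβ : α + β ≤ 1) (G : Finset ℕ)
    {v : ℕ → ℤ} (hv : Set.InjOn v G) :
    ∫ θ in (0 : ℝ)..1, hidSq α β G v θ ≤ β / α := by
  unfold hidSq
  rw [intervalIntegral.integral_finsetSum fun _ _ =>
    ((continuous_normSq_char _).const_mul _).intervalIntegrable _ _]
  have hβ1 : 0 ≤ 1 - β := by linarith
  calc _ ≤ ∑ B ∈ G.powerset, hidWeight α β G B := Finset.sum_le_sum fun B hB => by
        rw [intervalIntegral.integral_const_mul, integral_normSq_char]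
        have hw := hidWeight_nonneg hα hβ hαβ G B
        have hl := l2sq_pointSum_le (hv.mono (Finset.coe_subset.2 (Finset.mem_powerset.1 hB)))
        rcases B.card.eq_zero_or_pos with h0 | h0
        · simp [h0, hw]
        · have h0' : (0 : ℝ) < B.card := by exact_mod_cast h0
          calc _ ≤ hidWeight α β G B / B.card * B.card :=
                mul_le_mul_of_nonneg_left hl (div_nonneg hw h0'.le)
            _ = _ := by field_simp
    _ = (1 - β) ^ G.card * (β / α) := sum_hidWeight α β G
    _ ≤ 1 * (β / α) := mul_le_mul_of_nonneg_right (pow_le_one₀ hβ1 (by linarith))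
        (by positivity)
    _ = _ := one_mul _

lemma normSq_eq_meanSq {ρ : ℕ → ℝ} (F : Finset ℕ) (Δ : ℕ) (θ : ℝ) (U : ℝ[T;T⁻¹]) :
    ∑ S ∈ F.powerset, selWeight ρ F S * Complex.normSq
      (char θ ((1 - T (Δ : ℤ)) * U * fairProd (fun i : ℕ => (i : ℤ)) S))
      = meanSq ρ F Δ θ * Complex.normSq (char θ U) := by
  simp_rw [map_mul, normSq_char_one_sub_T]
  rw [meanSq]
  have := sum_selWeight_mul_normSq ρ (fun i : ℕ => (i : ℤ)) F θ
  push_cast at this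
  rw [← this, Finset.mul_sum, Finset.sum_mul]
  refine Finset.sum_congr rfl fun S _ => ?_
  push_cast; ring

lemma sum_hidWeight_l1_le {α β : ℝ} (hα : 0 < α) (hβ : 0 ≤ β) (hαβ : α + β ≤ 1)
    (F G : Finset ℕ) (v : ℕ → ℤ) (A Δ : ℕ) (hvA : ∀ i ∈ G, |v i| ≤ A)
    (p ν : ℕ → ℝ[T;T⁻¹]) (ρ : ℕ → ℝ) (hp : ∀ i ∈ F, p i = C (ρ i) * (1 + T (i : ℤ)) + ν i)
    (hρ : ∀ i ∈ F, 0 ≤ ρ i) (hν : ∀ i ∈ F, l1 (ν i) ≤ 1 - 2 * ρ i)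
    (h1 : ∑ B ∈ G.powerset, hidWeight α β G B * B.card ≤ 1) :
    ∑ B ∈ G.powerset, hidWeight α β G B *
        l1 ((1 - T (Δ : ℤ)) * (∏ i ∈ F, p i) * pointSum v B)
      ≤ √(∑ i ∈ F, 2 * ρ i * i + (Δ + 2 * A + 1)) *
        √(∫ θ in (0 : ℝ)..1, meanSq ρ F Δ θ * hidSq α β G v θ) := by
  classical
  have hρ' : ∀ i ∈ F, 2 * ρ i ≤ 1 := fun i hi => by
    have := (l1_nonneg _).trans (hν i hi); linarith
  set e : ℕ → ℤ := fun i => i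
  set X : Finset ℕ × Finset ℕ → ℝ[T;T⁻¹] := fun z =>
    (1 - T (Δ : ℤ)) * pointSum v z.2 * fairProd e z.1 with hX
  set w : Finset ℕ × Finset ℕ → ℝ := fun z => selWeight ρ F z.1 * hidWeight α β G z.2 with hw
  set R : Finset ℕ → ℝ := fun S => ∑ i ∈ S, (i : ℝ) + (Δ + 2 * A + 1) with hR
  set I := F.powerset ×ˢ G.powerset with hI
  have hw0 : ∀ z ∈ I, 0 ≤ w z := fun z hz =>
    mul_nonneg (selWeight_nonneg (Finset.mem_powerset.1 (Finset.mem_product.1 hz).1) hρ hρ')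
      (hidWeight_nonneg hα hβ hαβ _ _)
  have hR0 : ∀ S, 0 ≤ R S := fun S => by positivity
  have hstep : ∑ B ∈ G.powerset, hidWeight α β G B *
        l1 ((1 - T (Δ : ℤ)) * (∏ i ∈ F, p i) * pointSum v B) ≤ ∑ z ∈ I, w z * l1 (X z) := by
    rw [hI, Finset.sum_product_right]
    refine Finset.sum_le_sum fun B _ => ?_
    rw [mul_right_comm]
    refine (mul_le_mul_of_nonneg_left (l1_mul_prod_le_sum_selWeight F p ν ρ e _ hp hρ hν)
      (hidWeight_nonneg hα hβ hαβ _ _)).trans (le_of_eq ?_)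
    rw [Finset.mul_sum]
    exact Finset.sum_congr rfl fun S _ => by simp only [hw, hX]; ring
  have hl1 : ∀ z ∈ I, l1 (X z) ≤ √(R z.1) * √(l2sq (X z)) := fun z hz => by
    have hz' := Finset.mem_product.1 hz
    have hs : SuppIn (X z) (0 + -(A : ℤ) + 0) ((Δ : ℤ) + A + ∑ i ∈ z.1, e i) :=
      ((suppIn_one_sub_T (Int.natCast_nonneg Δ)).mul (suppIn_pointSum v z.2 A fun i hi =>
        hvA i (Finset.mem_powerset.1 hz'.2 hi))).mul
        (suppIn_fairProd e z.1 fun i _ => Int.natCast_nonneg i)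
    have he : 0 ≤ ∑ i ∈ z.1, e i := Finset.sum_nonneg fun i _ => Int.natCast_nonneg i
    have hle := hs.l1_sq_le (by omega)
    rw [← Real.sqrt_mul (hR0 _)]
    refine Real.le_sqrt_of_sq_le (hle.trans (le_of_eq ?_))
    congr 1
    simp only [hR, e]; push_cast; ring
  -- The factor `|B|` is moved between the two sides of Cauchy–Schwarz so that `w * |B|` has total
  -- mass at most one and `w / |B|` matches `hidSq`.
  have hterm : ∀ z ∈ I, w z * l1 (X z) ≤
      √(w z * z.2.card * R z.1) * √(w z / z.2.card * l2sq (X z)) := fun z hz => by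
    rcases z.2.card.eq_zero_or_pos with h0 | h0
    · have : z.2 = ∅ := Finset.card_eq_zero.1 h0
      simp [hX, this, pointSum, l1_zero]
    · have h0' : (0 : ℝ) < z.2.card := by exact_mod_cast h0
      have hw1 := hw0 z hz
      have hR1 := hR0 z.1
      have hl2 : 0 ≤ l2sq (X z) := Finset.sum_nonneg fun _ _ => sq_nonneg _
      refine (mul_le_mul_of_nonneg_left (hl1 z hz) hw1).trans (le_of_eq ?_)
      have hc : 0 ≤ w z * z.2.card * R z.1 := by positivity
      rw [← Real.sqrt_mul hR1, ← Real.sqrt_mul hc, show w z * z.2.card * R z.1 * (w z / z.2.card * l2sq (X z))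
        = w z ^ 2 * (R z.1 * l2sq (X z)) by field_simp]
      rw [Real.sqrt_mul (sq_nonneg (w z)), Real.sqrt_sq hw1]
  have hCS : ∑ z ∈ I, √(w z * z.2.card * R z.1) * √(w z / z.2.card * l2sq (X z))
      ≤ √(∑ z ∈ I, w z * z.2.card * R z.1) * √(∑ z ∈ I, w z / z.2.card * l2sq (X z)) := by
    have h2 := Real.sum_mul_le_sqrt_mul_sqrt I (fun z => √(w z * z.2.card * R z.1))
      (fun z => √(w z / z.2.card * l2sq (X z)))
    refine h2.trans (le_of_eq ?_)
    congr 2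
    · exact Finset.sum_congr rfl fun z hz => Real.sq_sqrt (mul_nonneg (mul_nonneg (hw0 z hz)
        (Nat.cast_nonneg _)) (hR0 _))
    · exact Finset.sum_congr rfl fun z hz => Real.sq_sqrt (mul_nonneg (div_nonneg (hw0 z hz)
        (Nat.cast_nonneg _)) (Finset.sum_nonneg fun _ _ => sq_nonneg _))
  have hA1 : ∑ z ∈ I, w z * z.2.card * R z.1
      ≤ ∑ i ∈ F, 2 * ρ i * i + (Δ + 2 * A + 1) := by
    have h2 : ∑ S ∈ F.powerset, selWeight ρ F S * R S
        = ∑ i ∈ F, 2 * ρ i * i + (Δ + 2 * A + 1) := by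
      simp only [hR, mul_add]
      simp only [Finset.sum_add_distrib, ← Finset.sum_mul, sum_selWeight,
        sum_selWeight_mul_sum ρ (fun i => (i : ℝ)) F, one_mul]
    have h3 : ∑ z ∈ I, w z * z.2.card * R z.1 = (∑ S ∈ F.powerset, selWeight ρ F S * R S) *
        ∑ B ∈ G.powerset, hidWeight α β G B * B.card := by
      rw [hI, Finset.sum_product, Finset.sum_mul_sum]
      exact Finset.sum_congr rfl fun S _ => Finset.sum_congr rfl fun B _ => by
        simp only [hw]; ring
    rw [h3, h2]
    refine mul_le_of_le_one_right ?_ h1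
    rw [← h2]
    exact Finset.sum_nonneg fun S hS => mul_nonneg
      (selWeight_nonneg (Finset.mem_powerset.1 hS) hρ hρ') (hR0 _)
  have hA2 : ∑ z ∈ I, w z / z.2.card * l2sq (X z)
      = ∫ θ in (0 : ℝ)..1, meanSq ρ F Δ θ * hidSq α β G v θ := by
    have h2 : ∀ θ, meanSq ρ F Δ θ * hidSq α β G v θ
        = ∑ z ∈ I, w z / z.2.card * Complex.normSq (char θ (X z)) := fun θ => by
      rw [hI, Finset.sum_product_right, hidSq, Finset.mul_sum]
      refine Finset.sum_congr rfl fun B _ => ?_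
      rw [mul_left_comm, ← normSq_eq_meanSq, Finset.mul_sum]
      exact Finset.sum_congr rfl fun S _ => by simp only [hw, hX]; ring
    simp_rw [h2]
    rw [intervalIntegral.integral_finsetSum fun _ _ =>
      ((continuous_normSq_char _).const_mul _).intervalIntegrable _ _]
    exact Finset.sum_congr rfl fun z _ => by
      rw [intervalIntegral.integral_const_mul, integral_normSq_char]
  refine hstep.trans ((Finset.sum_le_sum hterm).trans (hCS.trans ?_))
  rw [hA2]
  exact mul_le_mul_of_nonneg_right (Real.sqrt_le_sqrt hA1) (Real.sqrt_nonneg _)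

/-- Off `N` the integral bound for `hidSq` is used; on `N` the pointwise bound `hidSq ≤ 1` suffices
because `N` has small measure. -/
lemma integral_meanSq_mul_hidSq_le {α β : ℝ} (hα : 0 < α) (hβ : 0 ≤ β) (hαβ : α + β ≤ 1)
    (F G : Finset ℕ) {v : ℕ → ℤ} (hv : Set.InjOn v G) (Δ : ℕ) (ρ : ℕ → ℝ)
    (h1 : ∑ B ∈ G.powerset, hidWeight α β G B * B.card ≤ 1) {N : Set ℝ} (hN : MeasurableSet N)
    {a b δ : ℝ} (ha : 0 ≤ a) (hb : 0 ≤ b) (hVa : ∀ θ ∈ Set.Icc (0 : ℝ) 1, θ ∉ N →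
      meanSq ρ F Δ θ ≤ a)
    (hVb : ∀ θ ∈ Set.Icc (0 : ℝ) 1, θ ∈ N → meanSq ρ F Δ θ ≤ b)
    (hδ : volume.real (N ∩ Set.Icc 0 1) ≤ δ) :
    ∫ θ in (0 : ℝ)..1, meanSq ρ F Δ θ * hidSq α β G v θ ≤ a * (β / α) + b * δ := by
  have hfin : volume (N ∩ Set.Icc (0 : ℝ) 1) ≠ ⊤ :=
    measure_ne_top_of_subset Set.inter_subset_right (by simp)
  have hint : IntegrableOn (N.indicator fun _ => b) (Set.Icc (0 : ℝ) 1) := by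
    rw [IntegrableOn, integrable_indicator_iff hN]
    refine integrableOn_const ?_
    rw [Measure.restrict_apply hN]; exact hfin
  have hint' : IntervalIntegrable (N.indicator fun _ => b) volume 0 1 :=
    (intervalIntegrable_iff_integrableOn_Ioc_of_le zero_le_one).2
      (hint.mono_set Set.Ioc_subset_Icc_self)
  have hc : IntervalIntegrable (fun θ => a * hidSq α β G v θ) volume 0 1 :=
    ((continuous_hidSq α β G v).const_mul a).intervalIntegrable _ _
  calc _ ≤ ∫ θ in (0 : ℝ)..1, (a * hidSq α β G v θ + N.indicator (fun _ => b) θ) := by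
        refine intervalIntegral.integral_mono_on zero_le_one
          (((continuous_meanSq ρ F Δ).mul (continuous_hidSq α β G v)).intervalIntegrable _ _)
          (hc.add hint') fun θ hθ => ?_
        have h0 := hidSq_nonneg hα hβ hαβ G v θ
        have h2 := hidSq_le_one hα hβ hαβ G v θ h1
        by_cases hθN : θ ∈ N
        · rw [Set.indicator_of_mem hθN]
          have := hVb θ hθ hθN
          nlinarith [mul_nonneg ha h0, mul_le_mul_of_nonneg_right this h0]
        · rw [Set.indicator_of_notMem hθN, add_zero]
          exact mul_le_mul_of_nonneg_right (hVa θ hθ hθN) h0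
    _ = a * (∫ θ in (0 : ℝ)..1, hidSq α β G v θ)
          + ∫ θ in (0 : ℝ)..1, N.indicator (fun _ => b) θ := by
        rw [intervalIntegral.integral_add hc hint', intervalIntegral.integral_const_mul]
    _ ≤ _ := by
        refine add_le_add (mul_le_mul_of_nonneg_left (integral_hidSq_le hα hβ hαβ G hv) ha) ?_
        rw [intervalIntegral.integral_of_le zero_le_one, ← integral_Icc_eq_integral_Ioc,
          integral_indicator hN, setIntegral_const, measureReal_restrict_apply hN, smul_eq_mul,
          mul_comm]
        exact mul_le_mul_of_nonneg_left hδ hb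

/-! ### Trigonometric estimates -/

lemma one_sub_cos_add_le (x y : ℝ) :
    1 - Real.cos (x + y) ≤ 2 * ((1 - Real.cos x) + (1 - Real.cos y)) := by
  have h : ∀ z : ℝ, 1 - Real.cos z = 2 * Real.sin (z / 2) ^ 2 := fun z => by
    have h1 := Real.cos_sq (z / 2)
    have h2 := Real.sin_sq_add_cos_sq (z / 2)
    rw [mul_div_cancel₀ z two_ne_zero] at h1
    linarith
  rw [h, h, h, add_div, Real.sin_add]
  have hx := Real.sin_sq_add_cos_sq (x / 2)
  have hy := Real.sin_sq_add_cos_sq (y / 2)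
  set a := Real.sin (x / 2)
  set b := Real.cos (x / 2)
  set c := Real.sin (y / 2)
  set d := Real.cos (y / 2)
  nlinarith [sq_nonneg (a * d - b * c), mul_nonneg (sq_nonneg a) (sq_nonneg c)]

/-- The frequency `d` is the difference of `i + d` and `i`, so both choices cannot be insensitive to
`θ` unless the step `d` is. -/
lemma one_sub_cos_le_pair (θ : ℝ) (i d : ℕ) :
    1 - Real.cos (2 * Real.pi * θ * d) ≤ 2 * ((1 - Real.cos (2 * Real.pi * θ * i))
      + (1 - Real.cos (2 * Real.pi * θ * (i + d : ℕ)))) := by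
  have := one_sub_cos_add_le (-(2 * Real.pi * θ * i)) (2 * Real.pi * θ * (i + d : ℕ))
  rw [Real.cos_neg] at this
  convert this using 3
  push_cast; ring

/-- The distance of `2θ` to the nearest integer. -/
def dist2 (θ : ℝ) : ℝ := |2 * θ - round (2 * θ)|

lemma dist2_nonneg (θ : ℝ) : 0 ≤ dist2 θ := abs_nonneg _

lemma dist2_le_half (θ : ℝ) : dist2 θ ≤ 1 / 2 := abs_sub_round _

/-- All steps and shifts in play are even, so `θ` matters only through `2θ` modulo one, and `1/2` is
as exceptional as `0`. -/
lemma cos_eq_cos_dist2 (θ : ℝ) (m : ℕ) :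
    Real.cos (2 * Real.pi * θ * (2 * m : ℕ)) = Real.cos (2 * Real.pi * (m * dist2 θ)) := by
  have h1 : Real.cos (2 * Real.pi * θ * (2 * m : ℕ))
      = Real.cos (2 * Real.pi * (m * (2 * θ - round (2 * θ)))) := by
    rw [← Real.cos_sub_int_mul_two_pi _ (m * round (2 * θ))]
    congr 1; push_cast; ring
  rw [h1, dist2]
  rcases abs_choice (2 * θ - round (2 * θ)) with h | h
  · rw [h]
  · rw [h, ← Real.cos_neg]; congr 1; ring

lemma two_sub_two_cos_le (θ : ℝ) (m : ℕ) :
    2 - 2 * Real.cos (2 * Real.pi * θ * (2 * m : ℕ)) ≤ 10 * ((2 * m : ℕ) * dist2 θ) ^ 2 := by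
  rw [cos_eq_cos_dist2]
  have h1 := Real.one_sub_sq_div_two_le_cos (x := 2 * Real.pi * (m * dist2 θ))
  have h2 : Real.pi ^ 2 ≤ 10 := by nlinarith [Real.pi_lt_d2, Real.pi_pos]
  push_cast
  nlinarith [sq_nonneg (m * dist2 θ)]

/-- Take the largest dyadic step not exceeding `M` whose multiple of `dist2 θ` is at most one.
Doubling it violates one of the constraints, which bounds that multiple from below. -/
lemma exists_pow_two_one_sub_cos {M : ℕ} (hM : 2 ≤ M) (θ : ℝ) :
    ∃ g : ℕ, 2 ^ (g + 1) ≤ M ∧ ((2 ^ (g + 1) : ℕ) : ℝ) * dist2 θ ≤ 1 ∧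
      1 / 2 * min 1 (M * dist2 θ) ^ 2 ≤
        1 - Real.cos (2 * Real.pi * θ * (2 ^ (g + 1) : ℕ)) := by
  classical
  set y := dist2 θ with hy
  have hy0 : 0 ≤ y := dist2_nonneg θ
  have hy1 : y ≤ 1 / 2 := dist2_le_half θ
  have hex : ∃ g : ℕ, ¬ (2 ^ (g + 1) ≤ M ∧ ((2 ^ (g + 1) : ℕ) : ℝ) * y ≤ 1) :=
    ⟨M, fun h => by
      have := Nat.lt_two_pow_self (n := M + 1)
      omega⟩
  obtain ⟨g, hg⟩ : ∃ g, Nat.find hex = g + 1 := by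
    refine Nat.exists_eq_succ_of_ne_zero fun h0 => Nat.find_spec hex ?_
    rw [h0]
    refine ⟨by simpa using hM, ?_⟩
    norm_num; linarith
  have h1 := not_not.1 (Nat.find_min hex (m := g) (by omega))
  have h2 := Nat.find_spec hex
  rw [hg] at h2
  refine ⟨g, h1.1, h1.2, ?_⟩
  have hz : min 1 (M * y) ≤ 4 * (2 ^ g * y) := by
    rw [not_and_or, not_le, not_le] at h2
    rcases h2 with h2 | h2
    · refine (min_le_right _ _).trans ?_
      have : (M : ℝ) ≤ 2 ^ (g + 1 + 1) := by exact_mod_cast h2.le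
      calc M * y ≤ 2 ^ (g + 1 + 1) * y := mul_le_mul_of_nonneg_right this hy0
        _ = _ := by ring
    · refine (min_le_left _ _).trans ?_
      push_cast at h2
      calc (1 : ℝ) ≤ 2 ^ (g + 1 + 1) * y := h2.le
        _ = _ := by ring
  have hz0 : 0 ≤ min 1 (M * y) := le_min zero_le_one (by positivity)
  have hle : (2 : ℝ) ^ g * y ≤ 1 / 2 := by
    have := h1.2; push_cast at this; rw [pow_succ] at this; linarith
  have hcos : Real.cos (2 * Real.pi * θ * (2 ^ (g + 1) : ℕ))
      = Real.cos (2 * Real.pi * (2 ^ g * y)) := by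
    have := cos_eq_cos_dist2 θ (2 ^ g)
    rw [← pow_succ'] at this
    rw [this]; push_cast; rfl
  rw [hcos]
  have hq := Real.cos_le_one_sub_mul_cos_sq (x := 2 * Real.pi * (2 ^ g * y)) (by
    rw [abs_of_nonneg (by positivity)]; nlinarith [Real.pi_pos])
  have : 2 / Real.pi ^ 2 * (2 * Real.pi * (2 ^ g * y)) ^ 2 = 8 * (2 ^ g * y) ^ 2 := by
    field_simp; ring
  rw [this] at hq
  nlinarith

/-- An index of `F` occurs at most once as `i` and once as `i + d`; this costs a factor `2`, and
`one_sub_cos_le_pair` costs another. -/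
lemma sum_pairs_le {F E : Finset ℕ} (d : ℕ) {ρ c : ℕ → ℝ} (hρ : ∀ i ∈ F, 0 ≤ ρ i)
    (hc : ∀ i ∈ E, 0 ≤ c i) (h1 : ∀ i ∈ E, i ∈ F ∧ c i ≤ ρ i)
    (h2 : ∀ i ∈ E, i + d ∈ F ∧ c i ≤ ρ (i + d)) (θ : ℝ) :
    1 / 4 * (1 - Real.cos (2 * Real.pi * θ * d)) * ∑ i ∈ E, c i
      ≤ ∑ i ∈ F, ρ i * (1 - Real.cos (2 * Real.pi * θ * i)) := by
  set f : ℕ → ℝ := fun i => 1 - Real.cos (2 * Real.pi * θ * i) with hf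
  have hf0 : ∀ i, 0 ≤ f i := fun i => by 
    simpa [hf] using Real.cos_le_one (2 * Real.pi * θ * i)
  have hs1 : ∑ i ∈ E, ρ i * f i ≤ ∑ i ∈ F, ρ i * f i :=
    Finset.sum_le_sum_of_subset_of_nonneg (fun i hi => (h1 i hi).1)
      fun i hi _ => mul_nonneg (hρ i hi) (hf0 i)
  have hs2 : ∑ i ∈ E, ρ (i + d) * f (i + d) ≤ ∑ i ∈ F, ρ i * f i := by
    have he : ∑ i ∈ E, ρ (i + d) * f (i + d)
        = ∑ i ∈ E.map (addRightEmbedding d), ρ i * f i := by rw [Finset.sum_map]; rfl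
    rw [he]
    refine Finset.sum_le_sum_of_subset_of_nonneg (fun i hi => ?_)
      fun i hi _ => mul_nonneg (hρ i hi) (hf0 i)
    obtain ⟨j, hj, rfl⟩ := Finset.mem_map.1 hi
    exact (h2 j hj).1
  have hs3 : 1 / 2 * (1 - Real.cos (2 * Real.pi * θ * d)) * ∑ i ∈ E, c i
      ≤ ∑ i ∈ E, ρ i * f i + ∑ i ∈ E, ρ (i + d) * f (i + d) := by
    rw [Finset.mul_sum, ← Finset.sum_add_distrib]
    refine Finset.sum_le_sum fun i hi => ?_
    have hp := one_sub_cos_le_pair θ i d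
    have e1 : c i * f i ≤ ρ i * f i := mul_le_mul_of_nonneg_right (h1 i hi).2 (hf0 _)
    have e2 : c i * f (i + d) ≤ ρ (i + d) * f (i + d) :=
      mul_le_mul_of_nonneg_right (h2 i hi).2 (hf0 _)
    have e3 := mul_le_mul_of_nonneg_left hp (hc i hi)
    simp only [hf] at e1 e2 ⊢
    linarith
  linarith

lemma prod_one_sub_le_exp (F : Finset ℕ) {ρ : ℕ → ℝ} (hρ' : ∀ i ∈ F, 2 * ρ i ≤ 1)
    (hρ : ∀ i ∈ F, 0 ≤ ρ i) (θ : ℝ) :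
    ∏ i ∈ F, (1 - ρ i * (1 - Real.cos (2 * Real.pi * θ * i)))
      ≤ Real.exp (-∑ i ∈ F, ρ i * (1 - Real.cos (2 * Real.pi * θ * i))) := by
  rw [← Finset.sum_neg_distrib, Real.exp_sum]
  refine Finset.prod_le_prod (fun i hi => ?_) fun i _ => ?_
  · have h1 := Real.neg_one_le_cos (2 * Real.pi * θ * i)
    nlinarith [hρ i hi, hρ' i hi]
  · exact Real.one_sub_le_exp_neg _

/-! ### Indices chosen in blocks -/

section Blocks

variable {k : ℕ} {Q : ℕ → Prop}

lemma sum_blocks_le [DecidablePred Q] {i : ℕ → ℕ}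
    (hi : ∀ j, 1 ≤ j → i j ∈ Finset.Icc (j * k + 1) ((j + 1) * k) ∧ Q (i j))
    {f : ℕ → ℝ} (hf : ∀ x, 0 ≤ f x) {A M p q : ℕ} (hp : 1 ≤ p) (hA : A ≤ p * k) (hM : q * k ≤ M) :
    ∑ j ∈ Finset.Ico p q, f (i j) ≤ ∑ x ∈ (Finset.Ioc A M).filter Q, f x := by
  have hinj : Set.InjOn i (Finset.Ico p q) := by
    intro j hj l hl h
    have hj1 := Finset.mem_Icc.1 (hi j (hp.trans (Finset.mem_Ico.1 hj).1)).1
    have hl1 := Finset.mem_Icc.1 (hi l (hp.trans (Finset.mem_Ico.1 hl).1)).1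
    rw [h] at hj1
    rcases lt_trichotomy j l with hlt | heq | hlt
    · have := Nat.mul_le_mul_right k (Nat.succ_le_of_lt hlt)
      simp only [Nat.succ_eq_add_one] at this; omega
    · exact heq
    · have := Nat.mul_le_mul_right k (Nat.succ_le_of_lt hlt)
      simp only [Nat.succ_eq_add_one] at this; omega
  rw [← Finset.sum_image (f := f) hinj]
  refine Finset.sum_le_sum_of_subset_of_nonneg (fun x hx => ?_) fun x _ _ => hf x
  obtain ⟨j, hj, rfl⟩ := Finset.mem_image.1 hx
  have hj' := Finset.mem_Ico.1 hj
  obtain ⟨h1, h2⟩ := hi j (hp.trans hj'.1)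
  have h1 := Finset.mem_Icc.1 h1
  have e1 := Nat.mul_le_mul_right k hj'.1
  have e2 := Nat.mul_le_mul_right k (Nat.succ_le_of_lt hj'.2)
  simp only [Nat.succ_eq_add_one] at e2
  exact Finset.mem_filter.2 ⟨Finset.mem_Ioc.2 ⟨by omega, by omega⟩, h2⟩

lemma log_le_sum_Ico {p q : ℕ} (hpq : p ≤ q) :
    Real.log ((q + 1 : ℝ) / (p + 1)) ≤ ∑ j ∈ Finset.Ico p q, 1 / ((j : ℝ) + 1) := by
  induction q, hpq using Nat.le_induction with
  | base => simp [div_self (by positivity : (p : ℝ) + 1 ≠ 0)]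
  | succ q hpq ih =>
    rw [Finset.sum_Ico_succ_top hpq]
    have h : Real.log ((q + 1 + 1 : ℝ) / (q + 1)) ≤ 1 / ((q : ℝ) + 1) := by
      refine (Real.log_le_sub_one_of_pos (by positivity)).trans (le_of_eq ?_)
      field_simp; ring
    have e : ((↑(q + 1) + 1 : ℝ) / (p + 1)) = ((q + 1 : ℝ) / (p + 1)) * ((q + 1 + 1 : ℝ) / (q + 1)) := by
      push_cast; field_simp
    rw [e, Real.log_mul (by positivity) (by positivity)]
    linarith

lemma log_le_sum_blocks [DecidablePred Q] (hk : 1 ≤ k)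
    (hQ : ∀ j, 1 ≤ j → ∃ i ∈ Finset.Icc (j * k + 1) ((j + 1) * k), Q i) {A : ℕ} (hA : 1 ≤ A)
    (M : ℕ) :
    1 / k * Real.log (M / ((2 * k + 1) * A)) ≤ ∑ i ∈ (Finset.Ioc A M).filter Q, 1 / (i : ℝ) := by
  have hk0 : (0 : ℝ) < k := by exact_mod_cast hk
  have hA0 : (1 : ℝ) ≤ A := by exact_mod_cast hA
  have hnn : 0 ≤ ∑ i ∈ (Finset.Ioc A M).filter Q, 1 / (i : ℝ) :=
    Finset.sum_nonneg fun _ _ => by positivity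
  have hp1 : A < (A / k + 1) * k := by
    have h1 := Nat.div_add_mod A k
    have h2 := Nat.mod_lt A hk
    rw [add_mul, mul_comm (A / k)]; omega
  have hp2 : (A / k) * k ≤ A := Nat.div_mul_le_self A k
  have hq1 : M < (M / k + 1) * k := by
    have h1 := Nat.div_add_mod M k
    have h2 := Nat.mod_lt M hk
    rw [add_mul, mul_comm (M / k)]; omega
  have hq2 : (M / k) * k ≤ M := Nat.div_mul_le_self M k
  -- The blocks `j` with `p ≤ j < q` are those lying entirely inside `(A, M]`.
  set p := A / k + 1
  set q := M / k
  have hp2' : (p : ℝ) * k ≤ A + k := by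
    have : p * k ≤ A + k := by
      have : p * k = A / k * k + k := by simp only [p]; ring
      omega
    exact_mod_cast this
  have hq1' : (M : ℝ) < (q + 1) * k := by exact_mod_cast hq1
  rcases lt_or_ge q p with hqp | hpq
  · refine le_trans ?_ hnn
    refine mul_nonpos_of_nonneg_of_nonpos (by positivity) (Real.log_nonpos (by positivity) ?_)
    rw [div_le_one (by positivity)]
    have : ((q : ℝ) + 1) * k ≤ p * k := by
      refine mul_le_mul_of_nonneg_right ?_ hk0.le
      exact_mod_cast hqp
    nlinarith
  choose! i hi1 hi2 using hQ
  refine le_trans ?_ (sum_blocks_le (A := A) (M := M) (fun j hj => ⟨hi1 j hj, hi2 j hj⟩)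
    (f := fun x => 1 / (x : ℝ)) (fun _ => by positivity) (p := p) (q := q)
    (Nat.succ_pos _) hp1.le hq2)
  have hlow : 1 / k * ∑ j ∈ Finset.Ico p q, 1 / ((j : ℝ) + 1)
      ≤ ∑ j ∈ Finset.Ico p q, 1 / (i j : ℝ) := by
    rw [Finset.mul_sum]
    refine Finset.sum_le_sum fun j hj => ?_
    have hj1 : 1 ≤ j := (Nat.succ_pos _).trans_le (Finset.mem_Ico.1 hj).1
    have h := Finset.mem_Icc.1 (hi1 j hj1)
    have h1 : (i j : ℝ) ≤ (j + 1) * k := by exact_mod_cast h.2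
    have h2 : (0 : ℝ) < i j := by exact_mod_cast (by omega : 0 < i j)
    rw [one_div_mul_one_div]
    exact one_div_le_one_div_of_le h2 (by linarith)
  refine le_trans (mul_le_mul_of_nonneg_left ?_ (by positivity)) hlow
  rcases Nat.eq_zero_or_pos M with hM0 | hM0
  · simp only [hM0, Nat.cast_zero, zero_div, Real.log_zero]
    exact Finset.sum_nonneg fun _ _ => by positivity
  have hM1 : (0 : ℝ) < M := by exact_mod_cast hM0
  refine le_trans (Real.log_le_log (by positivity) ?_) (log_le_sum_Ico hpq)
  rw [div_le_div_iff₀ (by positivity) (by positivity)]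
  have h3 : ((p : ℝ) + 1) * k ≤ (2 * k + 1) * A := by nlinarith
  have h4 : (M : ℝ) * ((p + 1) * k) ≤ (q + 1) * k * ((2 * k + 1) * A) :=
    mul_le_mul hq1'.le h3 (by positivity) (by positivity)
  have h5 : (M : ℝ) * (p + 1) * k ≤ (q + 1) * ((2 * k + 1) * A) * k := by linarith
  exact le_of_mul_le_mul_right h5 hk0

lemma card_blocks_ge [DecidablePred Q] (hk : 1 ≤ k)
    (hQ : ∀ j, 1 ≤ j → ∃ i ∈ Finset.Icc (j * k + 1) ((j + 1) * k), Q i) (M : ℕ) :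
    (M : ℝ) / k - 2 ≤ ((Finset.Ioc M (2 * M)).filter Q).card := by
  have hk0 : (0 : ℝ) < k := by exact_mod_cast hk
  have hp1 : M < (M / k + 1) * k := by
    have h1 := Nat.div_add_mod M k
    have h2 := Nat.mod_lt M hk
    rw [add_mul, mul_comm (M / k)]; omega
  have hp2 : ((M / k : ℕ) : ℝ) ≤ M / k := Nat.cast_div_le
  have hq1 : 2 * M < (2 * M / k + 1) * k := by
    have h1 := Nat.div_add_mod (2 * M) k
    have h2 := Nat.mod_lt (2 * M) hk
    rw [add_mul, mul_comm (2 * M / k)]; omega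
  have hq1' : (2 * M : ℝ) / k ≤ (2 * M / k : ℕ) + 1 := by
    rw [div_le_iff₀ hk0]; exact_mod_cast hq1.le
  choose! i hi1 hi2 using hQ
  have h := sum_blocks_le (A := M) (M := 2 * M) (fun j hj => ⟨hi1 j hj, hi2 j hj⟩)
    (f := fun _ => (1 : ℝ)) (fun _ => zero_le_one) (p := M / k + 1) (q := 2 * M / k)
    (Nat.succ_pos _) hp1.le (Nat.div_mul_le_self _ k)
  simp only [Finset.sum_const, nsmul_eq_mul, mul_one, Nat.card_Ico] at h
  refine le_trans ?_ h
  have h6 : ((2 * M / k : ℕ) : ℝ) - ((M / k + 1 : ℕ) : ℝ) ≤ ((2 * M / k - (M / k + 1) : ℕ) : ℝ) := by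
    rw [sub_le_iff_le_add]
    exact_mod_cast (by omega : 2 * M / k ≤ 2 * M / k - (M / k + 1) + (M / k + 1))
  push_cast at h6
  have : (2 * M : ℝ) / k = M / k + M / k := by ring
  linarith

end Blocks

/-! ### Laws with mass at `0` and at `i` -/

/-- A finitely supported probability law on `ℤ`. -/
structure IsProb (p : ℝ[T;T⁻¹]) : Prop where
  nonneg : IsNonneg p
  mass_eq : mass p = 1

lemma IsProb.l1_eq {p : ℝ[T;T⁻¹]} (hp : IsProb p) : l1 p = 1 := by
  rw [hp.nonneg.l1_eq, hp.mass_eq]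

lemma IsProb.isNonneg_sub {p : ℝ[T;T⁻¹]} (hp : IsProb p) {u s : ℤ} (hus : u ≠ s) {a b : ℝ}
    (ha : a ≤ p.coeff u) (hb : b ≤ p.coeff s) : IsNonneg (p - (C a * T u + C b * T s)) := by
  intro x
  have h : (p - (C a * T u + C b * T s)).coeff x
      = p.coeff x - (a * (if u = x then 1 else 0) + b * (if s = x then 1 else 0)) := by
    rw [sub_eq_add_neg, AddMonoidAlgebra.coeff_add, AddMonoidAlgebra.coeff_neg,
      AddMonoidAlgebra.coeff_add, Finsupp.add_apply, Finsupp.neg_apply, Finsupp.add_apply,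
      coeff_C_mul, coeff_C_mul, LaurentPolynomial.T_apply, LaurentPolynomial.T_apply]
    ring
  rw [h]
  have h0 := hp.nonneg x
  split_ifs with h1 h2 h2
  · exact absurd (h1.trans h2.symm) hus
  · subst h1; linarith
  · subst h2; linarith
  · linarith

lemma IsProb.mass_sub {p : ℝ[T;T⁻¹]} (hp : IsProb p) (u s : ℤ) (a b : ℝ) :
    mass (p - (C a * T u + C b * T s)) = 1 - a - b := by
  simp [hp.mass_eq]; ring

lemma IsProb.add_le_one {p : ℝ[T;T⁻¹]} (hp : IsProb p) {u s : ℤ} (hus : u ≠ s) {a b : ℝ}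
    (ha : a ≤ p.coeff u) (hb : b ≤ p.coeff s) : a + b ≤ 1 := by
  have h := l1_nonneg (p - (C a * T u + C b * T s))
  rw [(hp.isNonneg_sub hus ha hb).l1_eq, hp.mass_sub] at h
  linarith

lemma IsProb.coeff_le_one {p : ℝ[T;T⁻¹]} (hp : IsProb p) (u : ℤ) : p.coeff u ≤ 1 := by
  have := hp.add_le_one (u := u) (s := u + 1) (by omega) le_rfl (hp.nonneg _)
  linarith

lemma l1_mul_prod_le_of_isProb {ι : Type*} (s : Finset ι) (x : ℝ[T;T⁻¹]) {p : ι → ℝ[T;T⁻¹]}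
    (hp : ∀ i, IsProb (p i)) : l1 (x * ∏ i ∈ s, p i) ≤ l1 x := by
  simpa using l1_mul_prod_le_prod s x p (fun _ => 1) fun i _ => (hp i).l1_eq.le

/-- The smaller of the masses of `p i` at `0` and at `i`. -/
def loMass (p : ℕ → ℝ[T;T⁻¹]) (i : ℕ) : ℝ := min ((p i).coeff 0) ((p i).coeff i)

/-- The larger of the masses of `p i` at `0` and at `i`. -/
def hiMass (p : ℕ → ℝ[T;T⁻¹]) (i : ℕ) : ℝ := max ((p i).coeff 0) ((p i).coeff i)

/-- The overlap condition for the pair of indices `i`, `i + d`. -/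
def Paired (p : ℕ → ℝ[T;T⁻¹]) (ψ : ℝ) (d i : ℕ) : Prop :=
  ψ / (i + d : ℕ) ≤ (p i).coeff 0 * (p (i + d)).coeff (i + d : ℕ) ∧
    ψ / (i + d : ℕ) ≤ (p i).coeff i * (p (i + d)).coeff 0

section Pairs

variable {p : ℕ → ℝ[T;T⁻¹]} {ψ : ℝ} {d i : ℕ}

lemma loMass_nonneg (hp : ∀ i, IsProb (p i)) (i : ℕ) : 0 ≤ loMass p i :=
  le_min ((hp i).nonneg _) ((hp i).nonneg _)

lemma loMass_le_hiMass (p : ℕ → ℝ[T;T⁻¹]) (i : ℕ) : loMass p i ≤ hiMass p i :=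
  (min_le_left _ _).trans (le_max_left _ _)

lemma two_mul_loMass_le (hp : ∀ i, IsProb (p i)) (hi : 1 ≤ i) : 2 * loMass p i ≤ 1 := by
  have := (hp i).add_le_one (u := 0) (s := i) (by omega) (min_le_left _ _ : loMass p i ≤ _)
    (min_le_right _ _ : loMass p i ≤ _)
  unfold loMass; linarith

lemma Paired.le_loMass_left (hp : ∀ i, IsProb (p i)) (h : Paired p ψ d i) :
    ψ / (i + d : ℕ) ≤ loMass p i :=
  le_min (h.1.trans (mul_le_of_le_one_right ((hp _).nonneg _) ((hp _).coeff_le_one _)))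
    (h.2.trans (mul_le_of_le_one_right ((hp _).nonneg _) ((hp _).coeff_le_one _)))

lemma Paired.le_loMass_right (hp : ∀ i, IsProb (p i)) (h : Paired p ψ d i) :
    ψ / (i + d : ℕ) ≤ loMass p (i + d) :=
  le_min (h.2.trans (mul_le_of_le_one_left ((hp _).nonneg _) ((hp _).coeff_le_one _)))
    (h.1.trans (mul_le_of_le_one_left ((hp _).nonneg _) ((hp _).coeff_le_one _)))

lemma le_of_div_le_mul {a b x y l : ℝ} (hl : 0 < l) (hy : 0 ≤ y) (hx : x ≤ 1 / l)
    (h : a / b ≤ x * y) : a * l / b ≤ y := by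
  have h1 : a / b ≤ 1 / l * y := h.trans (mul_le_mul_of_nonneg_right hx hy)
  have h2 := mul_le_mul_of_nonneg_left h1 hl.le
  calc a * l / b = l * (a / b) := by ring
    _ ≤ l * (1 / l * y) := h2
    _ = y := by field_simp

/-- The overlap bounds products of masses from below, so if both masses of one index are at most `1
/ l`, those of its partner gain a factor `l`. -/
lemma Paired.le_loMass_right_of_hiMass_le (hp : ∀ i, IsProb (p i)) (h : Paired p ψ d i) {l : ℝ}
    (hl : 0 < l) (hi : hiMass p i ≤ 1 / l) : ψ * l / (i + d : ℕ) ≤ loMass p (i + d) :=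
  le_min (le_of_div_le_mul hl ((hp _).nonneg _) ((le_max_right _ _).trans hi) h.2)
    (le_of_div_le_mul hl ((hp _).nonneg _) ((le_max_left _ _).trans hi) h.1)

lemma Paired.le_loMass_left_of_hiMass_le (hp : ∀ i, IsProb (p i)) (h : Paired p ψ d i) {l : ℝ}
    (hl : 0 < l) (hi : hiMass p (i + d) ≤ 1 / l) : ψ * l / (i + d : ℕ) ≤ loMass p i :=
  le_min (le_of_div_le_mul hl ((hp _).nonneg _) ((le_max_right _ _).trans hi)
      (by rw [mul_comm]; exact h.1))
    (le_of_div_le_mul hl ((hp _).nonneg _) ((le_max_left _ _).trans hi)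
      (by rw [mul_comm]; exact h.2))

end Pairs

/-- Each block contains a paired index, for every step that is a power of two. -/
def BlockPaired (p : ℕ → ℝ[T;T⁻¹]) (k : ℕ) (ψ : ℝ) : Prop :=
  ∀ g j : ℕ, 1 ≤ j → ∃ i ∈ Finset.Icc (j * k + 1) ((j + 1) * k), Paired p ψ (2 ^ (g + 1)) i

/-! ### Choosing the hidden indices. -/

section Window

variable {p : ℕ → ℝ[T;T⁻¹]} {k : ℕ} {ψ : ℝ}

lemma div_le_div_three {c : ℝ} (hc : 0 ≤ c) {x M : ℕ} (hx : 1 ≤ x) (hxM : x ≤ 3 * M) :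
    c / (3 * M) ≤ c / x :=
  div_le_div_of_nonneg_left hc (by exact_mod_cast hx) (by exact_mod_cast hxM)

lemma card_filter_shift_le (E H : Finset ℕ) (d : ℕ) :
    (E.filter fun i => i + d ∈ H).card ≤ H.card :=
  Finset.card_le_card_of_injOn (fun i => i + d) (fun i hi => (Finset.mem_filter.1 hi).2)
    fun x _ y _ h => by simpa using h

/-- The choice of the indices carrying the hidden selection: their larger mass is at least `1 / L`,
and for each step there remain many pairs both of whose smaller masses are large in terms of `L`. -/
lemma exists_hidden_indices (hk : 1 ≤ k) (hψ : 0 < ψ) (hp : ∀ i, IsProb (p i))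
    (hpair : BlockPaired p k ψ) {M : ℕ} (hM : 16 * k ≤ M) :
    ∃ L : ℕ, 1 ≤ L ∧ ∃ G ⊆ Finset.Ioc M (3 * M), G.card = M / (16 * k) ∧
      (∀ i ∈ G, ψ / (3 * M) ≤ loMass p i ∧ 1 / (L : ℝ) ≤ hiMass p i) ∧
      ∀ g : ℕ, 2 ^ (g + 1) ≤ M → ∃ E ⊆ Finset.Ioc M (2 * M), (M : ℝ) / (4 * k) ≤ E.card ∧
        ∀ i ∈ E, i ∉ G ∧ i + 2 ^ (g + 1) ∉ G ∧ ψ * (L - 1) / (3 * M) ≤ loMass p i ∧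
          ψ * (L - 1) / (3 * M) ≤ loMass p (i + 2 ^ (g + 1)) := by
  classical
  have hk0 : (0 : ℝ) < k := by exact_mod_cast hk
  have hM1 : 1 ≤ M := by omega
  have hM0 : (0 : ℝ) < M := by exact_mod_cast hM1
  have hM16 : (16 : ℝ) * k ≤ M := by exact_mod_cast hM
  set ν := M / (16 * k) with hν
  have hνle : (ν : ℝ) ≤ M / (16 * k) := by
    have := Nat.cast_div_le (α := ℝ) (m := M) (n := 16 * k)
    push_cast at this; exact this
  have hMk : (16 : ℝ) ≤ M / k := by rw [le_div_iff₀ hk0]; exact hM16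
  have h16 : (M : ℝ) / (16 * k) = M / k / 16 := by field_simp
  have h4 : (M : ℝ) / (4 * k) = M / k / 4 := by field_simp
  set J : ℕ → Finset ℕ := fun L => (Finset.Ioc M (3 * M)).filter fun i =>
    ψ / (3 * M) ≤ loMass p i ∧ 1 / (L : ℝ) ≤ hiMass p i with hJ
  have hcount : ∀ g, (M : ℝ) / k - 2
      ≤ ((Finset.Ioc M (2 * M)).filter (Paired p ψ (2 ^ (g + 1)))).card :=
    fun g => card_blocks_ge hk (hpair g) M
  have hlo : ∀ g i, 2 ^ (g + 1) ≤ M → i ∈ (Finset.Ioc M (2 * M)).filter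
      (Paired p ψ (2 ^ (g + 1))) → ∀ c : ℝ, 0 ≤ c →
      c / (3 * M) ≤ c / (i + 2 ^ (g + 1) : ℕ) := fun g i hg hi c hc => by
    have h1 := Finset.mem_Ioc.1 (Finset.mem_filter.1 hi).1
    have h2 := Nat.one_le_two_pow (n := g + 1)
    exact div_le_div_three hc (by omega) (by omega)
  have hex : ∃ L : ℕ, 1 ≤ L ∧ ν ≤ (J L).card := by
    -- For `L` this large the condition on `hiMass` follows from the one on `loMass`, so paired
    -- indices for the step `2` already suffice.
    refine ⟨⌈3 * M / ψ⌉₊ + 1, by omega, ?_⟩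
    have hsub : (Finset.Ioc M (2 * M)).filter (Paired p ψ (2 ^ (0 + 1))) ⊆ J (⌈3 * M / ψ⌉₊ + 1) := by
      intro i hi
      have h1 := Finset.mem_filter.1 hi
      have h2 := Finset.mem_Ioc.1 h1.1
      have h3 : ψ / (3 * M) ≤ loMass p i :=
        (hlo 0 i (by omega) hi ψ hψ.le).trans (h1.2.le_loMass_left hp)
      refine Finset.mem_filter.2 ⟨Finset.mem_Ioc.2 ⟨h2.1, by omega⟩, h3, ?_⟩
      refine le_trans ?_ (h3.trans (loMass_le_hiMass p i))
      rw [show ψ / (3 * M) = 1 / (3 * M / ψ) by field_simp]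
      refine one_div_le_one_div_of_le (by positivity) ?_
      push_cast
      exact (Nat.le_ceil _).trans (by linarith)
    have h1 := (hcount 0).trans (Nat.cast_le.2 (Finset.card_le_card hsub))
    have h2 : (ν : ℝ) ≤ (J (⌈3 * M / ψ⌉₊ + 1)).card := by linarith
    exact_mod_cast h2
  obtain ⟨hL1, hLν⟩ := Nat.find_spec hex
  set L := Nat.find hex with hL
  have hLmin : ∀ l, 1 ≤ l → l < L → (J l).card < ν := fun l hl hlL => by
    have := Nat.find_min hex hlL
    by_contra hc
    exact this ⟨hl, not_lt.1 hc⟩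
  obtain ⟨G, hGJ, hGc⟩ := Finset.exists_subset_card_eq hLν
  refine ⟨L, hL1, G, hGJ.trans (Finset.filter_subset _ _), hGc,
    fun i hi => (Finset.mem_filter.1 (hGJ hi)).2, fun g hg => ?_⟩
  set d := 2 ^ (g + 1) with hd
  set P := (Finset.Ioc M (2 * M)).filter (Paired p ψ d) with hP
  set H : Finset ℕ := if L = 1 then ∅ else J (L - 1) with hH
  have hHc : H.card ≤ ν := by
    rw [hH]; split_ifs with h
    · simp
    · exact (hLmin (L - 1) (by omega) (by omega)).le
  set E := P.filter fun i => ¬ (i ∈ G ∪ H ∨ i + d ∈ G ∪ H) with hE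
  -- Each element of `G ∪ H` spoils at most two pairs, once as `i` and once as `i + d`.
  have hcard : P.card ≤ E.card + 4 * ν := by
    have h1 : (P.filter fun i => i ∈ G ∪ H ∨ i + d ∈ G ∪ H).card + E.card = P.card := by
      rw [hE]; exact Finset.card_filter_add_card_filter_not _
    have h2 : (P.filter fun i => i ∈ G ∪ H ∨ i + d ∈ G ∪ H).card
        ≤ (G ∪ H).card + (G ∪ H).card := by
      rw [Finset.filter_or]
      refine (Finset.card_union_le _ _).trans (add_le_add ?_ (card_filter_shift_le _ _ _))
      exact Finset.card_le_card fun i hi => (Finset.mem_filter.1 hi).2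
    have h3 := Finset.card_union_le G H
    omega
  refine ⟨E, (Finset.filter_subset _ _).trans (Finset.filter_subset _ _), ?_, fun i hi => ?_⟩
  · have h1 := hcount g
    have h2 : (P.card : ℝ) ≤ E.card + 4 * ν := by exact_mod_cast hcard
    linarith
  · obtain ⟨hiP, hin⟩ := Finset.mem_filter.1 hi
    obtain ⟨hiI, hpr⟩ := Finset.mem_filter.1 hiP
    simp only [Finset.mem_union, not_or] at hin
    refine ⟨hin.1.1, hin.2.1, ?_⟩
    have hiI' := Finset.mem_Ioc.1 hiI
    rcases eq_or_ne L 1 with h1 | h1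
    · rw [h1]; simp only [Nat.cast_one, sub_self, mul_zero, zero_div]
      exact ⟨loMass_nonneg hp _, loMass_nonneg hp _⟩
    · have hl : (0 : ℝ) < L - 1 := by
        have : (1 : ℝ) < L := by exact_mod_cast (by omega : 1 < L)
        linarith
      have hHJ : H = J (L - 1) := by rw [hH, if_neg h1]
      have hcast : ((L - 1 : ℕ) : ℝ) = L - 1 := by push_cast [hL1]; ring
      have key : ∀ x, x ∈ Finset.Ioc M (3 * M) → ψ / (3 * M) ≤ loMass p x → x ∉ H →
          hiMass p x ≤ 1 / (L - 1) := fun x hx hxl hxH => by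
        by_contra hc
        refine hxH (hHJ ▸ Finset.mem_filter.2 ⟨hx, hxl, ?_⟩)
        rw [hcast]; exact (not_le.1 hc).le
      have hc1 := hlo g i hg hiP ψ hψ.le
      have hc2 := hlo g i hg hiP (ψ * (L - 1)) (by positivity)
      have hx1 := key i (Finset.mem_Ioc.2 ⟨hiI'.1, by omega⟩)
        (hc1.trans (hpr.le_loMass_left hp)) hin.1.2
      have h2g := Nat.one_le_two_pow (n := g + 1)
      have hx2 := key (i + d) (Finset.mem_Ioc.2 ⟨by omega, by omega⟩)
        (hc1.trans (hpr.le_loMass_right hp)) hin.2.2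
      exact ⟨hc2.trans (hpr.le_loMass_left_of_hiMass_le hp hl hx2),
        hc2.trans (hpr.le_loMass_right_of_hiMass_le hp hl hx1)⟩

end Window

/-! ### Elementary inequalities -/

lemma mul_exp_neg_le {c x : ℝ} (hc : 0 < c) : x * Real.exp (-(c * x)) ≤ 1 / c := by
  have h1 := Real.add_one_le_exp (c * x)
  rw [Real.exp_neg, ← div_eq_mul_inv, div_le_div_iff₀ (Real.exp_pos _) hc]
  linarith

lemma sq_mul_exp_neg_le {c x : ℝ} (hc : 0 < c) (hx : 0 ≤ x) :
    x ^ 2 * Real.exp (-(c * x)) ≤ 2 / c ^ 2 := by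
  have h1 := Real.quadratic_le_exp_of_nonneg (x := c * x) (by positivity)
  rw [Real.exp_neg, ← div_eq_mul_inv, div_le_div_iff₀ (Real.exp_pos _) (by positivity)]
  nlinarith [mul_nonneg hc.le hx]

/-- Near the exceptional points `s` is `(M * dist2 θ) ^ 2`; the resulting `1 / L` cancels the `L` in
the support length. -/
lemma mul_exp_neg_le_div {c L s : ℝ} (hc : 0 < c) (hL : 1 ≤ L) (hs : 0 ≤ s) (hs1 : s ≤ 1) :
    s * Real.exp (-(c * (L - 1) * s)) ≤ (1 + 1 / c) / L := by
  have hL0 : 0 < L := by linarith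
  rw [le_div_iff₀ hL0]
  have h1 := mul_exp_neg_le (x := (L - 1) * s) hc
  rw [← mul_assoc] at h1
  have h2 : Real.exp (-(c * (L - 1) * s)) ≤ 1 := Real.exp_le_one_iff.2 (by
    have : 0 ≤ L - 1 := by linarith
    have : 0 ≤ c * (L - 1) * s := by positivity
    linarith)
  have h3 : s * Real.exp (-(c * (L - 1) * s)) ≤ 1 :=
    mul_le_one₀ hs1 (Real.exp_pos _).le h2
  calc s * Real.exp (-(c * (L - 1) * s)) * L
      = s * Real.exp (-(c * (L - 1) * s)) + (L - 1) * s * Real.exp (-(c * (L - 1) * s)) := by ring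
    _ ≤ _ := add_le_add h3 h1

lemma sq_mul_exp_neg_sub_one_le {c L : ℝ} (hc : 0 < c) (hL : 1 ≤ L) :
    L ^ 2 * Real.exp (-(c * (L - 1))) ≤ 2 + 4 / c ^ 2 := by
  have hL0 : 0 ≤ L - 1 := by linarith
  have h1 := sq_mul_exp_neg_le hc hL0
  have h2 : Real.exp (-(c * (L - 1))) ≤ 1 := Real.exp_le_one_iff.2 (by
    have : 0 ≤ c * (L - 1) := by positivity
    linarith)
  have h3 : L ^ 2 ≤ 2 + 2 * (L - 1) ^ 2 := by nlinarith [sq_nonneg (L - 2)]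
  calc L ^ 2 * Real.exp (-(c * (L - 1)))
      ≤ (2 + 2 * (L - 1) ^ 2) * Real.exp (-(c * (L - 1))) :=
        mul_le_mul_of_nonneg_right h3 (Real.exp_pos _).le
    _ = 2 * Real.exp (-(c * (L - 1))) + 2 * ((L - 1) ^ 2 * Real.exp (-(c * (L - 1)))) := by ring
    _ ≤ 2 * 1 + 2 * (2 / c ^ 2) := by gcongr
    _ = _ := by ring

lemma exp_neg_mul_log {γ x y : ℝ} (hx : 0 < x) (hy : 0 < y) :
    Real.exp (-(γ * Real.log (x / y))) = (y / x) ^ γ := by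
  rw [Real.rpow_def_of_pos (by positivity), Real.log_div hx.ne' hy.ne',
    Real.log_div hy.ne' hx.ne']
  congr 1; ring

/-- Here `t` is the squared modulus of the shift factor. A step `d > a` leaves only the indices
above `d` for damping, but then `t` is at most `40 (a/d)^2`, which makes up the loss since `γ ≤ 1`.
-/
lemma mul_rpow_max_le {t K a d M γ : ℝ} (hγ1 : γ ≤ 1) (hK : 1 ≤ K) (ha : 0 < a)
    (hd : 0 < d) (hM : 0 < M) (ht4 : t ≤ 4) (ht : t ≤ 40 * (a / d) ^ 2) :
    t * (K * max a d / M) ^ γ ≤ 40 * K * (a / M) ^ γ := by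
  have hKγ : K ^ γ ≤ K := by
    simpa using Real.rpow_le_rpow_of_exponent_le hK hγ1
  have hK0 : 0 < K := by linarith
  have hmax : 0 < max a d := lt_max_of_lt_left ha
  rw [mul_div_assoc, Real.mul_rpow hK0.le (by positivity)]
  suffices h : t * (max a d / M) ^ γ ≤ 40 * (a / M) ^ γ by
    have h0 : 0 ≤ (a / M) ^ γ := by positivity
    calc t * (K ^ γ * (max a d / M) ^ γ) = K ^ γ * (t * (max a d / M) ^ γ) := by ring
      _ ≤ K ^ γ * (40 * (a / M) ^ γ) := mul_le_mul_of_nonneg_left h (by positivity)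
      _ ≤ K * (40 * (a / M) ^ γ) := mul_le_mul_of_nonneg_right hKγ (by positivity)
      _ = _ := by ring
  rcases le_total d a with h | h
  · rw [max_eq_left h]
    exact mul_le_mul_of_nonneg_right (by linarith) (by positivity)
  · rw [max_eq_right h]
    have had : a / d ≤ 1 := (div_le_one hd).2 h
    have h1 : (a / d) ^ 2 ≤ (a / d) ^ γ := by
      rw [← Real.rpow_natCast]
      exact Real.rpow_le_rpow_of_exponent_ge (by positivity) had (by push_cast; linarith)
    calc t * (d / M) ^ γ ≤ 40 * (a / d) ^ γ * (d / M) ^ γ :=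
          mul_le_mul_of_nonneg_right (by linarith) (by positivity)
      _ = 40 * (a / M) ^ γ := by
          rw [mul_assoc, ← Real.mul_rpow (by positivity) (by positivity)]
          congr 2; field_simp

/-! ### The exceptional arcs -/

/-- The points of `[0, 1]` near `0`, `1/2` and `1`. -/
def nearSet (M : ℕ) : Set ℝ :=
  Set.Icc 0 (1 / (2 * M)) ∪ Set.Icc (1 / 2 - 1 / (2 * M)) (1 / 2 + 1 / (2 * M)) ∪
    Set.Icc (1 - 1 / (2 * M)) 1

lemma measurableSet_nearSet (M : ℕ) : MeasurableSet (nearSet M) :=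
  (measurableSet_Icc.union measurableSet_Icc).union measurableSet_Icc

lemma volume_nearSet_le {M : ℕ} (hM : 1 ≤ M) :
    volume.real (nearSet M ∩ Set.Icc 0 1) ≤ 2 / M := by
  have hM0 : (0 : ℝ) < M := by exact_mod_cast hM
  have hfin : volume (nearSet M) ≠ ⊤ := by
    unfold nearSet
    exact (measure_union_lt_top (measure_union_lt_top measure_Icc_lt_top measure_Icc_lt_top)
      measure_Icc_lt_top).ne
  refine (measureReal_mono Set.inter_subset_left hfin).trans ?_
  unfold nearSet
  refine (measureReal_union_le _ _).trans ((add_le_add_left (measureReal_union_le _ _) _).trans ?_)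
  have hd : (0 : ℝ) < 1 / (2 * M) := by positivity
  rw [Real.volume_real_Icc_of_le hd.le, Real.volume_real_Icc_of_le (by linarith),
    Real.volume_real_Icc_of_le (by linarith)]
  apply le_of_eq; field_simp; ring

lemma mul_dist2_le_one_of_mem {M : ℕ} (hM : 1 ≤ M) {θ : ℝ} (h : θ ∈ nearSet M) :
    M * dist2 θ ≤ 1 := by
  have hM0 : (0 : ℝ) < M := by exact_mod_cast hM
  have key : ∀ z : ℤ, |2 * θ - z| ≤ 1 / M → M * dist2 θ ≤ 1 := fun z hz => by
    have := (round_le (2 * θ) z).trans hz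
    rw [le_div_iff₀ hM0] at this
    unfold dist2; linarith
  have e : (1 : ℝ) / (2 * M) = 1 / M / 2 := by field_simp
  rcases h with (⟨h1, h2⟩ | ⟨h1, h2⟩) | ⟨h1, h2⟩ <;> rw [e] at *
  · exact key 0 (abs_le.2 ⟨by push_cast; linarith [one_div_pos.2 hM0], by push_cast; linarith⟩)
  · exact key 1 (abs_le.2 ⟨by push_cast; linarith, by push_cast; linarith⟩)
  · exact key 2 (abs_le.2 ⟨by push_cast; linarith, by push_cast; linarith [one_div_pos.2 hM0]⟩)

lemma one_le_mul_dist2_of_notMem {M : ℕ} (hM : 1 ≤ M) {θ : ℝ} (hθ : θ ∈ Set.Icc (0 : ℝ) 1)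
    (h : θ ∉ nearSet M) : 1 ≤ M * dist2 θ := by
  have hM0 : (0 : ℝ) < M := by exact_mod_cast hM
  by_contra hc
  have h1 : |2 * θ - round (2 * θ)| ≤ 1 / M := by
    rw [le_div_iff₀ hM0]; unfold dist2 at hc; linarith
  have e : (1 : ℝ) / (2 * M) = 1 / M / 2 := by field_simp
  have hM2 : (1 : ℝ) / M ≤ 1 := (div_le_one hM0).2 (by exact_mod_cast hM)
  obtain ⟨h2, h3⟩ := abs_le.1 h1
  obtain ⟨h4, h5⟩ := abs_le.1 (abs_sub_round (2 * θ))
  set z := round (2 * θ)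
  have hz1 : (-1 : ℝ) < z := by linarith [hθ.1]
  have hz2 : (z : ℝ) < 3 := by linarith [hθ.2]
  have hz1' : -1 < z := by exact_mod_cast hz1
  have hz2' : z < 3 := by exact_mod_cast hz2
  apply h
  unfold nearSet
  rw [e]
  obtain h0 | h0 | h0 : z = 0 ∨ z = 1 ∨ z = 2 := by omega
  all_goals rw [h0] at h2 h3; push_cast at h2 h3
  · exact Or.inl (Or.inl ⟨hθ.1, by linarith⟩)
  · exact Or.inl (Or.inr ⟨by linarith, by linarith⟩)
  · exact Or.inr ⟨by linarith, hθ.2⟩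

/-! ### The one-window recursion -/

section Window

variable {p : ℕ → ℝ[T;T⁻¹]} {k : ℕ} {ψ : ℝ}

/-- The rate at which a fair choice between `0` and `i` is extracted from `p i`. -/
def rate (p : ℕ → ℝ[T;T⁻¹]) (ψ L : ℝ) (M i : ℕ) : ℝ :=
  if i ≤ M then min (loMass p i) (ψ / i) else min (loMass p i) (ψ * L / (3 * M))

lemma rate_nonneg (hp : ∀ i, IsProb (p i)) (hψ : 0 ≤ ψ) {L : ℝ} (hL : 0 ≤ L) (M i : ℕ) :
    0 ≤ rate p ψ L M i := by
  unfold rate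
  split_ifs
  · exact le_min (loMass_nonneg hp i) (by positivity)
  · exact le_min (loMass_nonneg hp i) (by positivity)

lemma rate_le_loMass (p : ℕ → ℝ[T;T⁻¹]) (ψ L : ℝ) (M i : ℕ) : rate p ψ L M i ≤ loMass p i := by
  unfold rate; split_ifs <;> exact min_le_left _ _

lemma log_le_sum_rate (hk : 1 ≤ k) (hψ : 0 < ψ) (hp : ∀ i, IsProb (p i))
    (hpair : BlockPaired p k ψ) {a M : ℕ} (ha : 1 ≤ a) (hM : 2 ≤ M) {L : ℝ} (hL : 0 ≤ L) (g : ℕ)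
    {θ : ℝ} (hcos : 1 / 2 ≤ 1 - Real.cos (2 * Real.pi * θ * (2 ^ (g + 1) : ℕ))) :
    ψ / (16 * k) * Real.log (M / (4 * (2 * k + 1) * max (a : ℝ) ((2 ^ (g + 1) : ℕ) : ℝ)))
      ≤ ∑ i ∈ Finset.Ioc a M, rate p ψ L M i * (1 - Real.cos (2 * Real.pi * θ * i)) := by
  classical
  have hk0 : (0 : ℝ) < k := by exact_mod_cast hk
  set d := 2 ^ (g + 1) with hd
  -- Indices in `(A, M / 2]` satisfy `i + d ≤ 2 * i ≤ M`, so both members of a pair lie in `(a, M]`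
  -- and `ψ / (i + d) ≥ ψ / (2 * i)`.
  set A := max a d with hA
  have hA1 : 1 ≤ A := le_max_of_le_left ha
  have hAc : max (a : ℝ) ((d : ℕ) : ℝ) = (A : ℝ) := (Nat.cast_max a d).symm
  rw [hAc]
  have hA0 : (0 : ℝ) < A := by exact_mod_cast hA1
  have hM0 : (0 : ℝ) < M := by exact_mod_cast (by omega : 0 < M)
  set E := (Finset.Ioc A (M / 2)).filter (Paired p ψ d) with hE
  have hmem : ∀ i ∈ E, a < i ∧ d < i ∧ 2 * i ≤ M ∧ Paired p ψ d i := fun i hi => by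
    obtain ⟨h1, h2⟩ := Finset.mem_filter.1 hi
    have h1 := Finset.mem_Ioc.1 h1
    have := le_max_left a d
    have := le_max_right a d
    exact ⟨by omega, by omega, by omega, h2⟩
  have h2g := Nat.one_le_two_pow (n := g + 1)
  have hcmp : ∀ i ∈ E, ψ / (2 * i) ≤ ψ / (i + d : ℕ) := fun i hi => by
    obtain ⟨h1, h2, h3, -⟩ := hmem i hi
    refine div_le_div_of_nonneg_left hψ.le (by exact_mod_cast (by omega : 0 < i + d)) ?_
    exact_mod_cast (by omega : i + d ≤ 2 * i)
  have hS := sum_pairs_le (F := Finset.Ioc a M) (E := E) d (ρ := rate p ψ L M)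
    (c := fun i => ψ / (2 * i)) (fun i _ => rate_nonneg hp hψ.le hL M i)
    (fun i _ => by positivity)
    (fun i hi => by
      obtain ⟨h1, h2, h3, h4⟩ := hmem i hi
      refine ⟨Finset.mem_Ioc.2 ⟨h1, by omega⟩, ?_⟩
      rw [rate, if_pos (by omega)]
      refine le_min ((hcmp i hi).trans (h4.le_loMass_left hp)) ?_
      have : (0 : ℝ) < i := by exact_mod_cast (by omega : 0 < i)
      exact div_le_div_of_nonneg_left hψ.le this (by linarith))
    (fun i hi => by
      obtain ⟨h1, h2, h3, h4⟩ := hmem i hi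
      refine ⟨Finset.mem_Ioc.2 ⟨by omega, by omega⟩, ?_⟩
      rw [rate, if_pos (by omega)]
      exact le_min ((hcmp i hi).trans (h4.le_loMass_right hp)) (hcmp i hi)) θ
  refine le_trans ?_ hS
  have hlog := log_le_sum_blocks (Q := Paired p ψ d) hk (hpair g) hA1 (M / 2)
  have hsum : ∑ i ∈ E, ψ / (2 * (i : ℝ)) = ψ / 2 * ∑ i ∈ E, 1 / (i : ℝ) := by
    rw [Finset.mul_sum]; exact Finset.sum_congr rfl fun i _ => by rw [div_mul_div_comm, mul_one]
  have hM2 : (M : ℝ) / 4 ≤ (M / 2 : ℕ) := by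
    have : M ≤ 4 * (M / 2) := by omega
    have : (M : ℝ) ≤ 4 * (M / 2 : ℕ) := by exact_mod_cast this
    linarith
  have hlog2 : Real.log (M / (4 * (2 * k + 1) * A))
      ≤ Real.log ((M / 2 : ℕ) / ((2 * k + 1) * A)) := by
    refine Real.log_le_log (by positivity) ?_
    rw [show (M : ℝ) / (4 * (2 * k + 1) * A) = M / 4 / ((2 * k + 1) * A) by field_simp]
    exact div_le_div_of_nonneg_right hM2 (by positivity)
  have hEnn : 0 ≤ ∑ i ∈ E, 1 / (i : ℝ) := Finset.sum_nonneg fun _ _ => by positivity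
  rw [hsum]
  calc ψ / (16 * k) * Real.log (M / (4 * (2 * k + 1) * A))
      ≤ ψ / (16 * k) * Real.log ((M / 2 : ℕ) / ((2 * k + 1) * A)) :=
        mul_le_mul_of_nonneg_left hlog2 (by positivity)
    _ = 1 / 8 * (ψ / 2 * (1 / k * Real.log ((M / 2 : ℕ) / ((2 * k + 1) * A)))) := by
        field_simp; ring
    _ ≤ 1 / 8 * (ψ / 2 * ∑ i ∈ E, 1 / (i : ℝ)) := by gcongr
    _ ≤ 1 / 4 * (1 - Real.cos (2 * Real.pi * θ * d)) * (ψ / 2 * ∑ i ∈ E, 1 / (i : ℝ)) := by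
        refine mul_le_mul_of_nonneg_right (by linarith) (by positivity)

/-- Used with `z = 1` away from the exceptional points and `z = (M * dist2 θ) ^ 2` near them. -/
lemma le_sum_rate_window (hk : 1 ≤ k) (hψ : 0 < ψ) (hp : ∀ i, IsProb (p i)) {M : ℕ} (hM : 1 ≤ M)
    {L : ℝ} (hL : 1 ≤ L) {G E : Finset ℕ} {d : ℕ} (hdM : d ≤ M) (hE : E ⊆ Finset.Ioc M (2 * M))
    (hEc : (M : ℝ) / (4 * k) ≤ E.card)
    (hE2 : ∀ i ∈ E, i ∉ G ∧ i + d ∉ G ∧ ψ * (L - 1) / (3 * M) ≤ loMass p i ∧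
          ψ * (L - 1) / (3 * M) ≤ loMass p (i + d)) {θ z : ℝ} (hz : 0 ≤ z)
    (hcos : 1 / 2 * z ≤ 1 - Real.cos (2 * Real.pi * θ * d)) :
    ψ / (96 * k) * (L - 1) * z
      ≤ ∑ i ∈ Finset.Ioc M (3 * M) \ G, rate p ψ L M i * (1 - Real.cos (2 * Real.pi * θ * i)) := by
  have hk0 : (0 : ℝ) < k := by exact_mod_cast hk
  have hM0 : (0 : ℝ) < M := by exact_mod_cast hM
  have hL0 : 0 ≤ L - 1 := by linarith
  have hle : ψ * (L - 1) / (3 * M) ≤ ψ * L / (3 * M) := by gcongr; linarith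
  have hS := sum_pairs_le (F := Finset.Ioc M (3 * M) \ G) (E := E) d (ρ := rate p ψ L M)
    (c := fun _ => ψ * (L - 1) / (3 * M)) (fun i _ => rate_nonneg hp hψ.le (by linarith) M i)
    (fun i _ => by positivity)
    (fun i hi => by
      have h1 := Finset.mem_Ioc.1 (hE hi)
      obtain ⟨h2, h3, h4, h5⟩ := hE2 i hi
      refine ⟨Finset.mem_sdiff.2 ⟨Finset.mem_Ioc.2 ⟨h1.1, by omega⟩, h2⟩, ?_⟩
      rw [rate, if_neg (by omega)]
      exact le_min h4 hle)
    (fun i hi => by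
      have h1 := Finset.mem_Ioc.1 (hE hi)
      obtain ⟨h2, h3, h4, h5⟩ := hE2 i hi
      refine ⟨Finset.mem_sdiff.2 ⟨Finset.mem_Ioc.2 ⟨by omega, by omega⟩, h3⟩, ?_⟩
      rw [rate, if_neg (by omega)]
      exact le_min h5 hle) θ
  refine le_trans ?_ hS
  rw [Finset.sum_const, nsmul_eq_mul]
  calc ψ / (96 * k) * (L - 1) * z
      = 1 / 4 * (1 / 2 * z) * (M / (4 * k) * (ψ * (L - 1) / (3 * M))) := by field_simp; ring
    _ ≤ _ := by
      have hc0 : 0 ≤ 1 - Real.cos (2 * Real.pi * θ * d) := le_trans (by positivity) hcos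
      gcongr

end Window

/-! ### Frequency bounds and the contraction step. -/

section Window

variable {p : ℕ → ℝ[T;T⁻¹]} {k : ℕ} {ψ : ℝ}

lemma sum_rate_union {a M : ℕ} (G : Finset ℕ) (f : ℕ → ℝ) :
    ∑ i ∈ Finset.Ioc a M ∪ (Finset.Ioc M (3 * M) \ G), f i
      = ∑ i ∈ Finset.Ioc a M, f i + ∑ i ∈ Finset.Ioc M (3 * M) \ G, f i := by
  refine Finset.sum_union (Finset.disjoint_left.2 fun i hi hi' => ?_)
  have h1 := Finset.mem_Ioc.1 hi
  have h2 := Finset.mem_Ioc.1 (Finset.mem_sdiff.1 hi').1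
  omega

lemma meanSq_nonneg {F : Finset ℕ} {ρ : ℕ → ℝ} (hρ : ∀ i ∈ F, 0 ≤ ρ i)
    (hρ' : ∀ i ∈ F, 2 * ρ i ≤ 1) (Δ : ℕ) (θ : ℝ) : 0 ≤ meanSq ρ F Δ θ := by
  refine mul_nonneg (by linarith [Real.cos_le_one (2 * Real.pi * θ * Δ)])
    (Finset.prod_nonneg fun i hi => ?_)
  have h1 := mul_le_mul_of_nonneg_left (Real.neg_one_le_cos (2 * Real.pi * θ * i)) (hρ i hi)
  linarith [hρ' i hi]

lemma meanSq_le_exp (hp : ∀ i, IsProb (p i)) (hψ : 0 ≤ ψ) {L : ℝ} (hL : 0 ≤ L) {a M : ℕ}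
    (G : Finset ℕ) (Δ : ℕ) (θ : ℝ) :
    meanSq (rate p ψ L M) (Finset.Ioc a M ∪ (Finset.Ioc M (3 * M) \ G)) Δ θ
      ≤ (2 - 2 * Real.cos (2 * Real.pi * θ * Δ)) *
        (Real.exp (-∑ i ∈ Finset.Ioc a M, rate p ψ L M i * (1 - Real.cos (2 * Real.pi * θ * i))) *
        Real.exp (-∑ i ∈ Finset.Ioc M (3 * M) \ G,
          rate p ψ L M i * (1 - Real.cos (2 * Real.pi * θ * i)))) := by
  have h := Real.cos_le_one (2 * Real.pi * θ * Δ)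
  refine mul_le_mul_of_nonneg_left ?_ (by linarith)
  rw [← Real.exp_add, ← neg_add, ← sum_rate_union]
  refine prod_one_sub_le_exp _ (fun i hi => ?_) (fun i _ => rate_nonneg hp hψ hL M i) θ
  have hi1 : 1 ≤ i := by
    rcases Finset.mem_union.1 hi with h | h
    · have := Finset.mem_Ioc.1 h; omega
    · have := Finset.mem_Ioc.1 (Finset.mem_sdiff.1 h).1; omega
  have := two_mul_loMass_le hp hi1
  have := rate_le_loMass p ψ L M i
  linarith

lemma exp_neg_sum_rate_le_one (hp : ∀ i, IsProb (p i)) (hψ : 0 ≤ ψ) {L : ℝ} (hL : 0 ≤ L) (M : ℕ)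
    (F : Finset ℕ) (θ : ℝ) :
    Real.exp (-∑ i ∈ F, rate p ψ L M i * (1 - Real.cos (2 * Real.pi * θ * i))) ≤ 1 := by
  refine Real.exp_le_one_iff.2 (neg_nonpos.2 (Finset.sum_nonneg fun i _ =>
    mul_nonneg (rate_nonneg hp hψ hL M i) ?_))
  linarith [Real.cos_le_one (2 * Real.pi * θ * i)]

/-- The indices in `(a, M]` give the power of `max a d / M`, which the shift factor improves to a
power of `a / M`; the window pairs give the exponential in `L`. -/
lemma meanSq_le_far (hk : 1 ≤ k) (hψ : 0 < ψ) (hψ1 : ψ ≤ 1) (hp : ∀ i, IsProb (p i))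
    (hpair : BlockPaired p k ψ) {a M m : ℕ} (ha : 1 ≤ a) (hM : 2 ≤ M) (hm : m ≤ a)
    {L : ℝ} (hL : 1 ≤ L) {G : Finset ℕ}
    (hG : ∀ g : ℕ, 2 ^ (g + 1) ≤ M → ∃ E ⊆ Finset.Ioc M (2 * M), (M : ℝ) / (4 * k) ≤ E.card ∧
        ∀ i ∈ E, i ∉ G ∧ i + 2 ^ (g + 1) ∉ G ∧ ψ * (L - 1) / (3 * M) ≤ loMass p i ∧
          ψ * (L - 1) / (3 * M) ≤ loMass p (i + 2 ^ (g + 1)))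
    {θ : ℝ} (hθ : 1 ≤ M * dist2 θ) :
    meanSq (rate p ψ L M) (Finset.Ioc a M ∪ (Finset.Ioc M (3 * M) \ G)) (2 * m) θ
      ≤ 40 * (4 * (2 * k + 1)) * ((a : ℝ) / M) ^ (ψ / (16 * k)) *
        Real.exp (-(ψ / (96 * k) * (L - 1))) := by
  have hk0 : (1 : ℝ) ≤ k := by exact_mod_cast hk
  have ha0 : (0 : ℝ) < a := by exact_mod_cast ha
  have hM0 : (0 : ℝ) < M := by exact_mod_cast (by omega : 0 < M)
  obtain ⟨g, hgM, hgy, hcos⟩ := exists_pow_two_one_sub_cos hM θ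
  rw [min_eq_left hθ, one_pow] at hcos
  obtain ⟨E, hE, hEc, hE2⟩ := hG g hgM
  have h1 := log_le_sum_rate hk hψ hp hpair ha hM (by linarith : 0 ≤ L) g (θ := θ) (by linarith)
  have h2 := le_sum_rate_window hk hψ hp (by omega) hL hgM hE hEc hE2 zero_le_one hcos
  rw [mul_one] at h2
  have hd0 : (0 : ℝ) < ((2 ^ (g + 1) : ℕ) : ℝ) := by positivity
  have hγ1 : ψ / (16 * k) ≤ 1 := by rw [div_le_one (by positivity)]; linarith
  set d : ℝ := ((2 ^ (g + 1) : ℕ) : ℝ)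
  have ht := two_sub_two_cos_le θ m
  have ht4 : 2 - 2 * Real.cos (2 * Real.pi * θ * (2 * m : ℕ)) ≤ 4 := by
    linarith [Real.neg_one_le_cos (2 * Real.pi * θ * (2 * m : ℕ))]
  have ht0 : 0 ≤ 2 - 2 * Real.cos (2 * Real.pi * θ * (2 * m : ℕ)) := by
    linarith [Real.cos_le_one (2 * Real.pi * θ * (2 * m : ℕ))]
  have ht' : 2 - 2 * Real.cos (2 * Real.pi * θ * (2 * m : ℕ)) ≤ 40 * (a / d) ^ 2 := by
    have hy : dist2 θ ≤ 1 / d := by rw [le_div_iff₀ hd0]; linarith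
    have hma : ((2 * m : ℕ) : ℝ) ≤ 2 * a := by exact_mod_cast Nat.mul_le_mul_left 2 hm
    have hmul : ((2 * m : ℕ) : ℝ) * dist2 θ ≤ 2 * a * (1 / d) :=
      mul_le_mul hma hy (dist2_nonneg θ) (by positivity)
    have hsq := pow_le_pow_left₀ (mul_nonneg (Nat.cast_nonneg _) (dist2_nonneg θ)) hmul 2
    calc _ ≤ 10 * (2 * a * (1 / d)) ^ 2 := by linarith
      _ = _ := by ring
  have hmx := mul_rpow_max_le (K := 4 * (2 * k + 1)) hγ1 (by linarith) ha0 hd0 hM0 ht4 ht'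
  refine (meanSq_le_exp hp hψ.le (by linarith) G (2 * m) θ).trans ?_
  have e1 : Real.exp (-∑ i ∈ Finset.Ioc a M, rate p ψ L M i *
      (1 - Real.cos (2 * Real.pi * θ * i))) ≤ (4 * (2 * k + 1) * max (a : ℝ) d / M) ^ (ψ / (16 * k)) := by
    rw [← exp_neg_mul_log hM0 (by positivity)]
    exact Real.exp_le_exp.2 (neg_le_neg h1)
  have e2 := Real.exp_le_exp.2 (neg_le_neg h2)
  calc _ ≤ (2 - 2 * Real.cos (2 * Real.pi * θ * (2 * m : ℕ))) *
        ((4 * (2 * k + 1) * max (a : ℝ) d / M) ^ (ψ / (16 * k)) *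
          Real.exp (-(ψ / (96 * k) * (L - 1)))) :=
        mul_le_mul_of_nonneg_left (mul_le_mul e1 e2 (Real.exp_pos _).le (by positivity)) ht0
    _ ≤ _ := by
        rw [← mul_assoc]
        exact mul_le_mul_of_nonneg_right hmx (Real.exp_pos _).le

/-- The damping from `(a, M]` is discarded: the shift factor is already of order `(a/M)^2 (M * dist2
θ)^2`, and the window pairs turn the last square into `1 / L`. -/
lemma meanSq_le_near (hk : 1 ≤ k) (hψ : 0 < ψ) (hp : ∀ i, IsProb (p i)) {a M m : ℕ}
    (hM : 2 ≤ M) (hm : m ≤ a) {L : ℝ} (hL : 1 ≤ L) {G : Finset ℕ}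
    (hG : ∀ g : ℕ, 2 ^ (g + 1) ≤ M → ∃ E ⊆ Finset.Ioc M (2 * M), (M : ℝ) / (4 * k) ≤ E.card ∧
        ∀ i ∈ E, i ∉ G ∧ i + 2 ^ (g + 1) ∉ G ∧ ψ * (L - 1) / (3 * M) ≤ loMass p i ∧
          ψ * (L - 1) / (3 * M) ≤ loMass p (i + 2 ^ (g + 1)))
    {θ : ℝ} (hθ : M * dist2 θ ≤ 1) :
    meanSq (rate p ψ L M) (Finset.Ioc a M ∪ (Finset.Ioc M (3 * M) \ G)) (2 * m) θ
      ≤ 40 * ((a : ℝ) / M) ^ 2 * ((1 + 1 / (ψ / (96 * k))) / L) := by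
  have hk0 : (1 : ℝ) ≤ k := by exact_mod_cast hk
  have hM0 : (0 : ℝ) < M := by exact_mod_cast (by omega : 0 < M)
  obtain ⟨g, hgM, hgy, hcos⟩ := exists_pow_two_one_sub_cos hM θ
  rw [min_eq_right hθ] at hcos
  obtain ⟨E, hE, hEc, hE2⟩ := hG g hgM
  have h2 := le_sum_rate_window hk hψ hp (by omega) hL hgM hE hEc hE2 (sq_nonneg (M * dist2 θ)) hcos
  have hs0 : 0 ≤ M * dist2 θ := mul_nonneg hM0.le (dist2_nonneg θ)
  have ht := two_sub_two_cos_le θ m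
  have ht0 : 0 ≤ 2 - 2 * Real.cos (2 * Real.pi * θ * (2 * m : ℕ)) := by
    linarith [Real.cos_le_one (2 * Real.pi * θ * (2 * m : ℕ))]
  have ht' : 2 - 2 * Real.cos (2 * Real.pi * θ * (2 * m : ℕ))
      ≤ 40 * ((a : ℝ) / M) ^ 2 * (M * dist2 θ) ^ 2 := by
    have hma : ((2 * m : ℕ) : ℝ) ≤ 2 * a := by exact_mod_cast Nat.mul_le_mul_left 2 hm
    have hmul : ((2 * m : ℕ) : ℝ) * dist2 θ ≤ 2 * a * dist2 θ :=
      mul_le_mul_of_nonneg_right hma (dist2_nonneg θ)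
    have hsq := pow_le_pow_left₀ (mul_nonneg (Nat.cast_nonneg _) (dist2_nonneg θ)) hmul 2
    calc _ ≤ 10 * (2 * a * dist2 θ) ^ 2 := by linarith
      _ = _ := by field_simp; ring
  refine (meanSq_le_exp hp hψ.le (by linarith) G (2 * m) θ).trans ?_
  have e1 := exp_neg_sum_rate_le_one hp hψ.le (by linarith : 0 ≤ L) M (Finset.Ioc a M) θ
  have e2 := Real.exp_le_exp.2 (neg_le_neg h2)
  have e3 := mul_exp_neg_le_div (c := ψ / (96 * k)) (by positivity) hL (sq_nonneg (M * dist2 θ))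
    (pow_le_one₀ hs0 hθ)
  calc _ ≤ 40 * ((a : ℝ) / M) ^ 2 * (M * dist2 θ) ^ 2 *
        (1 * Real.exp (-(ψ / (96 * k) * (L - 1) * (M * dist2 θ) ^ 2))) :=
        mul_le_mul ht' (mul_le_mul e1 e2 (Real.exp_pos _).le zero_le_one)
          (by positivity) (by positivity)
    _ = 40 * ((a : ℝ) / M) ^ 2 * ((M * dist2 θ) ^ 2 *
        Real.exp (-(ψ / (96 * k) * (L - 1) * (M * dist2 θ) ^ 2))) := by ring
    _ ≤ _ := mul_le_mul_of_nonneg_left e3 (by positivity)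

/-- This is why `rate` is capped: the mean of the selected sum, and with it the mean support length,
must stay of order `L * M` even where `loMass` is large. -/
lemma sum_rate_mul_le (hψ1 : ψ ≤ 1) {a M : ℕ} (hM : 1 ≤ M) {L : ℝ}
    (hL : 1 ≤ L) (G : Finset ℕ) :
    ∑ i ∈ Finset.Ioc a M ∪ (Finset.Ioc M (3 * M) \ G), 2 * rate p ψ L M i * i
      ≤ 2 * M + 4 * L * M := by
  have hM0 : (0 : ℝ) < M := by exact_mod_cast hM
  rw [sum_rate_union]
  refine add_le_add ?_ ?_
  · refine (Finset.sum_le_card_nsmul _ _ 2 fun i hi => ?_).trans ?_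
    · have h1 := Finset.mem_Ioc.1 hi
      have hi0 : (0 : ℝ) < i := by exact_mod_cast (by omega : 0 < i)
      rw [rate, if_pos h1.2]
      have : min (loMass p i) (ψ / i) * i ≤ ψ / i * i :=
        mul_le_mul_of_nonneg_right (min_le_right _ _) hi0.le
      rw [div_mul_cancel₀ _ hi0.ne'] at this
      linarith
    · rw [Nat.card_Ioc, nsmul_eq_mul, mul_comm]
      have : ((M - a : ℕ) : ℝ) ≤ M := by exact_mod_cast Nat.sub_le M a
      linarith
  · refine (Finset.sum_le_card_nsmul _ _ (2 * L) fun i hi => ?_).trans ?_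
    · have h1 := Finset.mem_Ioc.1 (Finset.mem_sdiff.1 hi).1
      have hi3 : (i : ℝ) ≤ 3 * M := by exact_mod_cast h1.2
      rw [rate, if_neg (by omega)]
      have h2 : min (loMass p i) (ψ * L / (3 * M)) ≤ L / (3 * M) := by
        refine (min_le_right _ _).trans ?_
        have : ψ * L ≤ L := by nlinarith
        gcongr
      calc 2 * min (loMass p i) (ψ * L / (3 * M)) * i ≤ 2 * (L / (3 * M)) * i := by gcongr
        _ ≤ 2 * (L / (3 * M)) * (3 * M) := by gcongr
        _ = _ := by field_simp
    · rw [nsmul_eq_mul]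
      have h1 : (Finset.Ioc M (3 * M) \ G).card ≤ 2 * M := by
        refine (Finset.card_le_card Finset.sdiff_subset).trans ?_
        rw [Nat.card_Ioc]; omega
      have h2 : ((Finset.Ioc M (3 * M) \ G).card : ℝ) ≤ 2 * M := by exact_mod_cast h1
      nlinarith

/-- The square of the constant in the one-window recursion. -/
def windowConst (k : ℕ) (ψ : ℝ) : ℝ :=
  15 * (160 * (2 * k + 1) * (2 + 4 / (ψ / (96 * k)) ^ 2) + 80 * (1 + 1 / (ψ / (96 * k))))

set_option maxHeartbeats 800000 in
-- If exactly one hidden selection occurs, the Fourier bounds apply to it and the fair choices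
-- outside `G`; otherwise the norm over `(a, M]` is kept.
lemma window_step (hk : 1 ≤ k) (hψ : 0 < ψ) (hψ1 : ψ ≤ 1) (hp : ∀ i, IsProb (p i))
    (hpair : BlockPaired p k ψ) {a M m : ℕ} (ha : 1 ≤ a) (haM : a ≤ M) (hM : 16 * k ≤ M)
    (hm : m ≤ a) :
    l1 ((1 - T ((2 * m : ℕ) : ℤ)) * ∏ i ∈ Finset.Ioc a (3 * M), p i)
      ≤ (1 - ψ / (192 * k)) * l1 ((1 - T ((2 * m : ℕ) : ℤ)) * ∏ i ∈ Finset.Ioc a M, p i)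
        + √(windowConst k ψ) * ((a : ℝ) / M) ^ (ψ / (32 * k)) := by
  classical
  have hk0 : (1 : ℝ) ≤ k := by exact_mod_cast hk
  have ha0 : (0 : ℝ) < a := by exact_mod_cast ha
  have hM1 : 1 ≤ M := by omega
  have hM0 : (0 : ℝ) < M := by exact_mod_cast hM1
  obtain ⟨L, hL1, G, hGsub, hGc, hGm, hG⟩ := exists_hidden_indices hk hψ hp hpair hM
  have hL1' : (1 : ℝ) ≤ L := by exact_mod_cast hL1
  have hL0 : (0 : ℝ) < L := by linarith
  set α : ℝ := 1 / L with hα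
  set β : ℝ := ψ / (3 * M) with hβ
  have hα0 : 0 < α := by positivity
  have hβ0 : 0 ≤ β := by positivity
  set u : ℕ → ℤ := fun i => if (p i).coeff i ≤ (p i).coeff 0 then 0 else i with hu
  set s : ℕ → ℤ := fun i => if (p i).coeff i ≤ (p i).coeff 0 then i else 0 with hs
  set v : ℕ → ℤ := fun i => s i - u i with hv
  have hvabs : ∀ i, |v i| = i := fun i => by
    simp only [hv, hu, hs]; split_ifs <;> simp
  have hαu : ∀ i ∈ G, α ≤ (p i).coeff (u i) := fun i hi => by
    have h := (hGm i hi).2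
    simp only [hu, hiMass] at h ⊢
    split_ifs with hc
    · rwa [max_eq_left hc] at h
    · rwa [max_eq_right (not_le.1 hc).le] at h
  have hβs : ∀ i ∈ G, β ≤ (p i).coeff (s i) := fun i hi => by
    have h := (hGm i hi).1
    simp only [hs, loMass] at h ⊢
    split_ifs with hc
    · rwa [min_eq_right hc] at h
    · rwa [min_eq_left (not_le.1 hc).le] at h
  have hus : ∀ i ∈ G, u i ≠ s i := fun i hi => by
    have := Finset.mem_Ioc.1 (hGsub hi)
    simp only [hu, hs]; split_ifs <;> omega
  have hGpos : 1 ≤ G.card := by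
    rw [hGc]; exact (Nat.one_le_div_iff (by omega)).2 hM
  have hαβ : α + β ≤ 1 := by
    obtain ⟨i, hi⟩ := Finset.card_pos.1 hGpos
    exact (hp i).add_le_one (hus i hi) (hαu i hi) (hβs i hi)
  set F := Finset.Ioc a M ∪ (Finset.Ioc M (3 * M) \ G) with hF
  have hprod : ∏ i ∈ Finset.Ioc a (3 * M), p i = (∏ i ∈ F, p i) * ∏ i ∈ G, p i := by
    have hd : Disjoint F G := by
      rw [Finset.disjoint_left]
      intro i hi hiG
      rcases Finset.mem_union.1 hi with h | h
      · have h1 := Finset.mem_Ioc.1 h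
        have h2 := Finset.mem_Ioc.1 (hGsub hiG)
        omega
      · exact (Finset.mem_sdiff.1 h).2 hiG
    rw [← Finset.prod_union hd]
    congr 1
    ext i
    simp only [hF, Finset.mem_union, Finset.mem_sdiff, Finset.mem_Ioc]
    constructor
    · intro h
      by_cases h1 : i ∈ G
      · exact Or.inr h1
      · by_cases h2 : i ≤ M
        · exact Or.inl (Or.inl ⟨h.1, h2⟩)
        · exact Or.inl (Or.inr ⟨⟨by omega, h.2⟩, h1⟩)
    · rintro ((h | h) | h)
      · omega
      · omega
      · have := Finset.mem_Ioc.1 (hGsub h); omega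
  have hFprod : l1 ((1 - T ((2 * m : ℕ) : ℤ)) * ∏ i ∈ F, p i)
      ≤ l1 ((1 - T ((2 * m : ℕ) : ℤ)) * ∏ i ∈ Finset.Ioc a M, p i) := by
    rw [hF, Finset.prod_union (Finset.disjoint_left.2 fun i hi hi' => by
      have h1 := Finset.mem_Ioc.1 hi
      have h2 := Finset.mem_Ioc.1 (Finset.mem_sdiff.1 hi').1
      omega), ← mul_assoc]
    exact l1_mul_prod_le_of_isProb _ _ hp
  obtain ⟨hc1, hstep⟩ := l1_mul_prod_le_hidden G p
    (fun i => p i - (C α * T (u i) + C β * T (s i))) hα0 hβ0 u s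
    ((1 - T ((2 * m : ℕ) : ℤ)) * ∏ i ∈ F, p i) (fun i _ => by ring)
    (fun i hi => (hp i).isNonneg_sub (hus i hi) (hαu i hi) (hβs i hi))
    (fun i _ => (hp i).mass_sub _ _ _ _)
  rw [mul_assoc _ (∏ i ∈ F, p i) (∏ i ∈ G, p i), ← hprod] at hstep
  have hcard := sum_hidWeight_mul_card hα0.ne' β G
  have h1 : ∑ B ∈ G.powerset, hidWeight α β G B * B.card ≤ 1 := hcard.trans_le hc1
  have hνle : (G.card : ℝ) ≤ M / (16 * k) := by
    have := Nat.cast_div_le (α := ℝ) (m := M) (n := 16 * k)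
    rw [hGc]; push_cast at this; exact this
  have hνge : (M : ℝ) / (32 * k) ≤ G.card := by
    have h2 : M < (M / (16 * k) + 1) * (16 * k) := by
      have h1 := Nat.div_add_mod M (16 * k)
      have h2 := Nat.mod_lt M (by omega : 16 * k > 0)
      rw [add_mul, mul_comm (M / (16 * k))]; omega
    have h3 : M ≤ (2 * G.card) * (16 * k) :=
      h2.le.trans (Nat.mul_le_mul_right _ (by rw [← hGc]; omega))
    rw [div_le_iff₀ (by positivity)]
    have h4 : (M : ℝ) ≤ (2 * G.card) * (16 * k) := by exact_mod_cast h3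
    linarith
  -- Bernoulli's inequality gives `(1 - β) ^ (|G| - 1) ≥ 1 / 2` since `|G| * β ≤ 1 / 2`; then `192 =
  -- 32 * 3 * 2`.
  have hsucc : ψ / (192 * k) ≤ G.card * β * (1 - β) ^ (G.card - 1) := by
    have hb : β ≤ 1 := by linarith
    have hber := one_add_mul_le_pow (a := -β) (by linarith) (G.card - 1)
    rw [← sub_eq_add_neg] at hber
    have hn : ((G.card - 1 : ℕ) : ℝ) ≤ G.card := by exact_mod_cast Nat.sub_le _ _
    have hnb : (G.card : ℝ) * β ≤ 1 / 2 := by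
      calc (G.card : ℝ) * β ≤ M / (16 * k) * (1 / (3 * M)) := by
            rw [hβ]; gcongr
        _ = 1 / (48 * k) := by field_simp; norm_num
        _ ≤ 1 / 2 := one_div_le_one_div_of_le (by norm_num) (by linarith)
    have hhalf : 1 / 2 ≤ (1 - β) ^ (G.card - 1) := by
      have := mul_le_mul_of_nonneg_right hn hβ0
      linarith
    calc ψ / (192 * k) = M / (32 * k) * β * (1 / 2) := by rw [hβ]; field_simp; norm_num
      _ ≤ _ := by gcongr
  refine hstep.trans (add_le_add ?_ ?_)
  · exact mul_le_mul (by linarith) hFprod (l1_nonneg _)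
      (by
        have : ψ / (192 * k) ≤ 1 := hsucc.trans hc1
        linarith)
  have hFi : ∀ i ∈ F, 1 ≤ i := fun i hi => by
    rcases Finset.mem_union.1 hi with h | h
    · have := Finset.mem_Ioc.1 h; omega
    · have := Finset.mem_Ioc.1 (Finset.mem_sdiff.1 h).1; omega
  have hrate : ∀ i, rate p ψ L M i ≤ loMass p i := rate_le_loMass p ψ L M
  have hbound := sum_hidWeight_l1_le hα0 hβ0 hαβ F G v (3 * M) (2 * m)
    (fun i hi => by rw [hvabs]; exact_mod_cast (Finset.mem_Ioc.1 (hGsub hi)).2)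
    p (fun i => p i - (C (rate p ψ L M i) * T 0 + C (rate p ψ L M i) * T (i : ℤ)))
    (rate p ψ L M) (fun i _ => by rw [LaurentPolynomial.T_zero]; ring)
    (fun i _ => rate_nonneg hp hψ.le hL0.le M i)
    (fun i hi => by
      have := hFi i hi
      rw [((hp i).isNonneg_sub (by omega) ((hrate i).trans (min_le_left _ _))
        ((hrate i).trans (min_le_right _ _))).l1_eq, (hp i).mass_sub]
      linarith) h1
  refine hbound.trans ?_
  have hvinj : Set.InjOn v G := fun x _ y _ h => by
    have h1 := hvabs x
    rw [h, hvabs y] at h1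
    exact_mod_cast h1.symm
  have hint := integral_meanSq_mul_hidSq_le hα0 hβ0 hαβ F G hvinj (2 * m) (rate p ψ L M) h1
    (measurableSet_nearSet M)
    (a := 40 * (4 * (2 * k + 1)) * ((a : ℝ) / M) ^ (ψ / (16 * k)) *
        Real.exp (-(ψ / (96 * k) * (L - 1))))
    (b := 40 * ((a : ℝ) / M) ^ 2 * ((1 + 1 / (ψ / (96 * k))) / L))
    (by positivity) (by positivity)
    (fun θ hθ hN => meanSq_le_far hk hψ hψ1 hp hpair ha (by omega) hm hL1' hG
      (one_le_mul_dist2_of_notMem hM1 hθ hN))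
    (fun θ _ hN => meanSq_le_near hk hψ hp (by omega) hm hL1' hG
      (mul_dist2_le_one_of_mem hM1 hN))
    (volume_nearSet_le hM1)
  have hR : ∑ i ∈ F, 2 * rate p ψ L M i * i + (((2 * m : ℕ) : ℝ) + 2 * ((3 * M : ℕ) : ℝ) + 1)
      ≤ 15 * L * M := by
    have h2 := sum_rate_mul_le (p := p) hψ1 (a := a) hM1 hL1' G
    have h3 : (m : ℝ) ≤ M := by exact_mod_cast hm.trans haM
    have h4 : (M : ℝ) ≤ L * M := by nlinarith
    have h5 : (1 : ℝ) ≤ M := by exact_mod_cast hM1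
    push_cast
    linarith
  set γ := ψ / (16 * k) with hγ
  set c := ψ / (96 * k) with hc
  have hc0 : 0 < c := by positivity
  have hγ2 : γ ≤ 2 := by
    rw [hγ, div_le_iff₀ (by positivity)]; linarith
  have haM1 : (a : ℝ) / M ≤ 1 := (div_le_one hM0).2 (by exact_mod_cast haM)
  have hpow : ((a : ℝ) / M) ^ 2 ≤ ((a : ℝ) / M) ^ γ := by
    rw [← Real.rpow_natCast]
    exact Real.rpow_le_rpow_of_exponent_ge (by positivity) haM1 (by push_cast; exact hγ2)
  have hL2 := sq_mul_exp_neg_sub_one_le hc0 hL1'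
  -- One `L` from the support length and one from `β / α ≤ L / M` are absorbed by the exponential;
  -- on the arcs the `1 / L` cancels the support's `L`.
  have hfinal : 15 * L * M * (40 * (4 * (2 * k + 1)) * ((a : ℝ) / M) ^ γ *
        Real.exp (-(c * (L - 1))) * (β / α)
        + 40 * ((a : ℝ) / M) ^ 2 * ((1 + 1 / c) / L) * (2 / M))
      ≤ windowConst k ψ * ((a : ℝ) / M) ^ γ := by
    have hba : β / α ≤ L / M := by
      rw [hβ, hα, div_div_eq_mul_div, div_one, div_mul_eq_mul_div,
        div_le_div_iff₀ (by positivity) hM0]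
      have h7 : ψ * (L * M) ≤ 3 * (L * M) := mul_le_mul_of_nonneg_right (by linarith) (by positivity)
      linarith
    calc _ ≤ 15 * L * M * (40 * (4 * (2 * k + 1)) * ((a : ℝ) / M) ^ γ *
        Real.exp (-(c * (L - 1))) * (L / M)
        + 40 * ((a : ℝ) / M) ^ γ * ((1 + 1 / c) / L) * (2 / M)) := by gcongr
      _ = 15 * (160 * (2 * k + 1) * (L ^ 2 * Real.exp (-(c * (L - 1)))) + 80 * (1 + 1 / c)) *
          ((a : ℝ) / M) ^ γ := by field_simp; ring
      _ ≤ 15 * (160 * (2 * k + 1) * (2 + 4 / c ^ 2) + 80 * (1 + 1 / c)) *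
          ((a : ℝ) / M) ^ γ := by gcongr
      _ = _ := by rw [windowConst]
  have hhalf : ((a : ℝ) / M) ^ γ = (((a : ℝ) / M) ^ (ψ / (32 * k))) ^ 2 := by
    rw [← Real.rpow_natCast, ← Real.rpow_mul (by positivity)]
    congr 1; rw [hγ]; push_cast; field_simp; norm_num
  have hW : 0 ≤ windowConst k ψ := by unfold windowConst; positivity
  have hInn : 0 ≤ ∫ θ in (0 : ℝ)..1,
      meanSq (rate p ψ L M) F (2 * m) θ * hidSq α β G v θ := by
    refine intervalIntegral.integral_nonneg zero_le_one fun θ _ => ?_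
    exact mul_nonneg (meanSq_nonneg (fun i _ => rate_nonneg hp hψ.le hL0.le M i)
      (fun i hi => by linarith [two_mul_loMass_le hp (hFi i hi), hrate i]) _ _)
      (hidSq_nonneg hα0 hβ0 hαβ G v θ)
  rw [← Real.sqrt_mul' _ hInn]
  refine Real.sqrt_le_iff.2 ⟨by positivity, ?_⟩
  rw [mul_pow, Real.sq_sqrt hW, ← hhalf]
  exact (mul_le_mul hR hint hInn (by positivity)).trans hfinal

end Window

/-! ### Shifts by even numbers -/

lemma l1_one_sub_T_le (n : ℤ) : l1 (1 - T n) ≤ 2 := by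
  have h : (1 - T n : ℝ[T;T⁻¹]) = T 0 + C (-1) * T n := by simp [sub_eq_add_neg]
  rw [h]
  refine (l1_add_le _ _).trans ?_
  rw [l1_C_mul, l1_T, l1_T]; norm_num

lemma l1_shift_le_two {p : ℕ → ℝ[T;T⁻¹]} (hp : ∀ i, IsProb (p i)) (n : ℤ) (s : Finset ℕ) :
    l1 ((1 - T n) * ∏ i ∈ s, p i) ≤ 2 :=
  (l1_mul_prod_le_of_isProb s _ hp).trans (l1_one_sub_T_le n)

lemma l1_shift_anti {p : ℕ → ℝ[T;T⁻¹]} (hp : ∀ i, IsProb (p i)) (x : ℝ[T;T⁻¹]) {s t : Finset ℕ}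
    (hst : s ⊆ t) : l1 (x * ∏ i ∈ t, p i) ≤ l1 (x * ∏ i ∈ s, p i) := by
  classical
  rw [← Finset.prod_sdiff hst, mul_comm (∏ i ∈ t \ s, p i), ← mul_assoc]
  exact l1_mul_prod_le_of_isProb _ _ hp

/-- Half of the contraction `c` absorbs the forcing term, leaving the rate `1 - c / 2`. -/
lemma geometric_bound_of_recursion {t : ℕ → ℝ} {c K l C₀ : ℝ} (hl : 0 ≤ l) (hcl : 1 - c / 2 ≤ l)
    (hc1 : c ≤ 1) (hKC : K ≤ C₀ * (c / 2)) (hC : 0 ≤ C₀) (h0 : t 0 ≤ C₀)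
    (h : ∀ q, t (q + 1) ≤ (1 - c) * t q + K * l ^ q) (q : ℕ) : t q ≤ C₀ * l ^ q := by
  induction q with
  | zero => simpa using h0
  | succ q ih =>
    have hlq : 0 ≤ l ^ q := pow_nonneg hl q
    calc t (q + 1) ≤ (1 - c) * t q + K * l ^ q := h q
      _ ≤ (1 - c) * (C₀ * l ^ q) + C₀ * (c / 2) * l ^ q := by
          have : 0 ≤ 1 - c := by linarith
          gcongr
      _ = C₀ * (1 - c / 2) * l ^ q := by ring
      _ ≤ C₀ * l * l ^ q := by gcongr
      _ = _ := by ring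

theorem l1_even_shift_le (k : ℕ) (hk : 1 ≤ k) (ψ : ℝ) (hψ : 0 < ψ) (hψ1 : ψ ≤ 1) :
    ∃ K γ : ℝ, 0 < K ∧ 0 < γ ∧ ∀ p : ℕ → ℝ[T;T⁻¹], (∀ i, IsProb (p i)) → BlockPaired p k ψ →
      ∀ a m n : ℕ, 1 ≤ a → m ≤ a → 1 ≤ n →
        l1 ((1 - T ((2 * m : ℕ) : ℤ)) * ∏ i ∈ Finset.Ioc a n, p i) ≤ K * ((a : ℝ) / n) ^ γ := by
  have hk0 : (1 : ℝ) ≤ k := by exact_mod_cast hk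
  set c := ψ / (192 * k) with hc
  have hc0 : 0 < c := by positivity
  have hc1 : c ≤ 1 := by rw [hc, div_le_one (by positivity)]; linarith
  set W := √(windowConst k ψ) with hW
  have hW0 : 0 ≤ W := Real.sqrt_nonneg _
  set γ' := ψ / (32 * k) with hγ'
  have hγ'0 : 0 < γ' := by positivity
  -- The slower of the contraction rate and the decay of the forcing term per tripling of the
  -- window.
  set l := max (1 - c / 2) ((3 : ℝ) ^ (-γ')) with hl
  have hl0 : 0 < l := lt_max_of_lt_right (by positivity)
  have hl1 : l < 1 := max_lt (by linarith)
    (Real.rpow_lt_one_of_one_lt_of_neg (by norm_num) (by linarith))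
  set γ := -Real.logb 3 l with hγ
  have hγ0 : 0 < γ := by
    have := Real.logb_neg (b := 3) (by norm_num) hl0 hl1
    linarith
  have hlγ : l = (3 : ℝ) ^ (-γ) := by
    rw [hγ, neg_neg, Real.rpow_logb (by norm_num) (by norm_num) hl0]
  set C₀ := max 2 (2 * W / c) with hC₀
  have hC2 : 2 ≤ C₀ := le_max_left _ _
  have hCW : W ≤ C₀ * (c / 2) := by
    have h1 : 2 * W / c ≤ C₀ := le_max_right _ _
    have h2 := mul_le_mul_of_nonneg_right h1 (by positivity : 0 ≤ c / 2)
    calc W = 2 * W / c * (c / 2) := by field_simp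
      _ ≤ _ := h2
  refine ⟨C₀ * (48 * k) ^ γ, γ, by positivity, hγ0, fun p hp hpair a m n ha hm hn => ?_⟩
  have ha0 : (0 : ℝ) < a := by exact_mod_cast ha
  have hn0 : (0 : ℝ) < n := by exact_mod_cast hn
  -- This start makes both `a ≤ M` and `16 * k ≤ M` hold for every `M = N * 3 ^ q`.
  set N := 16 * k * a with hN
  have hN1 : 1 ≤ N := Nat.mul_pos (by omega) ha
  have hrec : ∀ q, l1 ((1 - T ((2 * m : ℕ) : ℤ)) * ∏ i ∈ Finset.Ioc a (N * 3 ^ q), p i)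
      ≤ C₀ * l ^ q := by
    refine geometric_bound_of_recursion hl0.le (le_max_left _ _) hc1 hCW (by linarith)
      ((l1_shift_le_two hp _ _).trans hC2) fun q => ?_
    have h3 : 1 ≤ 3 ^ q := Nat.one_le_pow _ _ (by norm_num)
    have h1 : a ≤ N * 3 ^ q := by
      calc a ≤ N := Nat.le_mul_of_pos_left a (by omega)
        _ ≤ N * 3 ^ q := Nat.le_mul_of_pos_right N h3
    have h2 : 16 * k ≤ N * 3 ^ q := by
      calc 16 * k ≤ N := Nat.le_mul_of_pos_right (16 * k) ha
        _ ≤ N * 3 ^ q := Nat.le_mul_of_pos_right N h3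
    have hst := window_step hk hψ hψ1 hp hpair ha h1 h2 hm
    rw [pow_succ, ← mul_assoc, mul_comm (N * 3 ^ q) 3]
    refine hst.trans ?_
    have hpow : ((a : ℝ) / (N * 3 ^ q : ℕ)) ^ γ' ≤ l ^ q := by
      have e1 : (a : ℝ) / (N * 3 ^ q : ℕ) ≤ ((3 : ℝ) ^ q)⁻¹ := by
        push_cast [hN]
        rw [← one_div, div_le_div_iff₀ (by positivity) (by positivity)]
        have : (a : ℝ) ≤ 16 * k * a := by nlinarith
        nlinarith [pow_pos (by norm_num : (0 : ℝ) < 3) q]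
      calc ((a : ℝ) / (N * 3 ^ q : ℕ)) ^ γ' ≤ (((3 : ℝ) ^ q)⁻¹) ^ γ' :=
            Real.rpow_le_rpow (by positivity) e1 hγ'0.le
        _ = ((3 : ℝ) ^ (-γ')) ^ q := by
            rw [← Real.rpow_natCast, ← Real.rpow_natCast, ← Real.rpow_neg (by norm_num),
              ← Real.rpow_mul (by norm_num), ← Real.rpow_mul (by norm_num)]
            congr 1; ring
        _ ≤ l ^ q := pow_le_pow_left₀ (by positivity) (le_max_right _ _) q
    have := mul_le_mul_of_nonneg_left hpow hW0
    linarith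
  have hrhs : C₀ * (48 * k) ^ γ * ((a : ℝ) / n) ^ γ = C₀ * (48 * k * a / n) ^ γ := by
    rw [mul_assoc, ← Real.mul_rpow (by positivity) (by positivity), mul_div_assoc]
  rw [hrhs]
  rcases lt_or_ge n N with hnN | hnN
  · refine (l1_shift_le_two hp _ _).trans (hC2.trans ?_)
    refine le_mul_of_one_le_right (by linarith) (Real.one_le_rpow ?_ hγ0.le)
    rw [one_le_div hn0]
    have : (n : ℝ) < 16 * k * a := by exact_mod_cast hnN
    nlinarith
  · set q := Nat.log 3 (n / N) with hq
    have hq1 : N * 3 ^ q ≤ n := by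
      have h1 : 3 ^ q ≤ n / N :=
        Nat.pow_log_le_self 3 (Nat.div_pos hnN (by omega)).ne'
      calc N * 3 ^ q ≤ N * (n / N) := Nat.mul_le_mul_left N h1
        _ ≤ n := Nat.mul_div_le n N
    have hq2 : n < N * 3 ^ (q + 1) := by
      have h1 : n / N < 3 ^ (q + 1) := Nat.lt_pow_succ_log_self (by norm_num) _
      rw [mul_comm]
      exact (Nat.div_lt_iff_lt_mul (by omega)).1 h1
    refine (l1_shift_anti hp _ (Finset.Ioc_subset_Ioc_right hq1)).trans ((hrec q).trans ?_)
    refine mul_le_mul_of_nonneg_left ?_ (by linarith)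
    have h1 : (n : ℝ) < 16 * k * a * 3 ^ (q + 1) := by exact_mod_cast hq2
    have h2 : ((3 : ℝ) ^ q)⁻¹ ≤ 48 * k * a / n := by
      rw [← one_div, div_le_div_iff₀ (by positivity) hn0]
      rw [pow_succ] at h1; linarith
    calc l ^ q = (((3 : ℝ) ^ q)⁻¹) ^ γ := by
          rw [hlγ, ← Real.rpow_natCast, ← Real.rpow_natCast, ← Real.rpow_neg (by norm_num),
              ← Real.rpow_mul (by norm_num), ← Real.rpow_mul (by norm_num)]
          congr 1; ring
      _ ≤ _ := Real.rpow_le_rpow (by positivity) h2 hγ0.le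

/-! ### The unit shift -/

/-- Each block contains an odd index `i` whose masses at `0` and at `i` are at least `ψ / i`. -/
def BlockOdd (p : ℕ → ℝ[T;T⁻¹]) (k : ℕ) (ψ : ℝ) : Prop :=
  ∀ j : ℕ, 1 ≤ j → ∃ i ∈ Finset.Icc (j * k + 1) ((j + 1) * k), Odd i ∧ ψ / i ≤ loMass p i

/-- With weight `2 * ρ i` the index `i` makes a fair choice, turning the unit shift into the even
shifts `i + 1` and `i - 1`; otherwise the next index is tried. The trivial bound `2` remains only if
every index fails. -/
lemma l1_unit_shift_le_of_even {p : ℕ → ℝ[T;T⁻¹]} (hp : ∀ i, IsProb (p i)) {ρ : ℕ → ℝ}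
    (s O : Finset ℕ) (hρ : ∀ i ∈ O, 0 ≤ ρ i) (hO : ∀ i ∈ O, 1 ≤ i ∧ ρ i ≤ loMass p i) {B : ℝ}
    (hB : 0 ≤ B) (h1 : ∀ i ∈ O, l1 ((1 - T ((i : ℤ) + 1)) * ∏ j ∈ s, p j) ≤ B)
    (h2 : ∀ i ∈ O, l1 ((1 - T ((i : ℤ) - 1)) * ∏ j ∈ s, p j) ≤ B) :
    l1 ((1 - T 1) * ((∏ i ∈ O, p i) * ∏ j ∈ s, p j)) ≤ 2 * ∏ i ∈ O, (1 - 2 * ρ i) + B := by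
  classical
  induction O using Finset.induction_on with
  | empty => simpa using (l1_shift_le_two hp 1 s).trans (by linarith)
  | insert i O hi ih =>
    have ih' := ih (fun j hj => hρ j (by simp [hj])) (fun j hj => hO j (by simp [hj]))
      (fun j hj => h1 j (by simp [hj])) (fun j hj => h2 j (by simp [hj]))
    obtain ⟨hi1, hiρ⟩ := hO i (by simp)
    have hρi := hρ i (by simp)
    have hhalf : 0 ≤ 1 - 2 * ρ i := by
      have := two_mul_loMass_le hp hi1; linarith
    set κ := p i - (C (ρ i) * T 0 + C (ρ i) * T (i : ℤ)) with hκ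
    have hκ1 : l1 κ = 1 - 2 * ρ i := by
      rw [hκ, ((hp i).isNonneg_sub (by omega) (hiρ.trans (min_le_left _ _))
        (hiρ.trans (min_le_right _ _))).l1_eq, (hp i).mass_sub]; ring
    have hdec : (1 - T 1) * ((∏ j ∈ insert i O, p j) * ∏ j ∈ s, p j)
        = C (ρ i) * (((1 - T ((i : ℤ) + 1)) * ∏ j ∈ s, p j) * ∏ j ∈ O, p j)
          + (C (-ρ i) * (T 1 * (((1 - T ((i : ℤ) - 1)) * ∏ j ∈ s, p j) * ∏ j ∈ O, p j))
          + κ * ((1 - T 1) * ((∏ j ∈ O, p j) * ∏ j ∈ s, p j))) := by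
      have e : (T (i : ℤ) : ℝ[T;T⁻¹]) = T ((i : ℤ) - 1) * T 1 := by
        rw [← LaurentPolynomial.T_add]; congr 1; ring
      rw [Finset.prod_insert hi, LaurentPolynomial.T_add, hκ, LaurentPolynomial.T_zero, e, map_neg]
      ring
    have b1 : l1 (((1 - T ((i : ℤ) + 1)) * ∏ j ∈ s, p j) * ∏ j ∈ O, p j) ≤ B :=
      (l1_mul_prod_le_of_isProb O _ hp).trans (h1 i (by simp))
    have b2 : l1 (((1 - T ((i : ℤ) - 1)) * ∏ j ∈ s, p j) * ∏ j ∈ O, p j) ≤ B :=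
      (l1_mul_prod_le_of_isProb O _ hp).trans (h2 i (by simp))
    rw [hdec, Finset.prod_insert hi]
    refine (l1_add_le _ _).trans ((add_le_add_right (l1_add_le _ _) _).trans ?_)
    have b3 := l1_mul_le κ ((1 - T 1) * ((∏ j ∈ O, p j) * ∏ j ∈ s, p j))
    rw [hκ1] at b3
    rw [l1_C_mul, l1_C_mul, l1_T_mul, abs_neg, abs_of_nonneg hρi]
    have b4 := mul_le_mul_of_nonneg_left ih' hhalf
    have b5 := mul_le_mul_of_nonneg_left b1 hρi
    have b6 := mul_le_mul_of_nonneg_left b2 hρi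
    linarith

theorem l1_unit_shift_le (k : ℕ) (hk : 1 ≤ k) (ψ : ℝ) (hψ : 0 < ψ) (hψ1 : ψ ≤ 1) :
    ∃ K γ : ℝ, 0 < K ∧ 0 < γ ∧ ∀ p : ℕ → ℝ[T;T⁻¹], (∀ i, IsProb (p i)) → BlockPaired p k ψ →
      BlockOdd p k ψ → ∀ a n : ℕ, a < n →
        l1 ((1 - T 1) * ∏ i ∈ Finset.Ioc a n, p i) ≤ K * (((a : ℝ) + 1) / n) ^ γ := by
  classical
  have hk0 : (1 : ℝ) ≤ k := by exact_mod_cast hk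
  obtain ⟨K, γ, hK, hγ, heven⟩ := l1_even_shift_le k hk ψ hψ hψ1
  set δ := min (ψ / k) (γ / 2) with hδ
  have hδ0 : 0 < δ := lt_min (by positivity) (by positivity)
  refine ⟨2 * (2 * (2 * k + 1)) ^ (2 * ψ / k) + K, δ, by positivity, hδ0,
    fun p hp hpair hodd a n han => ?_⟩
  -- Moving the left end to `a + 1` covers `a = 0`, for which the logarithmic sum bound has no
  -- content.
  set b := a + 1 with hb
  have hbn : b ≤ n := han
  have hbc : (a : ℝ) + 1 = (b : ℕ) := by push_cast [hb]; ring
  rw [hbc]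
  have hb0 : (0 : ℝ) < b := by exact_mod_cast (by omega : 0 < b)
  have hn0 : (0 : ℝ) < n := by exact_mod_cast (by omega : 0 < n)
  -- The geometric mean makes both `b / r` and `r / n` of order `√(b / n)`.
  set r := Nat.sqrt (b * n) with hr
  have hr1 : r * r ≤ b * n := Nat.sqrt_le _
  have hr2 : b * n < (r + 1) * (r + 1) := Nat.lt_succ_sqrt _
  have hbr : b ≤ r := Nat.le_sqrt.2 (Nat.mul_le_mul_left b hbn)
  have hr0 : (0 : ℝ) < r := by exact_mod_cast (by omega : 0 < r)
  set x := (b : ℝ) / n with hx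
  have hx0 : 0 < x := by positivity
  have hx1 : x ≤ 1 := (div_le_one hn0).2 (by exact_mod_cast hbn)
  have hrx : (r : ℝ) / n ≤ x ^ (1 / 2 : ℝ) := by
    rw [← Real.sqrt_eq_rpow]
    refine Real.le_sqrt_of_sq_le ?_
    have h : (r : ℝ) * r ≤ b * n := by exact_mod_cast hr1
    rw [hx, div_pow, div_le_div_iff₀ (by positivity) hn0]
    nlinarith
  have hbx : (b : ℝ) / r ≤ 2 * x ^ (1 / 2 : ℝ) := by
    have h : (b : ℝ) * n ≤ (2 * r) * (2 * r) := by
      have h1 : b * n ≤ (2 * r) * (2 * r) :=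
        hr2.le.trans (Nat.mul_le_mul (by omega) (by omega))
      exact_mod_cast h1
    have h2 : ((b : ℝ) / r / 2) ^ 2 ≤ x := by
      rw [hx, div_div, div_pow, div_le_div_iff₀ (by positivity) hn0]
      nlinarith
    have h3 := Real.le_sqrt_of_sq_le h2
    rw [Real.sqrt_eq_rpow] at h3
    linarith
  set O := (Finset.Ioc b r).filter fun i => Odd i ∧ ψ / i ≤ loMass p i with hO
  set s := Finset.Ioc r n with hs
  have hmem : ∀ i ∈ O, b < i ∧ i ≤ r ∧ Odd i ∧ ψ / i ≤ loMass p i := fun i hi => by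
    obtain ⟨h1, h2⟩ := Finset.mem_filter.1 hi
    exact ⟨(Finset.mem_Ioc.1 h1).1, (Finset.mem_Ioc.1 h1).2, h2⟩
  have hdisj : Disjoint O s := Finset.disjoint_left.2 fun i hi hi' => by
    have := (hmem i hi).2.1
    have := (Finset.mem_Ioc.1 hi').1
    omega
  have hsub : O ∪ s ⊆ Finset.Ioc a n := by
    refine Finset.union_subset (fun i hi => ?_) (Finset.Ioc_subset_Ioc_left (by omega))
    have h1 := hmem i hi
    have hrn : r ≤ n := by
      by_contra hc
      have := Nat.mul_lt_mul'' (not_le.1 hc) (not_le.1 hc)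
      have := Nat.mul_le_mul_right n hbn
      omega
    exact Finset.mem_Ioc.2 ⟨by omega, by omega⟩
  refine (l1_shift_anti hp _ hsub).trans ?_
  rw [Finset.prod_union hdisj]
  have hev : ∀ m : ℕ, m ≤ r → l1 ((1 - T ((2 * m : ℕ) : ℤ)) * ∏ i ∈ s, p i)
      ≤ K * ((r : ℝ) / n) ^ γ := fun m hm => heven p hp hpair r m n (by omega) hm (by omega)
  have hmain := l1_unit_shift_le_of_even hp (ρ := fun i => ψ / i) s O
    (fun i _ => by positivity) (fun i hi => ⟨by have := (hmem i hi).1; omega, (hmem i hi).2.2.2⟩)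
    (B := K * ((r : ℝ) / n) ^ γ) (by positivity)
    (fun i hi => by
      obtain ⟨h1, h2, ⟨t, rfl⟩, -⟩ := hmem i hi
      rw [show ((2 * t + 1 : ℕ) : ℤ) + 1 = ((2 * (t + 1) : ℕ) : ℤ) by push_cast; ring]
      exact hev (t + 1) (by omega))
    (fun i hi => by
      obtain ⟨h1, h2, ⟨t, rfl⟩, -⟩ := hmem i hi
      rw [show ((2 * t + 1 : ℕ) : ℤ) - 1 = ((2 * t : ℕ) : ℤ) by push_cast; ring]
      exact hev t (by omega))
  refine hmain.trans ?_
  have hsum := log_le_sum_blocks (Q := fun i => Odd i ∧ ψ / i ≤ loMass p i) hk hodd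
    (by omega : 1 ≤ b) r
  have hprod : ∏ i ∈ O, (1 - 2 * (ψ / (i : ℝ))) ≤ ((2 * k + 1) * b / r) ^ (2 * ψ / k) := by
    calc ∏ i ∈ O, (1 - 2 * (ψ / (i : ℝ))) ≤ ∏ i ∈ O, Real.exp (-(2 * (ψ / (i : ℝ)))) := by
          refine Finset.prod_le_prod (fun i hi => ?_) fun i _ => Real.one_sub_le_exp_neg _
          have h1 := hmem i hi
          have := two_mul_loMass_le hp (by omega : 1 ≤ i)
          linarith [h1.2.2.2]
      _ = Real.exp (-(2 * ψ * ∑ i ∈ O, 1 / (i : ℝ))) := by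
          rw [← Real.exp_sum, Finset.sum_neg_distrib, Finset.mul_sum]
          congr 2; exact Finset.sum_congr rfl fun i _ => by ring
      _ ≤ Real.exp (-(2 * ψ / k * Real.log (r / ((2 * k + 1) * b)))) := by
          refine Real.exp_le_exp.2 (neg_le_neg ?_)
          have := mul_le_mul_of_nonneg_left hsum (by positivity : 0 ≤ 2 * ψ)
          calc _ = 2 * ψ * (1 / k * Real.log (r / ((2 * k + 1) * b))) := by ring
            _ ≤ _ := this
      _ = _ := exp_neg_mul_log hr0 (by positivity)
  have hodd' : ((2 * k + 1) * b / r) ^ (2 * ψ / k)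
      ≤ (2 * (2 * k + 1)) ^ (2 * ψ / k) * x ^ δ := by
    calc (((2 * k + 1) * b / r : ℝ)) ^ (2 * ψ / k)
        ≤ (2 * (2 * k + 1) * x ^ (1 / 2 : ℝ)) ^ (2 * ψ / k) := by
          refine Real.rpow_le_rpow (by positivity) ?_ (by positivity)
          rw [mul_div_assoc]
          have := mul_le_mul_of_nonneg_left hbx (by positivity : (0 : ℝ) ≤ 2 * k + 1)
          linarith
      _ = (2 * (2 * k + 1)) ^ (2 * ψ / k) * x ^ (ψ / k) := by
          rw [Real.mul_rpow (by positivity) (by positivity), ← Real.rpow_mul hx0.le]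
          congr 2; ring
      _ ≤ _ := mul_le_mul_of_nonneg_left
          (Real.rpow_le_rpow_of_exponent_ge hx0 hx1 (min_le_left _ _)) (by positivity)
  have heven' : K * ((r : ℝ) / n) ^ γ ≤ K * x ^ δ := by
    refine mul_le_mul_of_nonneg_left ?_ hK.le
    calc ((r : ℝ) / n) ^ γ ≤ (x ^ (1 / 2 : ℝ)) ^ γ :=
          Real.rpow_le_rpow (by positivity) hrx hγ.le
      _ = x ^ (γ / 2) := by rw [← Real.rpow_mul hx0.le]; congr 1; ring
      _ ≤ _ := Real.rpow_le_rpow_of_exponent_ge hx0 hx1 (min_le_right _ _)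
  rw [add_mul]
  refine add_le_add ?_ heven'
  linarith [hprod.trans hodd']

/-! ### Laws of sums of independent variables as Laurent polynomials -/

/-- The mass that the coefficients of a Laurent polynomial give to a set of integers. -/
def setMass (A : Set ℤ) : ℝ[T;T⁻¹] →+ ℝ :=
  (Finsupp.linearCombination ℝ (A.indicator (1 : ℤ → ℝ))).toAddMonoidHom.comp
    AddMonoidAlgebra.coeffAddEquiv.toAddMonoidHom

lemma setMass_apply (A : Set ℤ) (p : ℝ[T;T⁻¹]) :
    setMass A p = ∑ x ∈ p.coeff.support, p.coeff x * A.indicator (1 : ℤ → ℝ) x := rfl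

lemma setMass_C_mul_T (A : Set ℤ) (c : ℝ) (x : ℤ) :
    setMass A (C c * T x) = c * A.indicator (1 : ℤ → ℝ) x := by
  rw [← LaurentPolynomial.single_eq_C_mul_T]
  exact Finsupp.linearCombination_single _ _ _

lemma setMass_C_mul_T_mul (A : Set ℤ) (c : ℝ) (v : ℤ) (q : ℝ[T;T⁻¹]) :
    setMass A (C c * (T v * q)) = c * setMass {z | v + z ∈ A} q := by
  conv_lhs => rw [eq_sum_C_mul_T q]
  rw [Finset.mul_sum, Finset.mul_sum, map_sum, setMass_apply, Finset.mul_sum]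
  refine Finset.sum_congr rfl fun x _ => ?_
  have h : C c * (T v * (C (q.coeff x) * T x)) = C (c * q.coeff x) * T (v + x) := by
    rw [LaurentPolynomial.T_add, map_mul]; ring
  rw [h, setMass_C_mul_T, mul_assoc]
  rfl

lemma abs_setMass_le (A : Set ℤ) (p : ℝ[T;T⁻¹]) : |setMass A p| ≤ l1 p := by
  rw [setMass_apply]
  refine (Finset.abs_sum_le_sum_abs _ _).trans (Finset.sum_le_sum fun x _ => ?_)
  rw [abs_mul]
  refine mul_le_of_le_one_right (abs_nonneg _) ?_
  by_cases h : x ∈ A <;> simp [h]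

variable {Ω : Type*} [MeasurableSpace Ω] {P : Measure Ω}

/-- The law of `Y`, restricted to `{0, ..., N - 1}`. -/
def lawPoly (P : Measure Ω) (Y : Ω → ℕ) (N : ℕ) : ℝ[T;T⁻¹] :=
  ∑ x ∈ Finset.range N, C (P.real {ω | Y ω = x}) * T (x : ℤ)

lemma isProb_lawPoly [IsProbabilityMeasure P] {Y : Ω → ℕ} {N : ℕ} (hY : Measurable Y)
    (hN : ∀ ω, Y ω < N) : IsProb (lawPoly P Y N) where
  nonneg := IsNonneg.sum fun x _ => (isNonneg_T _).C_mul measureReal_nonneg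
  mass_eq := by
    simp only [lawPoly, map_sum, map_mul, mass_C, mass_T, mul_one]
    have h := measureReal_biUnion_finset (μ := P) (s := Finset.range N)
      (f := fun x => {ω | Y ω = x})
      (fun x _ y _ hxy => Set.disjoint_left.2 fun ω h1 h2 => hxy (h1.symm.trans h2))
      fun x _ => hY (measurableSet_singleton x)
    rw [← h]
    have : (⋃ x ∈ Finset.range N, {ω | Y ω = x}) = Set.univ := by
      ext ω; simp [hN ω]
    rw [this, probReal_univ]

lemma coeff_lawPoly (Y : Ω → ℕ) {N x : ℕ} (hx : x < N) :
    (lawPoly P Y N).coeff x = P.real {ω | Y ω = x} := by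
  have h : ∀ s : Finset ℕ, (∑ y ∈ s, C (P.real {ω | Y ω = y}) * T (y : ℤ)).coeff (x : ℤ)
      = ∑ y ∈ s, if y = x then P.real {ω | Y ω = y} else 0 := fun s => by
    induction s using Finset.induction_on with
    | empty => simp
    | insert a s ha ih =>
      rw [Finset.sum_insert ha, Finset.sum_insert ha, AddMonoidAlgebra.coeff_add,
        Finsupp.add_apply, ih, coeff_C_mul, LaurentPolynomial.T_apply]
      simp
  rw [lawPoly, h, Finset.sum_ite_eq' , if_pos (Finset.mem_range.2 hx)]

/-- Condition on the value of one variable at a time; the induction therefore needs every set `A`,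
not a fixed one. -/
lemma real_sum_mem_eq_setMass [IsProbabilityMeasure P] {Y : ℕ+ → Ω → ℕ} {N : ℕ+ → ℕ}
    (hY : ∀ i, Measurable (Y i)) (hN : ∀ i ω, Y i ω < N i) (hind : iIndepFun Y P)
    (s : Finset ℕ+) (A : Set ℤ) :
    P.real {ω | (((∑ i ∈ s, Y i ω : ℕ)) : ℤ) ∈ A} = setMass A (∏ i ∈ s, lawPoly P (Y i) (N i)) := by
  classical
  induction s using Finset.induction_on generalizing A with
  | empty =>
    have h : (1 : ℝ[T;T⁻¹]) = C 1 * T 0 := by simp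
    rw [Finset.prod_empty, h, setMass_C_mul_T]
    by_cases h0 : (0 : ℤ) ∈ A <;> simp [h0]
  | insert j s hj ih =>
    have hsplit : {ω | (((∑ i ∈ insert j s, Y i ω : ℕ)) : ℤ) ∈ A}
        = ⋃ v ∈ Finset.range (N j), ({ω | Y j ω = v} ∩
          {ω | (((∑ i ∈ s, Y i ω : ℕ)) : ℤ) ∈ {z : ℤ | (v : ℤ) + z ∈ A}}) := by
      ext ω
      simp only [Finset.sum_insert hj, Set.mem_ofPred_eq, Set.mem_iUnion, Set.mem_inter_iff,
        Finset.mem_range, exists_prop]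
      constructor
      · intro h
        exact ⟨Y j ω, hN j ω, rfl, by push_cast at h ⊢; exact h⟩
      · rintro ⟨v, -, hv, h⟩
        rw [hv]; push_cast at h ⊢; exact h
    have hmeas : Measurable fun ω => ∑ i ∈ s, Y i ω :=
      Finset.measurable_sum s fun i _ => hY i
    have hpre : ∀ v : ℕ, {ω | (((∑ i ∈ s, Y i ω : ℕ)) : ℤ) ∈ {z : ℤ | (v : ℤ) + z ∈ A}}
        = (∑ i ∈ s, Y i) ⁻¹' {x : ℕ | (v : ℤ) + x ∈ A} := fun v => by
      ext ω; simp [Finset.sum_apply]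
    have hI : IndepFun (Y j) (∑ i ∈ s, Y i) P :=
      (hind.indepFun_finsetSum_of_notMem hY hj).symm
    have hmeas' : Measurable (∑ i ∈ s, Y i) := by
      convert hmeas using 1; ext ω; simp
    rw [hsplit, measureReal_biUnion_finset, Finset.prod_insert hj, lawPoly, Finset.sum_mul, map_sum]
    · refine Finset.sum_congr rfl fun v _ => ?_
      rw [mul_assoc, setMass_C_mul_T_mul, ← ih, hpre, measureReal_def, measureReal_def,
        measureReal_def, ← ENNReal.toReal_mul]
      congr 1
      exact hI.measure_inter_preimage_eq_mul {v} _ (measurableSet_singleton v) trivial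
    · intro x _ y _ hxy
      exact Set.disjoint_left.2 fun ω h1 h2 => hxy (h1.1.symm.trans h2.1)
    · intro v _
      rw [hpre]
      exact (hY j (measurableSet_singleton v)).inter (hmeas' trivial)

lemma exists_real_le_lt [IsProbabilityMeasure P] {S : Ω → ℕ} (hS : Measurable S) {ε : ℝ}
    (hε : 0 < ε) : ∃ K : ℕ, P.real {ω | K ≤ S ω} < ε := by
  have h := tendsto_measure_iInter_atTop (μ := P) (s := fun K : ℕ => {ω | K ≤ S ω})
    (fun K => (hS (measurableSet_Ici (a := K))).nullMeasurableSet)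
    (fun K L hKL ω hω => hKL.trans hω) ⟨0, measure_ne_top _ _⟩
  have he : (⋂ K : ℕ, {ω | K ≤ S ω}) = ∅ := by
    ext ω
    simp only [Set.mem_iInter, Set.mem_ofPred_eq, Set.mem_empty_iff_false, iff_false, not_forall,
      not_le]
    exact ⟨S ω + 1, Nat.lt_succ_self _⟩
  rw [he, measure_empty] at h
  have h' := (ENNReal.tendsto_toReal ENNReal.zero_ne_top).comp h
  obtain ⟨K, hK⟩ := (h'.eventually (gt_mem_nhds (by simpa using hε))).exists
  exact ⟨K, hK⟩

lemma abs_real_sub_real_le [IsProbabilityMeasure P] {A B D : Set Ω} (h1 : A ⊆ B ∪ D)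
    (h2 : B ⊆ A ∪ D) : |P.real A - P.real B| ≤ P.real D := by
  have e1 := (measureReal_mono (μ := P) h1).trans (measureReal_union_le _ _)
  have e2 := (measureReal_mono (μ := P) h2).trans (measureReal_union_le _ _)
  exact abs_le.2 ⟨by linarith, by linarith⟩

/-! ### Truncation and transfer to the random variables. -/

/-- Truncation of the `i`-th variable, which keeps the values `0, ..., K + i`. -/
def trunc (K i x : ℕ) : ℕ := if i ≠ 0 ∧ x < K + i + 1 then x else 0

lemma trunc_lt (K i x : ℕ) : trunc K i x < K + i + 1 := by
  unfold trunc; split_ifs <;> omega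

lemma measurable_trunc_comp {X : ℕ → Ω → ℕ} (hX : ∀ i, 1 ≤ i → Measurable (X i)) (K i : ℕ) :
    Measurable fun ω => trunc K i (X i ω) := by
  -- No measurability is available for `X 0`; truncation replaces it by the constant zero.
  rcases Nat.eq_zero_or_pos i with h | h
  · subst h; simp [trunc]
  · exact (measurable_of_countable (trunc K i)).comp (hX i h)

/-- The laws of the truncated variables. -/
def truncLaw (P : Measure Ω) (X : ℕ → Ω → ℕ) (K i : ℕ) : ℝ[T;T⁻¹] :=
  lawPoly P (fun ω => trunc K i (X i ω)) (K + i + 1)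

section Trunc

variable [IsProbabilityMeasure P] {X : ℕ → Ω → ℕ}

lemma isProb_truncLaw (hX : ∀ i, 1 ≤ i → Measurable (X i)) (K i : ℕ) :
    IsProb (truncLaw P X K i) :=
  isProb_lawPoly (measurable_trunc_comp hX K i) fun _ => trunc_lt _ _ _

/-- Truncation sends the discarded values to `0`, so the mass there can only grow; the value `i` is
always kept for `i ≥ 1`. -/
lemma real_zero_le_coeff_truncLaw (K i : ℕ) :
    P.real {ω | X i ω = 0} ≤ (truncLaw P X K i).coeff 0 := by
  have h := coeff_lawPoly (P := P) (fun ω => trunc K i (X i ω)) (by omega : 0 < K + i + 1)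
  rw [Nat.cast_zero] at h
  rw [truncLaw, h]
  exact measureReal_mono fun ω hω => by
    simp only [Set.mem_ofPred_eq] at hω ⊢
    rw [hω]; simp [trunc]

lemma real_self_le_coeff_truncLaw (K i : ℕ) :
    P.real {ω | X i ω = i} ≤ (truncLaw P X K i).coeff i := by
  have h := coeff_lawPoly (P := P) (fun ω => trunc K i (X i ω)) (by omega : i < K + i + 1)
  rw [truncLaw, h]
  exact measureReal_mono fun ω hω => by
    simp only [Set.mem_ofPred_eq] at hω ⊢
    rw [hω]; unfold trunc; split_ifs <;> omega

lemma blockPaired_truncLaw {k : ℕ} {ψ ψ' : ℝ} (hψ : ψ' ≤ ψ)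
    (h : PairCondition P X (Set.range fun g : ℕ => 2 ^ (g + 1)) k ψ) (K : ℕ) :
    BlockPaired (truncLaw P X K) k ψ' := by
  intro g j hj
  obtain ⟨i, ⟨-, hi⟩, hmem⟩ := h _ ⟨g, rfl⟩ j hj
  refine ⟨i, Finset.mem_Icc.2 ⟨hmem.1, hmem.2⟩, ?_⟩
  have hle : ψ' / (i + 2 ^ (g + 1) : ℕ) ≤ pairOverlap P X i (2 ^ (g + 1)) := by
    refine le_trans ?_ hi
    push_cast
    exact div_le_div_of_nonneg_right hψ (by positivity)
  have h0 := fun j => real_zero_le_coeff_truncLaw (P := P) (X := X) K j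
  have h1 := fun j => real_self_le_coeff_truncLaw (P := P) (X := X) K j
  exact ⟨(hle.trans (min_le_left _ _)).trans (mul_le_mul (h0 _) (by exact_mod_cast h1 (i + 2 ^ (g + 1)))
      measureReal_nonneg (measureReal_nonneg.trans (h0 _))),
    (hle.trans (min_le_right _ _)).trans (mul_le_mul (h1 _) (h0 _)
      measureReal_nonneg (measureReal_nonneg.trans (h1 _)))⟩

lemma blockOdd_truncLaw {k : ℕ} {ψ ψ' : ℝ} (hψ : ψ' ≤ ψ) (h : OddCondition P X k ψ) (K : ℕ) :
    BlockOdd (truncLaw P X K) k ψ' := by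
  intro j hj
  obtain ⟨i, ⟨hodd, hi⟩, hmem⟩ := h j hj
  refine ⟨i, Finset.mem_Icc.2 ⟨hmem.1, hmem.2⟩, hodd, ?_⟩
  have hle : ψ' / i ≤ singleOverlap P X i :=
    le_trans (div_le_div_of_nonneg_right hψ (by positivity)) hi
  exact le_min ((hle.trans (min_le_left _ _)).trans (real_zero_le_coeff_truncLaw K i))
    ((hle.trans (min_le_right _ _)).trans (real_self_le_coeff_truncLaw K i))

lemma real_truncSum_mem (hX : ∀ i, 1 ≤ i → Measurable (X i))
    (hind : iIndepFun (fun i : ℕ+ => X (i : ℕ)) P) (K a n : ℕ) (A : Set ℤ) :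
    P.real {ω | ((∑ i ∈ Finset.Ioc a n, trunc K i (X i ω) : ℕ) : ℤ) ∈ A}
      = setMass A (∏ i ∈ Finset.Ioc a n, truncLaw P X K i) := by
  have hpos : ∀ x ∈ Finset.Ioc a n, 0 < x := fun x hx => by
    have := (Finset.mem_Ioc.1 hx).1; omega
  have hind' : iIndepFun (fun (i : ℕ+) ω => trunc K i (X i ω)) P :=
    hind.comp (fun (i : ℕ+) => trunc K i) fun _ => measurable_of_countable _
  have h := real_sum_mem_eq_setMass (N := fun i : ℕ+ => K + i + 1)
    (fun i => measurable_trunc_comp hX K i) (fun i ω => trunc_lt K i _) hind'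
    ((Finset.Ioc a n).subtype fun x => 0 < x) A
  have h1 : ∀ ω, ∑ i ∈ (Finset.Ioc a n).subtype (fun x => 0 < x), trunc K i (X i ω)
      = ∑ i ∈ Finset.Ioc a n, trunc K i (X i ω) := fun ω =>
    Finset.sum_subtype_of_mem (fun i => trunc K i (X i ω)) hpos
  have h2 : ∏ i ∈ (Finset.Ioc a n).subtype (fun x => 0 < x), truncLaw P X K i
      = ∏ i ∈ Finset.Ioc a n, truncLaw P X K i :=
    Finset.prod_subtype_of_mem (fun i => truncLaw P X K i) hpos
  rw [← h2]
  refine Eq.trans ?_ h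
  congr 1
  ext ω
  simp only [Set.mem_ofPred_eq]
  rw [← h1 ω]
  rfl

lemma measurable_partialSum (hX : ∀ i, 1 ≤ i → Measurable (X i)) (a n : ℕ) :
    Measurable (partialSum X a n) :=
  Finset.measurable_sum _ fun i hi => hX i (by have := (Finset.mem_Ioc.1 hi).1; omega)

lemma truncSum_eq_partialSum {Ω : Type*} {X : ℕ → Ω → ℕ} {K a n : ℕ} {ω : Ω}
    (h : partialSum X a n ω < K) :
    ∑ i ∈ Finset.Ioc a n, trunc K i (X i ω) = partialSum X a n ω := by
  refine Finset.sum_congr rfl fun i hi => ?_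
  have h1 : X i ω ≤ partialSum X a n ω :=
    Finset.single_le_sum (f := fun i => X i ω) (fun _ _ => Nat.zero_le _) hi
  have h2 := (Finset.mem_Ioc.1 hi).1
  rw [trunc, if_pos ⟨by omega, by omega⟩]

/-- The bound `b` does not depend on the truncation level, and the truncated sum differs from the
original with arbitrarily small probability, so no error survives. -/
lemma dTV_partialSum_le (hX : ∀ i, 1 ≤ i → Measurable (X i))
    (hind : iIndepFun (fun i : ℕ+ => X (i : ℕ)) P) (a n : ℕ) {b : ℝ}
    (hb : ∀ K, l1 ((1 - T 1) * ∏ i ∈ Finset.Ioc a n, truncLaw P X K i) ≤ b) :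
    dTV (P.map (partialSum X a n)) (P.map fun ω => partialSum X a n ω + 1) ≤ b := by
  have hS := measurable_partialSum hX a n
  refine ciSup_le fun A => ?_
  rw [map_measureReal_apply hS trivial,
    map_measureReal_apply (hS.add_const 1) trivial]
  refine le_of_forall_pos_le_add fun ε hε => ?_
  obtain ⟨K, hK⟩ := exists_real_le_lt (P := P) hS (half_pos hε)
  set S := partialSum X a n with hSdef
  set S' : Ω → ℕ := fun ω => ∑ i ∈ Finset.Ioc a n, trunc K i (X i ω) with hS'
  have heq : ∀ ω, ω ∉ {ω | K ≤ S ω} → S' ω = S ω := fun ω hω =>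
    truncSum_eq_partialSum (not_le.1 hω)
  have hclose : ∀ B : Set ℕ, |P.real (S ⁻¹' B) - P.real (S' ⁻¹' B)| ≤ P.real {ω | K ≤ S ω} :=
    fun B => by
    refine abs_real_sub_real_le (fun ω hω => ?_) fun ω hω => ?_
    · by_cases h : ω ∈ {ω | K ≤ S ω}
      · exact Or.inr h
      · exact Or.inl (by rw [Set.mem_preimage, heq ω h]; exact hω)
    · by_cases h : ω ∈ {ω | K ≤ S ω}
      · exact Or.inr h
      · exact Or.inl (by rw [Set.mem_preimage, ← heq ω h]; exact hω)
  set q := ∏ i ∈ Finset.Ioc a n, truncLaw P X K i with hq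
  set A' : Set ℤ := {z | ∃ x ∈ A, (x : ℤ) = z} with hA'
  have e1 : P.real (S' ⁻¹' A) = setMass A' q := by
    rw [hq, ← real_truncSum_mem hX hind]
    congr 1; ext ω
    simp only [hA', Set.mem_preimage, Set.mem_ofPred_eq, Nat.cast_inj, exists_eq_right, hS']
  have e2 : P.real (S' ⁻¹' {x | x + 1 ∈ A}) = setMass A' (T 1 * q) := by
    have := setMass_C_mul_T_mul A' 1 1 q
    rw [map_one, one_mul, one_mul] at this
    rw [this, hq, ← real_truncSum_mem hX hind]
    congr 1; ext ω
    simp only [hA', Set.mem_preimage, Set.mem_ofPred_eq, hS']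
    constructor
    · intro h; exact ⟨_, h, by push_cast; ring⟩
    · rintro ⟨x, hx, hxe⟩
      have : x = ∑ i ∈ Finset.Ioc a n, trunc K i (X i ω) + 1 := by
        have : (x : ℤ) = ((∑ i ∈ Finset.Ioc a n, trunc K i (X i ω) + 1 : ℕ) : ℤ) := by
          rw [hxe]; push_cast; ring
        exact_mod_cast this
      rwa [← this]
  have e3 : |P.real (S' ⁻¹' A) - P.real (S' ⁻¹' {x | x + 1 ∈ A})| ≤ b := by
    rw [e1, e2, ← map_sub]
    refine (abs_setMass_le _ _).trans ?_
    rw [show q - T 1 * q = (1 - T 1) * q by ring]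
    exact hb K
  have c1 := hclose A
  have c2 := hclose {x | x + 1 ∈ A}
  have hpre : (fun ω => S ω + 1) ⁻¹' A = S ⁻¹' {x | x + 1 ∈ A} := rfl
  rw [hpre]
  have := abs_le.1 c1
  have := abs_le.1 c2
  have := abs_le.1 e3
  exact abs_le.2 ⟨by linarith, by linarith⟩

end Trunc

end

end UnitShift

theorem mainTheorem7 (k : ℕ) (hk : 1 ≤ k) (ψ : ℝ) (hψ : 0 < ψ) :
    ∃ C γ : ℝ, 0 < C ∧ 0 < γ ∧
      ∀ (Ω : Type*) [MeasurableSpace Ω] (P : Measure Ω) [IsProbabilityMeasure P]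
        (X : ℕ → Ω → ℕ),
        (∀ i : ℕ, 1 ≤ i → Measurable (X i)) →
        iIndepFun (fun (i : ℕ+) => X (i : ℕ)) P →
        UnitShift.PairCondition P X (Set.range fun g : ℕ => 2 ^ (g + 1)) k ψ →
        UnitShift.OddCondition P X k ψ →
        ∀ a n : ℕ, a < n →
          UnitShift.dTV (P.map (UnitShift.partialSum X a n))
              (P.map fun ω => UnitShift.partialSum X a n ω + 1)
            ≤ C * (((a : ℝ) + 1) / (n : ℝ)) ^ γ := by
  -- Lowering `ψ` weakens both overlap conditions, so `ψ ≤ 1` may be assumed.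
  obtain ⟨K, γ, hK, hγ, h⟩ := UnitShift.l1_unit_shift_le k hk (min ψ 1)
    (lt_min hψ one_pos) (min_le_right _ _)
  refine ⟨K, γ, hK, hγ, fun Ω _ P _ X hX hind hpair hodd a n han => ?_⟩
  exact UnitShift.dTV_partialSum_le hX hind a n fun L =>
    h _ (UnitShift.isProb_truncLaw hX L)
      (UnitShift.blockPaired_truncLaw (min_le_left _ _) hpair L)
      (UnitShift.blockOdd_truncLaw (min_le_left _ _) hodd L) a n han
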